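/- Let $X$ be a separated Noetherian scheme (for instance a complex algebraic variety that carries a positive line bundle), and let $\mathcal F$, $\mathcal G$ be coherent $\mathcal O_X$-modules. Let $\mathcal{E}xt^p(\mathcal F,\mathcal G)=H^p(R\mathcal{H}om(\mathcal F,\mathcal G))$ denote the Ext sheaves, and for an open $U\subseteq X$ let $\mathrm{Ext}^p_{\mathcal O_U}(\mathcal F|_U,\mathcal G|_U)\to\Gamma(U,\mathcal{E}xt^p(\mathcal F,\mathcal G))$ be the canonical map. A $p$-extension of $\mathcal G|_U$ by $\mathcal F|_U$ is an exact sequence of $\mathcal O_U$-modules $$0\to\mathcal G|_U\to\mathcal H_{p-1}\to\dots\to\mathcal H_0\to\mathcal F|_U\to 0 ;$$ it has a class in $\mathrm{Ext}^p_{\mathcal O_U}(\mathcal F|_U,\mathcal G|_U)$, hence in $\Gamma(U,\mathcal{E}xt^p(\mathcal F,\mathcal G))$. Let $\mathfrak U=\{U_\alpha\}$ be an open covering of $X$ that is sufficiently fine, in the sense that each $U_\alpha$ is contained in an affine open subset of $X$. Write $U_{\alpha_0\dots\alpha_q}=\bigcap_{j=0}^q U_{\alpha_j}$. Let $p>0$,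 $q\ge 0$ and $x\in H^q(X,\mathcal{E}xt^p(\mathcal F,\mathcal G))$. 1. There is a Čech $q$-cocycle $c=(c_{\alpha_0\dots\alpha_q})$ of $\mathfrak U$ with values in $\mathcal{E}xt^p(\mathcal F,\mathcal G)$ which represents $x$, and such that for all $\alpha_0,\dots,\alpha_q$ the section $c_{\alpha_0\dots\alpha_q}$ is the class of a $p$-extension of $\mathcal G|_{U_{\alpha_0\dots\alpha_q}}$ by $\mathcal F|_{U_{\alpha_0\dots\alpha_q}}$ all of whose terms are coherent. 2. If moreover every $U_\alpha$ is affine, then for every Čech $q$-cocycle $c$ of $\mathfrak U$ which represents $x$ and for all $\alpha_0,\dots,\alpha_q$, the section $c_{\alpha_0\dots\alpha_q}$ is the class of a $p$-extension of $\mathcal G|_{U_{\alpha_0\dots\alpha_q}}$ by $\mathcal F|_{U_{\alpha_0\dots\alpha_q}}$ with coherent terms, and any two $p$-extensions of $\mathcal G|_{U_{\alpha_0\dots\alpha_q}}$ by $\mathcal F|_{U_{\alpha_0\dots\alpha_q}}$ with this class are Yoneda equivalent. Thus each element of $H^q(X,\mathcal{E}xt^p(\mathcal F,\mathcal G))$ with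 $p>0$ determines local $p$-extensions of $\mathcal G$ by $\mathcal F$ on the sets $U_{\alpha_0\dots\alpha_q}$. -/

import Mathlib

open CategoryTheory Limits AlgebraicGeometry Opposite TopologicalSpace
universe u

/-! ### Enough injectives in categories of sheaves of modules -/

theorem PresheafOfModules.ab5 {C : Type u} [SmallCategory C] (R : Cᵒᵖ ⥤ RingCat.{u}) :
    AB5OfSize.{u, u} (PresheafOfModules.{u} R) where
  ofShape K _ _ := by
    have : ReflectsFiniteLimits (PresheafOfModules.toPresheaf.{u} R) :=
      ⟨fun J _ _ => reflectsLimitsOfShape_of_reflectsIsomorphisms⟩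
    exact HasExactColimitsOfShape.domain_of_functor K (PresheafOfModules.toPresheaf.{u} R)

theorem SheafOfModules.hasSeparator' {C : Type u} [SmallCategory C]
    {J : GrothendieckTopology C} (R : Sheaf J RingCat.{u}) :
    HasSeparator (SheafOfModules.{u} R) := by
  let adj := PresheafOfModules.sheafificationAdjunction.{u} (𝟙 R.obj)
  let S : C → SheafOfModules.{u} R := fun c => (PresheafOfModules.sheafification (𝟙 R.obj)).obj
    ((PresheafOfModules.free R.obj).obj (yoneda.obj c))
  have hS : ObjectProperty.IsSeparating (.ofObj S) := by
    intro M N f g h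
    apply (SheafOfModules.forget.{u} R ⋙ PresheafOfModules.restrictScalars (𝟙 R.obj)).map_injective
    refine PresheafOfModules.freeYoneda.isSeparating R.obj _ _ ?_
    rintro _ ⟨c⟩ k
    have := congrArg (adj.homEquiv _ _) (h _ ⟨c⟩ ((adj.homEquiv _ _).symm k))
    rwa [Adjunction.homEquiv_naturality_right, Adjunction.homEquiv_naturality_right,
      Equiv.apply_symm_apply] at this
  exact ⟨_, hS.isSeparator_coproduct⟩

theorem SheafOfModules.isGrothendieckAbelian {C : Type u} [SmallCategory C]
    {J : GrothendieckTopology C} (R : Sheaf J RingCat.{u}) :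
    IsGrothendieckAbelian.{u} (SheafOfModules.{u} R) where
  ab5OfSize := ⟨fun K _ _ => by
    have := PresheafOfModules.ab5 R.obj
    exact (PresheafOfModules.sheafificationAdjunction.{u} (𝟙 R.obj)).hasExactColimitsOfShape K⟩
  hasSeparator := SheafOfModules.hasSeparator' R

/-! ### Yoneda extensions -/

namespace CategoryTheory

/-- A `p`-fold extension of `G` by `F` in an abelian category: an exact sequence
`0 ⟶ G ⟶ H_{p-1} ⟶ ⋯ ⟶ H_0 ⟶ F ⟶ 0`. Here `seq` is the sequence
`seq 0 ⟶ seq 1 ⟶ ⋯ ⟶ seq p ⟶ seq (p + 1)`, whose end terms are identified with `G` and `F`. -/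
structure YonedaExtension {C : Type*} [Category* C] [Abelian C] (p : ℕ) (F G : C) where
  seq : ComposableArrows C (p + 1)
  exact : seq.Exact
  mono_left : Mono (seq.map (homOfLE (Fin.castSucc_le_succ (0 : Fin (p + 1)))))
  epi_right : Epi (seq.map (homOfLE (Fin.castSucc_le_succ (Fin.last p))))
  isoLeft : seq.obj 0 ≅ G
  isoRight : seq.obj (Fin.last (p + 1)) ≅ F

namespace YonedaExtension

variable {C : Type*} [Category* C] [Abelian C] {p : ℕ} {F G : C}

/-- The `k`-th map `seq k ⟶ seq (k + 1)` of an extension. -/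
def arrow (S : YonedaExtension p F G) (k : Fin (p + 1)) : S.seq.obj k.castSucc ⟶ S.seq.obj k.succ :=
  S.seq.map (homOfLE (Fin.castSucc_le_succ k))

/-- There is a morphism of exact sequences `S ⟶ S'` inducing the identity on `G` and on `F`. -/
def HasMorphism (S S' : YonedaExtension p F G) : Prop :=
  ∃ φ : S.seq ⟶ S'.seq, φ.app 0 ≫ S'.isoLeft.hom = S.isoLeft.hom ∧
    φ.app (Fin.last (p + 1)) ≫ S'.isoRight.hom = S.isoRight.hom

/-- Yoneda equivalence of `p`-fold extensions. -/
def Equivalent (S S' : YonedaExtension p F G) : Prop :=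
  Relation.EqvGen HasMorphism S S'

end YonedaExtension

end CategoryTheory

/-! ### Čech cochains and sheaf cohomology classes -/

namespace TopCat.Sheaf

/-- The intersection `U_{α_0} ∩ ⋯ ∩ U_{α_q}`. -/
def cechOpen {X : TopCat.{u}} {I : Type u} (U : I → Opens X) {q : ℕ} (α : Fin (q + 1) → I) :
    Opens X := ⨅ j, U (α j)

/-- Čech `q`-cochains of the family `U` with values in `A`. -/
abbrev CechCochain {X : TopCat.{u}} (A : TopCat.Sheaf Ab.{u} X) {I : Type u} (U : I → Opens X)
    (q : ℕ) : Type u :=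
  ∀ α : Fin (q + 1) → I, A.obj.obj (op (cechOpen U α))

theorem cechOpen_le {X : TopCat.{u}} {I : Type u} (U : I → Opens X) {q : ℕ}
    (α : Fin (q + 2) → I) (k : Fin (q + 2)) : cechOpen U α ≤ cechOpen U (α ∘ k.succAbove) :=
  le_iInf fun j => iInf_le _ (k.succAbove j)

/-- The Čech coboundary
`(δb)_{α_0…α_{q+1}} = ∑ₖ (-1)ᵏ b_{α_0…α̂_k…α_{q+1}}|_{U_{α_0…α_{q+1}}}`. -/
noncomputable def cechδ {X : TopCat.{u}} {A : TopCat.Sheaf Ab.{u} X} {I : Type u}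
    {U : I → Opens X} {q : ℕ} (b : CechCochain A U q) : CechCochain A U (q + 1) := fun α =>
  ∑ k : Fin (q + 2), (-1 : ℤ) ^ (k : ℕ) •
    A.obj.map (homOfLE (cechOpen_le U α k)).op (b (α ∘ k.succAbove))

/-- The cochain obtained by applying a morphism of sheaves. -/
def CechCochain.map {X : TopCat.{u}} {A B : TopCat.Sheaf Ab.{u} X} (f : A ⟶ B) {I : Type u}
    {U : I → Opens X} {q : ℕ} (b : CechCochain A U q) : CechCochain B U q := fun α =>
  f.hom.app _ (b α)

/-- `CechRepresents U q A c x`: under the canonical homomorphism from Čech cohomology of the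
covering `U` to sheaf cohomology, the class of the cocycle `c` is sent to `x ∈ H^q(X, A)`.

In degree `0`, the cocycle consists of the restrictions of the global section `x`. In degree
`q + 1`, the canonical homomorphism is determined by its compatibility with connecting
homomorphisms: for a short exact sequence `0 ⟶ A ⟶ B ⟶ Q ⟶ 0` and a `q`-cochain `b` of `B` whose
image in `Q` is a cocycle representing `y ∈ H^q(X, Q)`, the cocycle `δb`, which takes its values
in `A`, represents the image of `y` under the connecting homomorphism `H^q(X, Q) → H^{q+1}(X, A)`.
-/
def CechRepresents {X : TopCat.{u}} {I : Type u} (U : I → Opens X) :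
    ∀ (q : ℕ) (A : TopCat.Sheaf Ab.{u} X), CechCochain A U q → Sheaf.H A q → Prop
  | 0, A, c, x => ∀ α, c α =
      A.obj.map (homOfLE (le_top : cechOpen U α ≤ ⊤)).op (Sheaf.H.equiv₀ A isTerminalTop x)
  | q + 1, A, c, x => ∃ (B Q : TopCat.Sheaf Ab.{u} X) (f : A ⟶ B) (g : B ⟶ Q) (w : f ≫ g = 0)
      (h : (ShortComplex.mk f g w).ShortExact) (b : CechCochain B U q) (y : Sheaf.H Q q),
      CechRepresents U q Q (b.map g) y ∧ c.map f = cechδ b ∧ x = y.comp h.extClass rfl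

end TopCat.Sheaf

/-! ### Sheaves of modules on schemes -/

namespace AlgebraicGeometry.Scheme.Modules

instance (X : Scheme.{u}) : IsGrothendieckAbelian.{u} X.Modules :=
  SheafOfModules.isGrothendieckAbelian X.ringCatSheaf

/-- Coherent sheaves on a (locally) Noetherian scheme: quasi-coherent modules whose sections over
every affine open subset form a finitely generated module. -/
structure IsCoherent {X : Scheme.{u}} (M : X.Modules) : Prop where
  isQuasicoherent : M.IsQuasicoherent
  finite : ∀ U : X.Opens, IsAffineOpen U → Module.Finite Γ(X, U) Γ(M, U)

/-- `Hom_{𝒪_U}(F|_U, G|_U)` for an open subset `U`: compatible families of `𝒪(V)`-linear maps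
`F(V) → G(V)`, for all open `V ⊆ U`. -/
def localHom {X : Scheme.{u}} (F G : X.Modules) (U : X.Opens) :
    AddSubgroup (∀ V : Set.Iic U, (Γ(F, V.1) →+ Γ(G, V.1))) where
  carrier := {φ |
    (∀ (V : Set.Iic U) (r : Γ(X, V.1)) (s : Γ(F, V.1)), φ V (r • s) = r • φ V s) ∧
    (∀ (V W : Set.Iic U) (h : W.1 ≤ V.1) (s : Γ(F, V.1)),
      φ W (F.presheaf.map (homOfLE h).op s) = G.presheaf.map (homOfLE h).op (φ V s))}
  zero_mem' := by simp
  add_mem' := by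
    rintro φ ψ ⟨h₁, h₂⟩ ⟨h₃, h₄⟩
    exact ⟨fun V r s => by simp [h₁, h₃], fun V W h s => by simp [h₂ V W h, h₄ V W h]⟩
  neg_mem' := by
    rintro φ ⟨h₁, h₂⟩
    exact ⟨fun V r s => by simp [h₁], fun V W h s => by simp [h₂ V W h]⟩

/-- The presheaf `U ↦ Hom_{𝒪_U}(F|_U, G|_U)` of abelian groups. -/
noncomputable def homPresheaf {X : Scheme.{u}} (F G : X.Modules) : TopCat.Presheaf Ab.{u} X where
  obj U := AddCommGrpCat.of (localHom F G U.unop)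
  map i := AddCommGrpCat.ofHom
    { toFun φ := ⟨fun W => φ.1 ⟨W.1, W.2.trans i.unop.le⟩,
        fun W => φ.2.1 ⟨W.1, W.2.trans i.unop.le⟩, fun W W' =>
          φ.2.2 ⟨W.1, W.2.trans i.unop.le⟩ ⟨W'.1, W'.2.trans i.unop.le⟩⟩
      map_zero' := rfl
      map_add' _ _ := rfl }
  map_id _ := rfl
  map_comp _ _ := rfl

theorem homPresheaf_isSheaf {X : Scheme.{u}} (F G : X.Modules) : (homPresheaf F G).IsSheaf := by
  rw [TopCat.Presheaf.isSheaf_iff_isSheafUniqueGluing]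
  intro ι U (sf : ∀ i, localHom F G (U i)) hsf
  have mem {W U : X.Opens} (h : W ≤ U) : W ∈ Set.Iic U := h
  -- compatible values on a common open subset
  have key : ∀ (i j : ι) (W : X.Opens) (hi : W ≤ U i) (hj : W ≤ U j),
      (sf i).1 ⟨W, hi⟩ = (sf j).1 ⟨W, hj⟩ := fun i j W hi hj =>
    congrFun (congrArg Subtype.val (hsf i j)) ⟨W, le_inf hi hj⟩
  let GS : TopCat.Sheaf Ab.{u} X := ⟨G.presheaf, G.isSheaf⟩
  have cov : ∀ V : Set.Iic (iSup U), V.1 ≤ ⨆ i, V.1 ⊓ U i := fun V => by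
    rw [← inf_iSup_eq]; exact le_inf le_rfl V.2
  have ex : ∀ (V : Set.Iic (iSup U)) (s : Γ(F, V.1)), ∃! t : Γ(G, V.1), ∀ i,
      G.presheaf.map (homOfLE (inf_le_left : V.1 ⊓ U i ≤ V.1)).op t =
        (sf i).1 ⟨V.1 ⊓ U i, mem (inf_le_right)⟩
          (F.presheaf.map (homOfLE (inf_le_left : V.1 ⊓ U i ≤ V.1)).op s) := by
    intro V s
    refine GS.existsUnique_gluing' (fun i => V.1 ⊓ U i) V.1 (fun i => homOfLE inf_le_left) (cov V)
      (fun i => (sf i).1 ⟨V.1 ⊓ U i, mem (inf_le_right)⟩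
          (F.presheaf.map (homOfLE (inf_le_left : V.1 ⊓ U i ≤ V.1)).op s)) ?_
    intro i j
    have hi := (sf i).2.2 ⟨V.1 ⊓ U i, mem (inf_le_right)⟩
      ⟨(V.1 ⊓ U i) ⊓ (V.1 ⊓ U j), mem (inf_le_left.trans inf_le_right)⟩ inf_le_left
      (F.presheaf.map (homOfLE (inf_le_left : V.1 ⊓ U i ≤ V.1)).op s)
    have hj := (sf j).2.2 ⟨V.1 ⊓ U j, mem (inf_le_right)⟩
      ⟨(V.1 ⊓ U i) ⊓ (V.1 ⊓ U j), mem (inf_le_right.trans inf_le_right)⟩ inf_le_right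
      (F.presheaf.map (homOfLE (inf_le_left : V.1 ⊓ U j ≤ V.1)).op s)
    refine hi.symm.trans (Eq.trans ?_ hj)
    refine (DFunLike.congr_fun (key i j _ (inf_le_left.trans inf_le_right)
      (inf_le_right.trans inf_le_right)) _).trans ?_
    rw [← ConcreteCategory.comp_apply, ← ConcreteCategory.comp_apply,
      ← Functor.map_comp, ← Functor.map_comp]
    rfl
  choose t ht htu using ex
  have sep : ∀ (V : Set.Iic (iSup U)) (a b : Γ(G, V.1)),
      (∀ i, G.presheaf.map (homOfLE (inf_le_left : V.1 ⊓ U i ≤ V.1)).op a =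
        G.presheaf.map (homOfLE (inf_le_left : V.1 ⊓ U i ≤ V.1)).op b) → a = b := fun V a b h =>
    GS.eq_of_locally_eq' (fun i => V.1 ⊓ U i) V.1 (fun i => homOfLE inf_le_left) (cov V) a b h
  let φ : localHom F G (iSup U) := ⟨fun V =>
      { toFun := t V
        map_zero' := sep V _ _ fun i => by simp [ht]
        map_add' := fun a b => sep V _ _ fun i => by simp [ht] }, by
    refine ⟨fun V r s => sep V _ _ fun i => ?_, fun V W h s => sep W _ _ fun i => ?_⟩
    · have := (sf i).2.1 ⟨V.1 ⊓ U i, mem (inf_le_right)⟩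
      simp [ht, this]
    · have h' : W.1 ⊓ U i ≤ V.1 ⊓ U i := inf_le_inf_right _ h
      have h1 := (sf i).2.2 ⟨V.1 ⊓ U i, mem (inf_le_right)⟩ ⟨W.1 ⊓ U i, mem (inf_le_right)⟩ h'
        (F.presheaf.map (homOfLE (inf_le_left : V.1 ⊓ U i ≤ V.1)).op s)
      have h2 := congrArg (G.presheaf.map (homOfLE h').op) (ht V s i)
      refine (ht W _ i).trans (Eq.trans ?_ (h1.trans (h2.symm.trans ?_)))
      · rw [← ConcreteCategory.comp_apply, ← ConcreteCategory.comp_apply,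
          ← Functor.map_comp, ← Functor.map_comp]
        rfl
      · change _ = G.presheaf.map _ (G.presheaf.map _ (t V s))
        rw [← ConcreteCategory.comp_apply, ← ConcreteCategory.comp_apply,
          ← Functor.map_comp, ← Functor.map_comp]
        rfl⟩
  refine ⟨φ, fun i => Subtype.ext (funext fun V => AddMonoidHom.ext fun s => ?_), fun ψ hψ =>
    Subtype.ext (funext fun V => AddMonoidHom.ext fun s => htu V s _ fun i => ?_)⟩
  · have hV : V.1 ≤ iSup U := V.2.trans (le_iSup U i)
    refine sep ⟨V.1, hV⟩ _ _ fun j => (ht ⟨V.1, hV⟩ s j).trans ?_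
    refine (DFunLike.congr_fun (key j i _ inf_le_right (inf_le_left.trans V.2)) _).trans ?_
    exact (sf i).2.2 V ⟨V.1 ⊓ U j, mem (inf_le_left.trans V.2)⟩ inf_le_left s
  · rw [← hψ i]
    exact (ψ.2.2 V ⟨V.1 ⊓ U i, mem (inf_le_left.trans V.2)⟩ inf_le_left s).symm

/-- The functor `𝓗om(F, -)` from `𝒪_X`-modules to sheaves of abelian groups. -/
noncomputable def homSheaf {X : Scheme.{u}} (F : X.Modules) :
    X.Modules ⥤ TopCat.Sheaf Ab.{u} X where
  obj G := ⟨homPresheaf F G, homPresheaf_isSheaf F G⟩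
  map {G G'} g := ⟨
    { app U := AddCommGrpCat.ofHom (X := localHom F G U.unop) (Y := localHom F G' U.unop)
        { toFun φ := ⟨fun V => (g.app V.1).hom.comp (φ.1 V),
            fun V r s => by simp [φ.2.1 V r s], fun V W h s => by
              have := ConcreteCategory.congr_hom (g.mapPresheaf.naturality (homOfLE h).op) (φ.1 V s)
              simpa [φ.2.2 V W h s] using this⟩
          map_zero' := by ext; simp
          map_add' _ _ := by ext; simp } }⟩
  map_id G := rfl
  map_comp f g := rfl

instance {X : Scheme.{u}} (F : X.Modules) : (homSheaf F).Additive where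

/-- The complex of sheaves `𝓗om(F, I^•)`, where `I^•` is an injective resolution of `G`. -/
noncomputable def extComplex {X : Scheme.{u}} (F G : X.Modules) :
    CochainComplex (TopCat.Sheaf Ab.{u} X) ℕ :=
  ((homSheaf F).mapHomologicalComplex _).obj (injectiveResolution G).cocomplex

/-- The sheaf `𝓔xt^p(F, G) = H^p(R𝓗om(F, G))`. -/
noncomputable def extSheaf {X : Scheme.{u}} (F G : X.Modules) (p : ℕ) : TopCat.Sheaf Ab.{u} X :=
  (extComplex F G).homology p

/-- The augmentation `G ⟶ I^0` of the injective resolution of `G`. -/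
noncomputable def augmentation {X : Scheme.{u}} (G : X.Modules) :
    G ⟶ (injectiveResolution G).cocomplex.X 0 :=
  (injectiveResolution G).ι.f 0

/-- The `p`-fold extension `S` of `G|_U` by `F|_U` has class `e ∈ Γ(U, 𝓔xt^p(F, G))`, that is, `e`
is the image of the class of `S` under `Ext^p_{𝒪_U}(F|_U, G|_U) → Γ(U, 𝓔xt^p(F, G))`.

Explicitly, the identity of `G|_U` extends to a morphism `φ` from
`0 ⟶ G|_U ⟶ H_{p-1} ⟶ ⋯ ⟶ H_0 ⟶ F|_U` to `0 ⟶ G|_U ⟶ I^0|_U ⟶ ⋯ ⟶ I^{p-1}|_U ⟶ I^p|_U`; its last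
component is a section `z` over `U` of the kernel of `𝓗om(F, I^p) ⟶ 𝓗om(F, I^{p+1})`, and `e` is
the class of `z`. -/
def HasExtClass {X : Scheme.{u}} {F G : X.Modules} {p : ℕ} {U : X.Opens}
    (S : YonedaExtension p (F.restrict U.ι) (G.restrict U.ι))
    (e : (extSheaf F G p).obj.obj (op U)) : Prop :=
  ∃ (φ : ∀ k : Fin (p + 1),
      S.seq.obj k.succ ⟶ ((injectiveResolution G).cocomplex.X k).restrict U.ι)
    (z : localHom F ((injectiveResolution G).cocomplex.X p) U)
    (w : ((extComplex F G).cycles p).obj.obj (op U)),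
    S.arrow 0 ≫ φ 0 = S.isoLeft.hom ≫ (restrictFunctor U.ι).map (augmentation G) ∧
    (∀ k : Fin p, S.arrow k.succ ≫ φ k.succ = φ k.castSucc ≫
      (restrictFunctor U.ι).map ((injectiveResolution G).cocomplex.d k (k + 1))) ∧
    (∀ (W : U.toScheme.Opens) (hW : U.ι ''ᵁ W ≤ U) (s : Γ(F, U.ι ''ᵁ W)),
      z.1 ⟨U.ι ''ᵁ W, hW⟩ s = (S.isoRight.inv ≫ φ (Fin.last p)).app W s) ∧
    ((extComplex F G).iCycles p).hom.app (op U) w = z ∧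
    ((extComplex F G).homologyπ p).hom.app (op U) w = e

end AlgebraicGeometry.Scheme.Modules

/-! Everything rests on one vanishing: for coherent `F`, `G` on a locally Noetherian scheme,
`𝓔xt^p(F, G)` has no higher cohomology on an affine open `V` (`acyclicOn_extSheaf`). The terms of
`𝓗om(F, I^•)` are flasque, so the cycles of this complex are acyclic on `V` as well
(`AcyclicOn.cycles`). Hence every section of `𝓔xt^p` over `V` lifts to a cocycle `z : F|_V ⟶
I^p|_V`, and two cocycles with the same class differ by the coboundary of a section over `V`.

The vanishing is proved on `Spec R`. If `E` is injective over a Noetherian ring, Artin–Rees makes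
`E~` flasque (`isFlasque_tilde`), so every `M~` is acyclic. For finite `M`, `𝓗om(M~, N~)` is the
sheaf of `Hom(M, N)`, which settles `p = 0`. For `p > 0` the sequence `0 ⟶ K ⟶ R^n ⟶ M ⟶ 0` shifts
the degree, because `𝓗om` out of a free sheaf is exact (`acyclicOn_homology_homComplex`);
quasi-coherence of the higher Ext sheaves is not needed. The passage from `X` to `Spec R` uses that
restriction to an open subscheme preserves injectives (`injective_restrict`).

Existence (`exists_extension_mapTo`): given `z`, the extension is built from the right. Each syzygy
is covered by a free sheaf of finite rank, whose map to the resolution lifts because the relevant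
cocycles are coboundaries. At the left end the last syzygy maps to `G = ker d⁰`, and a pushout along
this map puts `G` in its place.

Uniqueness (`equivalent_of_mapTo`): pulling the truncated resolution back along `z` gives an
extension that receives a morphism from every extension mapping to `I^•` over `z`. If two extensions
have cohomologous cocycles, a homotopy first makes the cocycles equal (`MapTo.exists_homotopic`).

For part 1, the sets `U_α` are enlarged to affine opens `V_α`. Their intersections are affine since
`X` is separated, so Leray's argument represents `x` by a cocycle on the `V_α`
(`exists_cechRepresents`). The extensions found on the affine intersections are then restricted. -/

namespace CategoryTheory

/-! ### Splicing Yoneda extensions and mapping them to sequences -/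

theorem ShortComplex.Exact.comp_mono {C : Type*} [Category* C] [HasZeroMorphisms C]
    {X Y Z W : C} {f : X ⟶ Y} {g : Y ⟶ Z} {w : f ≫ g = 0} (h : (ShortComplex.mk f g w).Exact)
    (m : Z ⟶ W) [Mono m] (w' : f ≫ g ≫ m = 0) : (ShortComplex.mk f (g ≫ m) w').Exact := by
  let φ : ShortComplex.mk f g w ⟶ ShortComplex.mk f (g ≫ m) w' :=
    { τ₁ := 𝟙 _, τ₂ := 𝟙 _, τ₃ := m }
  have : Epi φ.τ₁ := inferInstanceAs (Epi (𝟙 _))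
  have : IsIso φ.τ₂ := inferInstanceAs (IsIso (𝟙 _))
  have : Mono φ.τ₃ := inferInstanceAs (Mono m)
  exact (ShortComplex.exact_iff_of_epi_of_isIso_of_mono φ).1 h

theorem ShortComplex.exact_epi_comp_iff {C : Type*} [Category* C] [HasZeroMorphisms C]
    {W X Y Z : C} {f : X ⟶ Y} {g : Y ⟶ Z} (w : f ≫ g = 0) (e : W ⟶ X) [Epi e]
    (w' : (e ≫ f) ≫ g = 0) :
    (ShortComplex.mk (e ≫ f) g w').Exact ↔ (ShortComplex.mk f g w).Exact := by
  let φ : ShortComplex.mk (e ≫ f) g w' ⟶ ShortComplex.mk f g w :=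
    { τ₁ := e, τ₂ := 𝟙 _, τ₃ := 𝟙 _ }
  have : Epi φ.τ₁ := inferInstanceAs (Epi e)
  have : IsIso φ.τ₂ := inferInstanceAs (IsIso (𝟙 _))
  have : Mono φ.τ₃ := inferInstanceAs (Mono (𝟙 _))
  exact ShortComplex.exact_iff_of_epi_of_isIso_of_mono φ

namespace YonedaExtension

variable {C : Type*} [Category* C] [Abelian C] {n : ℕ} {F K : C}

/-- The term of an extension next to its left end. -/
abbrev first (S : YonedaExtension n F K) : C := S.seq.obj (Fin.succ 0)

/-- The monomorphism from the left end of an extension to its first term. -/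
def inl (S : YonedaExtension n F K) : K ⟶ S.first :=
  S.isoLeft.inv ≫ S.arrow 0

/-- The maps between consecutive terms of an extension, without the leftmost one. -/
def tailArrow (S : YonedaExtension n F K) (k : Fin n) :
    S.seq.obj k.castSucc.succ ⟶ S.seq.obj k.succ.succ :=
  S.arrow k.succ

/-- The leftmost map of an extension. -/
def firstArrow (S : YonedaExtension n F K) : S.seq.obj 0 ⟶ S.first := S.arrow 0

theorem firstArrow_eq (S : YonedaExtension n F K) : S.firstArrow = S.isoLeft.hom ≫ S.inl :=
  (S.isoLeft.hom_inv_id_assoc (S.arrow 0)).symm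

instance mono_inl (S : YonedaExtension n F K) : Mono S.inl :=
  @mono_comp _ _ _ _ _ _ _ _ S.mono_left

/-- The map from the first term to the second term. -/
def secondArrow (S : YonedaExtension (n + 1) F K) :
    S.first ⟶ S.seq.obj (Fin.succ (Fin.succ 0)) := S.tailArrow 0

theorem firstArrow_comp_secondArrow (S : YonedaExtension (n + 1) F K) :
    S.firstArrow ≫ S.secondArrow = 0 := S.exact.toIsComplex.zero 0 (by omega)

theorem inl_comp_secondArrow (S : YonedaExtension (n + 1) F K) : S.inl ≫ S.secondArrow = 0 := by
  have h := S.firstArrow_comp_secondArrow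
  rw [firstArrow_eq] at h
  exact (cancel_epi S.isoLeft.hom).1 ((Category.assoc _ _ _).symm.trans (h.trans comp_zero.symm))

theorem exact_inl (S : YonedaExtension (n + 1) F K) :
    (ShortComplex.mk _ _ S.inl_comp_secondArrow).Exact := by
  have h' : (ShortComplex.mk _ _ S.firstArrow_comp_secondArrow).Exact := S.exact.exact 0 (by omega)
  refine (ShortComplex.exact_epi_comp_iff S.inl_comp_secondArrow S.isoLeft.hom ?_).1 ?_
  · rw [← firstArrow_eq, firstArrow_comp_secondArrow]
  · convert h' using 2
    exact S.firstArrow_eq.symm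

theorem isIso_inl (S : YonedaExtension 0 F K) : IsIso S.inl := by
  have h : Epi (S.arrow 0) := S.epi_right
  have : Epi S.inl := epi_comp _ _
  exact isIso_of_mono_of_epi _

theorem isComplex_δ₀ (S : YonedaExtension n F K) : S.seq.δ₀.IsComplex :=
  ⟨fun i hi => S.exact.toIsComplex.zero (i + 1)⟩

/-- A morphism to the terms of an extension, extended by one step to a complex, induces a morphism
to its left end. -/
theorem exists_lift_inl (S : YonedaExtension n F K) {R : ComposableArrows C (n + 1)}
    (hR : R.IsComplex) (θ : R.δ₀ ⟶ S.seq.δ₀) :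
    ∃ c : R.obj' 0 ⟶ K, c ≫ S.inl = R.map' 0 1 ≫ θ.app 0 := by
  cases n with
  | zero =>
    have := S.isIso_inl
    obtain ⟨b, hb⟩ : ∃ b : S.first ⟶ K, b ≫ S.inl = 𝟙 _ := ⟨inv S.inl, by simp⟩
    exact ⟨(R.map' 0 1 ≫ θ.app 0) ≫ b,
      (Category.assoc _ _ _).trans ((_ ≫= hb).trans (Category.comp_id _))⟩
  | succ n =>
    have h : (R.map' 0 1 ≫ θ.app 0) ≫ S.secondArrow = 0 := by
      have h1 : R.map' 1 2 ≫ θ.app 1 = θ.app 0 ≫ S.secondArrow :=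
        θ.naturality (homOfLE (show (0 : Fin (n + 2)) ≤ 1 from Fin.zero_le _))
      have h2 : R.map' 0 1 ≫ R.map' 1 2 = 0 := hR.zero 0
      refine (Category.assoc _ _ _).trans ((_ ≫= h1.symm).trans ?_)
      exact (Category.assoc _ _ _).symm.trans ((h2 =≫ _).trans zero_comp)
    exact ⟨S.exact_inl.lift _ h, S.exact_inl.lift_f _ h⟩

section splice

variable (S : YonedaExtension n F K) (T : ShortComplex C) (e : T.X₃ ⟶ K)

/-- The composition `T.X₂ ⟶ K ⟶ S.seq 1`. -/
noncomputable def spliceArrow : T.X₂ ⟶ S.first := (T.g ≫ e) ≫ S.inl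

theorem f_comp_spliceArrow : T.f ≫ S.spliceArrow T e = 0 := by
  rw [spliceArrow, Category.assoc, T.zero_assoc, zero_comp]

theorem spliceArrow_comp (S : YonedaExtension (n + 1) F K) :
    S.spliceArrow T e ≫ S.secondArrow = 0 := by
  rw [spliceArrow, Category.assoc, inl_comp_secondArrow, comp_zero]

/-- Yoneda product with a short exact sequence on the left. -/
noncomputable def splice (hT : T.ShortExact) [IsIso e] : YonedaExtension (n + 1) F T.X₁ where
  seq := (S.seq.δ₀.precomp (S.spliceArrow T e)).precomp T.f
  exact := by
    have := hT.epi_g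
    refine ComposableArrows.exact_of_δ₀ ?_ ?_
    · refine ComposableArrows.exact₂_mk _ (S.f_comp_spliceArrow T e) ?_
      have h1 : T.f ≫ T.g ≫ e = 0 := by rw [T.zero_assoc, zero_comp]
      have : (ShortComplex.mk T.f (T.g ≫ e) h1).Exact :=
        ShortComplex.Exact.comp_mono (w := T.zero) hT.exact e h1
      exact this.comp_mono S.inl (S.f_comp_spliceArrow T e)
    · cases n with
      | zero => exact ComposableArrows.exact₁ _
      | succ n =>
        refine ComposableArrows.exact_of_δ₀ ?_ S.exact.δ₀
        refine ComposableArrows.exact₂_mk _ (S.spliceArrow_comp T e) ?_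
        exact (ShortComplex.exact_epi_comp_iff S.inl_comp_secondArrow (T.g ≫ e)
          (S.spliceArrow_comp T e)).2 S.exact_inl
  mono_left := hT.mono_f
  epi_right := by
    have := hT.epi_g
    cases n with
    | zero =>
      have := S.isIso_inl
      exact epi_comp (T.g ≫ e) S.inl
    | succ n => exact S.epi_right
  isoLeft := Iso.refl _
  isoRight := S.isoRight

theorem splice_inl (hT : T.ShortExact) [IsIso e] : (S.splice T e hT).inl = T.f :=
  Category.id_comp _

end splice

/-- The extension `0 ⟶ F ⟶ F ⟶ 0`. -/
noncomputable def trivial (F : C) : YonedaExtension 0 F F where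
  seq := ComposableArrows.mk₁ (𝟙 F)
  exact := ComposableArrows.exact₁ _
  mono_left := inferInstanceAs (Mono (𝟙 F))
  epi_right := inferInstanceAs (Epi (𝟙 F))
  isoLeft := Iso.refl _
  isoRight := Iso.refl _

/-- A morphism from the positive part of an extension to a sequence of morphisms. -/
structure MapTo (S : YonedaExtension n F K) {J : ℕ → C} (d : ∀ k, J k ⟶ J (k + 1)) where
  φ : ∀ k : Fin (n + 1), S.seq.obj k.succ ⟶ J k
  comm : ∀ k : Fin n, S.tailArrow k ≫ φ k.succ = φ k.castSucc ≫ d k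

namespace MapTo

variable {J : ℕ → C} {d : ∀ k, J k ⟶ J (k + 1)}

/-- The component of a `MapTo` at the first term. -/
def first {S : YonedaExtension n F K} (φ : S.MapTo d) : S.first ⟶ J 0 := φ.φ 0

/-- The component of a `MapTo` at the second term. -/
def second {S : YonedaExtension (n + 1) F K} (φ : S.MapTo d) :
    S.seq.obj (Fin.succ (Fin.succ 0)) ⟶ J 1 := φ.φ (Fin.succ 0)

/-- The component of a `MapTo` at the right end. -/
def last {S : YonedaExtension n F K} (φ : S.MapTo d) : F ⟶ J n :=
  S.isoRight.inv ≫ φ.φ (Fin.last n)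

/-- Extension of a `MapTo` along a Yoneda product. -/
noncomputable def splice {S : YonedaExtension n F K} (φ : S.MapTo (fun k => d (k + 1)))
    (T : ShortComplex C) (hT : T.ShortExact) (e : T.X₃ ⟶ K) [IsIso e] (b : T.X₂ ⟶ J 0)
    (hb : S.spliceArrow T e ≫ φ.first = b ≫ d 0) :
    (S.splice T e hT).MapTo d where
  φ k := Fin.cases (motive := fun k => (S.splice T e hT).seq.obj k.succ ⟶ J k) b φ.φ k
  comm k := Fin.cases (motive := fun k => (S.splice T e hT).tailArrow k ≫
      (Fin.cases (motive := fun k => (S.splice T e hT).seq.obj k.succ ⟶ J k) b φ.φ k.succ) =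
      (Fin.cases (motive := fun k => (S.splice T e hT).seq.obj k.succ ⟶ J k) b φ.φ k.castSucc) ≫
        d k) hb (fun k => by
      cases n with
      | zero => exact k.elim0
      | succ n => exact φ.comm k) k

/-- The left end lands in the cycles of `J 0`: for `n > 0` since consecutive maps of `S` compose to
zero, for `n = 0` since `S` is just an isomorphism and the hypothesis on `φ.last` applies. This is
the condition needed to continue the construction one step to the left. -/
theorem inl_comp_first_comp {S : YonedaExtension n F K} (φ : S.MapTo d)
    (h : φ.last ≫ d n = 0) : S.inl ≫ φ.first ≫ d 0 = 0 := by
  cases n with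
  | zero =>
    have h' : φ.first ≫ d 0 = 0 := by
      refine (cancel_epi S.isoRight.inv).1 (Eq.trans ?_ comp_zero.symm)
      exact (Category.assoc _ _ _).symm.trans h
    rw [h', comp_zero]
  | succ n =>
    have h1 : S.secondArrow ≫ φ.second = φ.first ≫ d 0 := φ.comm 0
    rw [← h1, ← Category.assoc, S.inl_comp_secondArrow, zero_comp]

end MapTo

/-! ### Existence of an extension with a given cocycle -/

section Existence

/-- Exactness comes from the universal property: a map out of the pushout that kills `G` is a map
out of `T.X₂` that kills `T.X₁`, so it factors through `T.X₃`. -/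
theorem _root_.CategoryTheory.ShortComplex.ShortExact.exists_pushout {T : ShortComplex C}
    (hT : T.ShortExact) {G : C} (y : T.X₁ ⟶ G) :
    ∃ (g : pushout T.f y ⟶ T.X₃) (h : pushout.inr T.f y ≫ g = 0), pushout.inl T.f y ≫ g = T.g ∧
      (ShortComplex.mk _ _ h).ShortExact := by
  have := hT.mono_f
  have := hT.epi_g
  have h0 : T.f ≫ T.g = y ≫ 0 := by rw [T.zero, comp_zero]
  obtain ⟨g, hl, hr⟩ : ∃ g, pushout.inl T.f y ≫ g = T.g ∧ pushout.inr T.f y ≫ g = 0 :=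
    ⟨pushout.desc T.g 0 h0, pushout.inl_desc _ _ _, pushout.inr_desc _ _ _⟩
  have hg : Epi g := epi_of_epi_fac hl
  refine ⟨g, hr, hl, ShortComplex.ShortExact.mk' (ShortComplex.exact_of_g_is_cokernel _ ?_)
    (inferInstanceAs (Mono (pushout.inr T.f y))) hg⟩
  refine CokernelCofork.IsColimit.ofπ' _ _ fun k hk => ?_
  have hk' : T.f ≫ pushout.inl T.f y ≫ k = 0 := by rw [pushout.condition_assoc, hk, comp_zero]
  have hc := hT.gIsCokernel
  have hc' : T.g ≫ hc.desc (CokernelCofork.ofπ _ hk') = pushout.inl T.f y ≫ k :=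
    hc.fac (CokernelCofork.ofπ _ hk') WalkingParallelPair.one
  refine ⟨hc.desc (CokernelCofork.ofπ _ hk'), pushout.hom_ext ?_ ?_⟩
  · rw [reassoc_of% hl]
    exact hc'
  · rw [reassoc_of% hr, zero_comp, hk]

variable (coh : ObjectProperty C) (proj : ObjectProperty C)

/-- Every object of `coh` is a quotient of an object of `coh` and `proj`, with kernel in `coh`. -/
def HasCover : Prop := ∀ K : C, coh K → ∃ T : ShortComplex C, T.ShortExact ∧ T.X₃ = K ∧
  coh T.X₁ ∧ coh T.X₂ ∧ proj T.X₂

variable {coh proj}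

theorem coh_splice {S : YonedaExtension n F K} (hS : ∀ k : Fin (n + 1), coh (S.seq.obj k.succ))
    (T : ShortComplex C) (hT : T.ShortExact) (e : T.X₃ ⟶ K) [IsIso e]
    (h₁ : coh T.X₁) (h₂ : coh T.X₂) (k) : coh ((S.splice T e hT).seq.obj k) :=
  Fin.cases h₁ (fun k => Fin.cases (motive := fun k => coh ((S.splice T e hT).seq.obj k.succ))
    h₂ hS k) k

/-- Induction on `n` with the target shifted by one: the extension already built maps to `J 1 ⟶ J 2
⟶ ⋯`. A cover of its left end is spliced on, and the map from the covering object to `J 1`, which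
lands in cycles, lifts to `J 0` by the lifting property of `proj`. The left end `K` is an
uncontrolled syzygy at this stage. -/
theorem exists_mapTo (hcov : HasCover coh proj) (n : ℕ) :
    ∀ {J : ℕ → C} (d : ∀ k, J k ⟶ J (k + 1))
    (_ : ∀ P, proj P → ∀ k (a : P ⟶ J (k + 1)), a ≫ d (k + 1) = 0 → ∃ b, b ≫ d k = a)
    {F : C} (_ : coh F) (z : F ⟶ J n) (_ : z ≫ d n = 0),
    ∃ (K : C) (S : YonedaExtension n F K) (φ : S.MapTo d), coh K ∧
      (∀ k : Fin (n + 1), coh (S.seq.obj k.succ)) ∧ φ.last = z := by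
  induction n with
  | zero =>
    intro J d _ F hF z hz
    refine ⟨F, trivial F, ⟨fun k => ?_, fun k => k.elim0⟩, hF, fun k => ?_, ?_⟩
    · obtain rfl : k = 0 := by omega
      exact z
    · obtain rfl : k = 0 := by omega
      exact hF
    · exact Category.id_comp z
  | succ n ih =>
    intro J d hJ F hF z hz
    obtain ⟨K, S, φ, hK, hS, hφ⟩ := ih (fun k => d (k + 1)) (fun P hP k => hJ P hP (k + 1)) hF z hz
    obtain ⟨T, hT, rfl, h₁, h₂, hp⟩ := hcov K hK
    have h0 : S.inl ≫ φ.first ≫ d 1 = 0 := φ.inl_comp_first_comp (by rw [hφ]; exact hz)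
    obtain ⟨b, hb⟩ := hJ _ hp 0 (S.spliceArrow T (𝟙 _) ≫ φ.first) (by
      rw [spliceArrow, Category.assoc, Category.assoc]
      exact ((T.g ≫ 𝟙 _) ≫= h0).trans comp_zero)
    exact ⟨_, S.splice T (𝟙 _) hT, φ.splice T hT (𝟙 _) b hb.symm, h₁,
      fun k => coh_splice hS T hT (𝟙 _) h₁ h₂ k.succ, hφ⟩

/-- A cocycle `z : F ⟶ J (n + 1)` comes from an extension of `G` by `F` with terms in `coh`, where
`G` is the kernel of `J 0 ⟶ J 1`. -/
theorem exists_extension_mapTo (hcov : HasCover coh proj)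
    (hpush : ∀ {X Y Z : C} (f : X ⟶ Y) (g : X ⟶ Z), coh X → coh Y → coh Z → coh (pushout f g))
    {J : ℕ → C} (d : ∀ k, J k ⟶ J (k + 1))
    (hJ : ∀ P, proj P → ∀ k (a : P ⟶ J (k + 1)), a ≫ d (k + 1) = 0 → ∃ b, b ≫ d k = a)
    {G : C} (hG : coh G) (a : G ⟶ J 0) (w : a ≫ d 0 = 0)
    (ha : ∀ {A : C} (x : A ⟶ J 0), x ≫ d 0 = 0 → ∃ y, y ≫ a = x)
    {F : C} (hF : coh F) (z : F ⟶ J (n + 1)) (hz : z ≫ d (n + 1) = 0) :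
    ∃ (S : YonedaExtension (n + 1) F G) (φ : S.MapTo d), (∀ k, coh (S.seq.obj k)) ∧
      S.inl ≫ φ.first = a ∧ φ.last = z := by
  obtain ⟨K, S, φ, hK, hS, hφ⟩ := exists_mapTo hcov n (fun k => d (k + 1))
    (fun P hP k => hJ P hP (k + 1)) hF z hz
  obtain ⟨T, hT, rfl, h₁, h₂, hp⟩ := hcov K hK
  have h0 : S.inl ≫ φ.first ≫ d 1 = 0 := φ.inl_comp_first_comp (by rw [hφ]; exact hz)
  obtain ⟨b, hb⟩ := hJ _ hp 0 (S.spliceArrow T (𝟙 _) ≫ φ.first) (by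
      rw [spliceArrow, Category.assoc, Category.assoc]
      exact ((T.g ≫ 𝟙 _) ≫= h0).trans comp_zero)
  -- The last syzygy `T.X₁` lands in the kernel of `d 0`, which is `G`. Pushing out along the
  -- resulting `y` replaces this syzygy by `G`.
  obtain ⟨y, hy⟩ := ha (T.f ≫ b) (by
    rw [Category.assoc, hb, ← Category.assoc, f_comp_spliceArrow, zero_comp])
  obtain ⟨g, hr, hl, hT'⟩ := hT.exists_pushout y
  obtain ⟨b', hbl, hbr⟩ : ∃ b', pushout.inl T.f y ≫ b' = b ∧ pushout.inr T.f y ≫ b' = a :=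
    ⟨pushout.desc b a hy.symm, pushout.inl_desc _ _ _, pushout.inr_desc _ _ _⟩
  have hb' : S.spliceArrow (ShortComplex.mk _ _ hr) (𝟙 _) ≫ φ.first = b' ≫ d 0 := by
    apply pushout.hom_ext
    · rw [reassoc_of% hbl, hb]
      simp only [spliceArrow, Category.assoc]
      rw [reassoc_of% hl]
    · rw [reassoc_of% hbr, w]
      simp only [spliceArrow, Category.assoc]
      rw [reassoc_of% hr, zero_comp]
  refine ⟨S.splice (ShortComplex.mk _ _ hr) (𝟙 T.X₃) hT', φ.splice _ hT' (𝟙 T.X₃) b' hb',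
    fun k => coh_splice hS _ hT' (𝟙 T.X₃) hG (hpush _ _ h₁ h₂ hG) k, ?_, hφ⟩
  rw [splice_inl]
  exact hbr

end Existence

/-! ### Uniqueness up to Yoneda equivalence -/

section Uniqueness

variable {J : ℕ → C} {d : ∀ k, J k ⟶ J (k + 1)}

/-- `x` is a kernel of `d`. -/
def IsKernelOf {A B D : C} (x : A ⟶ B) (d : B ⟶ D) : Prop :=
  Mono x ∧ x ≫ d = 0 ∧ ∀ {W : C} (t : W ⟶ B), t ≫ d = 0 → ∃ y, y ≫ x = t

/-- The truncation of an exact sequence `J`, pulled back along a cocycle `z : F ⟶ J n`, receives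
a morphism from every complex mapping to `J` over `z`. -/
theorem exists_terminal_mapTo (n : ℕ) : ∀ {J : ℕ → C} (d : ∀ k, J k ⟶ J (k + 1))
    (_ : ∀ k, ∃ w : d k ≫ d (k + 1) = 0, (ShortComplex.mk _ _ w).Exact)
    {F : C} (z : F ⟶ J n) (_ : z ≫ d n = 0),
    ∃ (K : C) (T : YonedaExtension n F K) (ψ : T.MapTo d), ψ.last = z ∧
      (n ≠ 0 → IsKernelOf (T.inl ≫ ψ.first) (d 0)) ∧
      ∀ (R : ComposableArrows C n) (_ : R.IsComplex) (φ : ∀ k : Fin (n + 1), R.obj k ⟶ J k)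
        (_ : ∀ k : Fin n, R.map (homOfLE (Fin.castSucc_le_succ k)) ≫ φ k.succ =
          φ k.castSucc ≫ d k)
        (r : R.obj (Fin.last n) ⟶ F) (_ : φ (Fin.last n) = r ≫ z),
        ∃ θ : R ⟶ T.seq.δ₀, (∀ k : Fin (n + 1), θ.app k ≫ ψ.φ k = φ k) ∧
          θ.app (Fin.last n) ≫ T.isoRight.hom = r := by
  induction n with
  | zero =>
    intro J d _ F z hz
    -- For `n = 0` the left end is `F` itself, and `z` has no reason to be a kernel; hence the
    -- exclusion of this case in the second claim.
    refine ⟨F, trivial F, ⟨fun k => ?_, fun k => k.elim0⟩, ?_, fun h => (h rfl).elim, ?_⟩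
    · obtain rfl : k = 0 := by omega
      exact z
    · exact Category.id_comp z
    · intro R _ φ _ r hr
      refine ⟨ComposableArrows.homMk₀ r, fun k => ?_, Category.comp_id r⟩
      obtain rfl : k = 0 := by omega
      exact hr.symm
  | succ n ih =>
    intro J d hd F z hz
    obtain ⟨K, T, ψ, hψ, hker, huniv⟩ := ih (fun k => d (k + 1)) (fun k => hd (k + 1)) z hz
    have hcyc : (T.inl ≫ ψ.first) ≫ d 1 = 0 :=
      (Category.assoc _ _ _).trans (ψ.inl_comp_first_comp (by rw [hψ]; exact hz))
    obtain ⟨w, hw⟩ := hd 0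
    obtain ⟨κ, hκ⟩ : ∃ κ, κ = T.inl ≫ ψ.first := ⟨_, rfl⟩
    rw [← hκ] at hcyc
    -- `κ` takes values in the cycles of `J 1`, and these are the image of `d 0` since `J` is exact.
    -- The kernel of this projection is the kernel of `d 0`.
    have hepi : Epi (pullback.fst κ (d 0)) := by
      rw [epi_iff_surjective_up_to_refinements]
      intro A y
      obtain ⟨A', π, hπ, x, hx⟩ := hw.exact_up_to_refinements (y ≫ κ)
        ((Category.assoc _ _ _).trans ((y ≫= hcyc).trans comp_zero))
      refine ⟨A', π, hπ, pullback.lift (π ≫ y) x ((Category.assoc _ _ _).trans hx), ?_⟩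
      exact (pullback.lift_fst _ _ _).symm
    let T₀ : ShortComplex C := ShortComplex.mk _ _ (kernel.condition (pullback.fst κ (d 0)))
    have hT₀ : T₀.ShortExact := ShortComplex.ShortExact.mk' (ShortComplex.exact_kernel _)
      (inferInstanceAs (Mono (kernel.ι _))) hepi
    have hb : T.spliceArrow T₀ (𝟙 K) ≫ ψ.first = pullback.snd κ (d 0) ≫ d 0 := by
      refine Eq.trans ?_ pullback.condition
      rw [spliceArrow, Category.comp_id, Category.assoc, ← hκ]
    refine ⟨_, T.splice T₀ (𝟙 K) hT₀, ψ.splice T₀ hT₀ (𝟙 K) (pullback.snd κ (d 0)) hb, hψ,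
      fun _ => ?_, ?_⟩
    · rw [splice_inl]
      change IsKernelOf (kernel.ι (pullback.fst κ (d 0)) ≫ pullback.snd κ (d 0)) (d 0)
      refine ⟨⟨fun x y hxy => ?_⟩, ?_, fun t ht => ?_⟩
      · rw [← cancel_mono (kernel.ι (pullback.fst κ (d 0)))]
        apply pullback.hom_ext
        · simp [kernel.condition]
        · simpa using hxy
      · rw [Category.assoc, ← pullback.condition, kernel.condition_assoc, zero_comp]
      · obtain ⟨l, hl₁, hl₂⟩ : ∃ l, l ≫ pullback.fst κ (d 0) = 0 ∧ l ≫ pullback.snd κ (d 0) = t :=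
          ⟨pullback.lift 0 t (zero_comp.trans ht.symm), pullback.lift_fst _ _ _,
            pullback.lift_snd _ _ _⟩
        exact ⟨kernel.lift _ l hl₁, by rw [kernel.lift_ι_assoc, hl₂]⟩
    · intro R hR φ hφ r hr
      have hR' : R.δ₀.IsComplex := ⟨fun i hi => hR.zero (i + 1)⟩
      obtain ⟨θ, hθ, hθr⟩ := huniv R.δ₀ hR' (fun k => φ k.succ) (fun k => hφ k.succ) r hr
      -- The map `R 0 ⟶ R 1 ⟶ T.first` factors through `K` because `R` is a complex; together with
      -- `φ 0` it defines the component into the pullback.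
      obtain ⟨c, hc⟩ := T.exists_lift_inl hR θ
      have h0 : R.map' 0 1 ≫ φ (Fin.succ 0) = φ 0 ≫ d 0 := hφ 0
      have h1 : c ≫ κ = φ 0 ≫ d 0 := by
        rw [← h0, hκ]
        refine (Category.assoc _ _ _).symm.trans ((hc =≫ _).trans ((Category.assoc _ _ _).trans ?_))
        exact _ ≫= hθ 0
      obtain ⟨l, hl₁, hl₂⟩ : ∃ l, l ≫ pullback.fst κ (d 0) = c ∧ l ≫ pullback.snd κ (d 0) = φ 0 :=
          ⟨pullback.lift c (φ 0) h1, pullback.lift_fst _ _ _, pullback.lift_snd _ _ _⟩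
      have hl : R.map' 0 1 ≫ θ.app 0 = l ≫ T.spliceArrow T₀ (𝟙 K) := by
        rw [← hc, ← hl₁, spliceArrow, Category.comp_id, Category.assoc]
      refine ⟨ComposableArrows.homMkSucc (G := (T.splice T₀ (𝟙 K) hT₀).seq.δ₀) l θ hl,
        fun k => Fin.cases hl₂ hθ k, hθr⟩

/-- Two `n`-extensions, `n ≠ 0`, which map to the same exact sequence `J` over the same cocycle are
Yoneda equivalent. -/
theorem equivalent_of_mapTo {G : C} (hn : n ≠ 0)
    (hd : ∀ k, ∃ w : d k ≫ d (k + 1) = 0, (ShortComplex.mk _ _ w).Exact)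
    {a : G ⟶ J 0} (ha : IsKernelOf a (d 0)) {S S' : YonedaExtension n F G} (φ : S.MapTo d)
    (φ' : S'.MapTo d) (h : S.inl ≫ φ.first = a) (h' : S'.inl ≫ φ'.first = a)
    (hz : φ.last = φ'.last) (hc : φ.last ≫ d n = 0) : S.Equivalent S' := by
  obtain ⟨K, T, ψ, hψ, hker, huniv⟩ := exists_terminal_mapTo n d hd φ.last hc
  obtain ⟨_, hk₀, hk⟩ := hker hn
  obtain ⟨u, hu⟩ := hk a ha.2.1
  obtain ⟨v, hv⟩ := ha.2.2 _ hk₀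
  have := ha.1
  -- `K` and `G` are both kernels of `d 0`. This makes the terminal object an extension by `F` of
  -- `G` itself, and the equivalence is the roof `S ⟶ T' ⟵ S'`.
  let e : K ≅ G := ⟨v, u, by
    rw [← cancel_mono (T.inl ≫ ψ.first), Category.assoc, hu, hv, Category.id_comp], by
    rw [← cancel_mono a, Category.assoc, hv, hu, Category.id_comp]⟩
  let T' : YonedaExtension n F G := { T with isoLeft := T.isoLeft ≪≫ e }
  have key : ∀ {S : YonedaExtension n F G} (φ : S.MapTo d), S.inl ≫ φ.first = a →
      φ.last = ψ.last → S.HasMorphism T' := by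
    intro S φ h hl
    obtain ⟨θ, hθ, hθr⟩ := huniv S.seq.δ₀ S.isComplex_δ₀ φ.φ φ.comm S.isoRight.hom (by
      rw [← hψ, ← hl]
      exact (S.isoRight.hom_inv_id_assoc _).symm)
    obtain ⟨c, hc⟩ : ∃ c : S.seq.obj 0 ⟶ G,
        c ≫ T'.inl = S.firstArrow ≫ (show S.first ⟶ T'.first from θ.app 0) :=
      T'.exists_lift_inl S.exact.toIsComplex θ
    have hT' : T'.inl ≫ ψ.first = a := by
      rw [← hu, ← Category.assoc]
      exact Category.assoc _ _ _ =≫ _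
    have hca : c = S.isoLeft.hom := by
      rw [← cancel_mono a]
      calc c ≫ a = (c ≫ T'.inl) ≫ ψ.first := by rw [Category.assoc, hT']
        _ = (S.firstArrow ≫ (show S.first ⟶ T'.first from θ.app 0)) ≫ ψ.first := by rw [hc]
        _ = S.firstArrow ≫ φ.first := (Category.assoc _ _ _).trans (_ ≫= hθ 0)
        _ = S.isoLeft.hom ≫ a := by rw [firstArrow_eq, Category.assoc, h]
    refine ⟨ComposableArrows.homMkSucc (G := T'.seq) (c ≫ T'.isoLeft.inv) θ ?_, ?_, hθr⟩
    · exact hc.symm.trans (Category.assoc _ _ _).symm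
    · change (c ≫ T'.isoLeft.inv) ≫ T'.isoLeft.hom = S.isoLeft.hom
      rw [Category.assoc, Iso.inv_hom_id, Category.comp_id, hca]
  exact (Relation.EqvGen.rel _ _ (key φ h hψ.symm)).trans _ _ _
    ((Relation.EqvGen.rel _ _ (key φ' h' (hz.symm.trans hψ.symm))).symm _ _)

end Uniqueness

end YonedaExtension
end CategoryTheory

/-! ### Čech cochains, refinement, cocycles -/

namespace TopCat.Sheaf

variable {X : TopCat.{u}} {I : Type u}

/-- Restriction of sections of a presheaf of abelian groups. -/
def _root_.TopCat.Presheaf.res (P : TopCat.Presheaf Ab.{u} X) {V W : Opens X} (h : W ≤ V) :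
    P.obj (op V) →+ P.obj (op W) := (P.map (homOfLE h).op).hom

theorem _root_.TopCat.Presheaf.res_res (P : TopCat.Presheaf Ab.{u} X) {V W W' : Opens X}
    (h : W ≤ V) (h' : W' ≤ W) (s : P.obj (op V)) :
    P.res h' (P.res h s) = P.res (h'.trans h) s :=
  (ConcreteCategory.congr_hom (P.map_comp (homOfLE h).op (homOfLE h').op) s).symm

theorem _root_.TopCat.Presheaf.res_self (P : TopCat.Presheaf Ab.{u} X) {V : Opens X}
    (h : V ≤ V) (s : P.obj (op V)) : P.res h s = s :=
  ConcreteCategory.congr_hom (P.map_id _) s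

section Cech

variable {A B : TopCat.Sheaf Ab.{u} X} {U V : I → Opens X} {q : ℕ}

theorem cechOpen_le_comp (U : I → Opens X) {p q : ℕ} (θ : Fin (p + 1) → Fin (q + 1))
    (α : Fin (q + 1) → I) : cechOpen U α ≤ cechOpen U (α ∘ θ) :=
  le_iInf fun j => iInf_le _ (θ j)

/-- The cosimplicial group of Čech cochains. -/
noncomputable def cechCosimplicial (A : TopCat.Sheaf Ab.{u} X) (U : I → Opens X) :
    CosimplicialObject Ab.{u} where
  obj n := AddCommGrpCat.of (CechCochain A U n.len)
  map θ := AddCommGrpCat.ofHom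
    { toFun b α := A.obj.map (homOfLE (cechOpen_le_comp U θ.toOrderHom α)).op (b (α ∘ θ.toOrderHom))
      map_zero' := by ext; simp
      map_add' _ _ := by ext; simp }
  map_id n := by
    ext b α
    exact ConcreteCategory.congr_hom (A.obj.map_id _) (b α)
  map_comp θ θ' := by
    ext b α
    exact ConcreteCategory.congr_hom (A.obj.map_comp
      (homOfLE (cechOpen_le_comp U θ.toOrderHom (α ∘ θ'.toOrderHom))).op
      (homOfLE (cechOpen_le_comp U θ'.toOrderHom α)).op) (b _)

/-- The coboundary is the alternating sum of the cofaces of `cechCosimplicial`, so its square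
vanishes for formal reasons. -/
theorem cechδ_cechδ (b : CechCochain A U q) : cechδ (cechδ b) = 0 := by
  have h : ∀ {q : ℕ} (b : CechCochain A U q), cechδ b =
      (AlgebraicTopology.AlternatingCofaceMapComplex.objD (cechCosimplicial A U) q) b := by
    intro q b
    -- Passing from morphisms of `Ab` to group homomorphisms additively allows the sum of cofaces to
    -- be evaluated at `b`.
    let e : ((cechCosimplicial A U).obj (.mk q) ⟶ (cechCosimplicial A U).obj (.mk (q + 1))) →+
        ((cechCosimplicial A U).obj (.mk q) →+ (cechCosimplicial A U).obj (.mk (q + 1))) :=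
      AddCommGrpCat.homAddEquiv.toAddMonoidHom
    have h1 := DFunLike.congr_fun (map_sum e
      (fun i : Fin (q + 2) => (-1 : ℤ) ^ (i : ℕ) • (cechCosimplicial A U).δ i) Finset.univ) b
    refine Eq.trans ?_ h1.symm
    refine Eq.trans ?_ (AddMonoidHom.finsetSum_apply _ _ _).symm
    funext α
    exact (Finset.sum_apply α Finset.univ fun i : Fin (q + 2) =>
      (((-1 : ℤ) ^ (i : ℕ) • fun α => A.obj.map (homOfLE (cechOpen_le U α i)).op
        (b (α ∘ i.succAbove)) : CechCochain A U (q + 1)))).symm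
  rw [h, h]
  exact ConcreteCategory.congr_hom
    (AlgebraicTopology.AlternatingCofaceMapComplex.d_squared (cechCosimplicial A U) q) b

theorem CechCochain.map_cechδ (f : A ⟶ B) (b : CechCochain A U q) :
    (cechδ b).map f = cechδ (b.map f) := by
  funext α
  change f.hom.app _ (∑ k, _) = _
  rw [map_sum]
  refine Finset.sum_congr rfl fun k _ => ?_
  rw [map_zsmul]
  congr 1
  exact NatTrans.naturality_apply f.hom _ _

/-- Restriction of cochains to a finer covering with the same index set. -/
def CechCochain.refine (h : ∀ i, U i ≤ V i) (b : CechCochain A V q) : CechCochain A U q :=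
  fun α => A.obj.map (homOfLE (iInf_mono fun j => h (α j) : cechOpen U α ≤ cechOpen V α)).op (b α)

theorem CechCochain.refine_cechδ (h : ∀ i, U i ≤ V i) (b : CechCochain A V q) :
    (cechδ b).refine h = cechδ (b.refine h) := by
  funext α
  refine (map_sum (Presheaf.res A.obj _) _ _).trans (Finset.sum_congr rfl fun k _ => ?_)
  refine (map_zsmul (Presheaf.res A.obj _) _ _).trans (congrArg (_ • ·) ?_)
  exact (Presheaf.res_res A.obj _ _ _).trans (Presheaf.res_res A.obj _ _ _).symm

theorem CechCochain.refine_map (h : ∀ i, U i ≤ V i) (f : A ⟶ B) (b : CechCochain A V q) :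
    (b.map f).refine h = (b.refine h).map f := by
  funext α
  exact (NatTrans.naturality_apply f.hom _ _).symm

/-- By recursion along the definition: the short exact sequence and the class `y` stay the same,
only the cochains are restricted. -/
theorem CechRepresents.refine (h : ∀ i, U i ≤ V i) : ∀ (q : ℕ) (A : TopCat.Sheaf Ab.{u} X)
    (c : CechCochain A V q) (x : Sheaf.H A q), CechRepresents V q A c x →
      CechRepresents U q A (c.refine h) x
  | 0, A, c, x, hc => fun α =>
    (congrArg (Presheaf.res A.obj _) (hc α)).trans (Presheaf.res_res A.obj _ _ _)
  | q + 1, A, c, x, ⟨B, Q, f, g, w, hs, b, y, h1, h2, h3⟩ => by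
    refine ⟨B, Q, f, g, w, hs, b.refine h, y, ?_, ?_, h3⟩
    · rw [← CechCochain.refine_map]
      exact CechRepresents.refine h q Q _ y h1
    · rw [← CechCochain.refine_map, h2, CechCochain.refine_cechδ]

theorem app_injective (f : A ⟶ B) [Mono f] (V : Opens X) :
    Function.Injective (f.hom.app (op V)) := by
  have : Mono f.hom := inferInstanceAs (Mono ((TopCat.Sheaf.forget Ab X).map f))
  exact (AddCommGrpCat.mono_iff_injective _).1 inferInstance

/-- In positive degree the image of `δc` in `B` is `δδb = 0`, and `A ⟶ B` is injective on sections.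
-/
theorem CechRepresents.cechδ_eq_zero : ∀ (q : ℕ) (A : TopCat.Sheaf Ab.{u} X)
    (c : CechCochain A V q) (x : Sheaf.H A q), CechRepresents V q A c x → cechδ c = 0
  | 0, A, c, x, hc => by
    funext α
    have hc' : ∀ α, c α = A.obj.map (homOfLE (le_top : cechOpen V α ≤ ⊤)).op
      (Sheaf.H.equiv₀ A isTerminalTop x) := hc
    have h : ∀ k : Fin 2, Presheaf.res A.obj (cechOpen_le V α k) (c (α ∘ k.succAbove)) =
        Presheaf.res A.obj le_top (Sheaf.H.equiv₀ A isTerminalTop x) := fun k =>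
      (congrArg (Presheaf.res A.obj _) (hc' _)).trans (Presheaf.res_res A.obj _ _ _)
    refine (Fin.sum_univ_two _).trans ?_
    refine (congrArg₂ (fun a b => (-1 : ℤ) ^ 0 • a + (-1 : ℤ) ^ 1 • b) (h 0) (h 1)).trans ?_
    simp
  | q + 1, A, c, x, ⟨B, Q, f, g, w, hs, b, y, h1, h2, h3⟩ => by
    have := hs.mono_f
    have h4 : (cechδ c).map f = 0 := by rw [CechCochain.map_cechδ, h2, cechδ_cechδ]
    funext α
    exact app_injective f _ ((congrFun h4 α).trans (map_zero _).symm)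

end Cech

end TopCat.Sheaf

/-! ### Acyclicity on an open set, complexes of acyclic sheaves, Leray's argument -/

namespace TopCat.Sheaf

variable {X : TopCat.{u}}

/-- The free abelian sheaf on an open subset. -/
noncomputable def freeOn (V : Opens X) : TopCat.Sheaf Ab.{u} X :=
  (presheafToSheaf (Opens.grothendieckTopology X) Ab.{u}).obj (yoneda.obj V ⋙ AddCommGrpCat.free)

/-- Morphisms from the free abelian sheaf on `V` are sections over `V`. -/
noncomputable def freeOnEquiv (V : Opens X) (A : TopCat.Sheaf Ab.{u} X) :
    (freeOn V ⟶ A) ≃ A.obj.obj (op V) :=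
  ((sheafificationAdjunction (Opens.grothendieckTopology X) Ab.{u}).homEquiv _ A).trans
    (((AddCommGrpCat.adj.whiskerRight _).homEquiv (yoneda.obj V) A.obj).trans yonedaEquiv)

theorem freeOnEquiv_comp {V : Opens X} {A B : TopCat.Sheaf Ab.{u} X} (f : freeOn V ⟶ A)
    (g : A ⟶ B) : freeOnEquiv V B (f ≫ g) = g.hom.app (op V) (freeOnEquiv V A f) :=
  rfl

/-- The inclusion of free abelian sheaves. -/
noncomputable def freeOnMap {V W : Opens X} (h : W ≤ V) : freeOn W ⟶ freeOn V :=
  (presheafToSheaf (Opens.grothendieckTopology X) Ab.{u}).map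
    (Functor.whiskerRight (yoneda.map (homOfLE h)) AddCommGrpCat.free)

theorem freeOnEquiv_precomp {V W : Opens X} (h : W ≤ V) {A : TopCat.Sheaf Ab.{u} X}
    (f : freeOn V ⟶ A) :
    freeOnEquiv W A (freeOnMap h ≫ f) = A.obj.map (homOfLE h).op (freeOnEquiv V A f) := by
  have h1 := (sheafificationAdjunction (Opens.grothendieckTopology X) Ab.{u}).homEquiv_naturality_left
    (Functor.whiskerRight (yoneda.map (homOfLE h)) AddCommGrpCat.free) f
  have h2 := (AddCommGrpCat.adj.whiskerRight _).homEquiv_naturality_left (yoneda.map (homOfLE h))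
    ((sheafificationAdjunction (Opens.grothendieckTopology X) Ab.{u}).homEquiv _ A f)
  exact (congrArg (yonedaEquiv ∘ (AddCommGrpCat.adj.whiskerRight _).homEquiv _ _) h1).trans
    ((congrArg yonedaEquiv h2).trans (yonedaEquiv_naturality _ _).symm)

/-- Free abelian groups preserve injections and sheafification is exact. -/
instance {V W : Opens X} (h : W ≤ V) : Mono (freeOnMap h) := by
  have : Mono (Functor.whiskerRight (yoneda.map (homOfLE h)) AddCommGrpCat.free) := by
    rw [NatTrans.mono_iff_mono_app]
    intro T
    have : Mono ((yoneda.map (homOfLE h)).app T) := inferInstance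
    exact inferInstanceAs (Mono (AddCommGrpCat.free.map ((yoneda.map (homOfLE h)).app T)))
  exact inferInstanceAs (Mono ((presheafToSheaf (Opens.grothendieckTopology X) Ab.{u}).map _))

/-- A section over `W` is a morphism from `freeOn W`, and it extends along the monomorphism to
`freeOn V`. -/
theorem isFlasque_of_injective (A : TopCat.Sheaf Ab.{u} X) [Injective A] : IsFlasque A where
  epi {V W} i := by
    rw [AddCommGrpCat.epi_iff_surjective]
    intro s
    obtain ⟨f, rfl⟩ := (freeOnEquiv W.unop A).surjective s
    obtain ⟨g, hg⟩ := Injective.factors f (freeOnMap i.unop.le)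
    exact ⟨freeOnEquiv V.unop A g, by rw [← hg]; exact (freeOnEquiv_precomp i.unop.le g).symm⟩

open Abelian

/-- Vanishing of the higher cohomology of `A` over the open subset `V`. -/
def AcyclicOn (V : Opens X) (A : TopCat.Sheaf Ab.{u} X) : Prop :=
  ∀ n, Subsingleton (Ext (freeOn V) A (n + 1))

namespace AcyclicOn

variable {V : Opens X}

theorem of_iso {A B : TopCat.Sheaf Ab.{u} X} (e : A ≅ B) (h : AcyclicOn V A) : AcyclicOn V B :=
  fun n => ⟨fun x y => by
    have := h n
    have key : ∀ x : Ext (freeOn V) B (n + 1),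
        x = (x.comp (Ext.mk₀ e.inv) (add_zero _)).comp (Ext.mk₀ e.hom) (add_zero _) := fun x => by
      rw [Ext.comp_assoc_of_third_deg_zero, Ext.mk₀_comp_mk₀, e.inv_hom_id, Ext.comp_mk₀_id]
    rw [key x, key y, Subsingleton.elim (x.comp _ _) (y.comp _ _)]⟩

theorem of_injective (A : TopCat.Sheaf Ab.{u} X) [Injective A] : AcyclicOn V A := fun _ =>
  subsingleton_of_forall_eq 0 fun x => x.eq_zero_of_injective

variable {S : ShortComplex (TopCat.Sheaf Ab.{u} X)} (hS : S.ShortExact)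
include hS

theorem X₃ (h₁ : AcyclicOn V S.X₁) (h₂ : AcyclicOn V S.X₂) : AcyclicOn V S.X₃ := fun n =>
  subsingleton_of_forall_eq 0 fun x => by
    have := h₁ (n + 1)
    have := h₂ n
    obtain ⟨y, rfl⟩ := Ext.covariant_sequence_exact₃ _ hS x rfl (Subsingleton.elim _ _)
    rw [Subsingleton.elim y 0, Ext.zero_comp]

theorem X₂ (h₁ : AcyclicOn V S.X₁) (h₃ : AcyclicOn V S.X₃) : AcyclicOn V S.X₂ := fun n =>
  subsingleton_of_forall_eq 0 fun x => by
    have := h₁ n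
    have := h₃ n
    obtain ⟨y, rfl⟩ := Ext.covariant_sequence_exact₂ _ hS x (Subsingleton.elim _ _)
    rw [Subsingleton.elim y 0, Ext.zero_comp]

/-- The obstruction to lifting a section lies in `Ext¹(freeOn V, S.X₁)`. -/
theorem surjective (h₁ : AcyclicOn V S.X₁) : Function.Surjective (S.g.hom.app (op V)) := fun s => by
  have := h₁ 0
  obtain ⟨f, rfl⟩ := (freeOnEquiv V S.X₃).surjective s
  obtain ⟨y, hy⟩ := Ext.covariant_sequence_exact₃ _ hS (Ext.mk₀ f) rfl (Subsingleton.elim _ _)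
  obtain ⟨g, rfl⟩ := (Ext.mk₀_bijective _ _).2 y
  rw [Ext.mk₀_comp_mk₀] at hy
  have := (Ext.mk₀_bijective _ _).1 hy
  exact ⟨freeOnEquiv V S.X₂ g, by rw [← this]; exact (freeOnEquiv_comp g S.g).symm⟩

end AcyclicOn

/-- Dimension shifting: a class of sheaves closed under cokernels of suitable embeddings into
acyclic sheaves consists of acyclic sheaves. -/
theorem AcyclicOn.of_class {V : Opens X} (P : TopCat.Sheaf Ab.{u} X → Prop)
    (h : ∀ A, P A → ∃ S : ShortComplex (TopCat.Sheaf Ab.{u} X), S.ShortExact ∧ S.X₁ = A ∧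
      AcyclicOn V S.X₂ ∧ P S.X₃ ∧ Function.Surjective (S.g.hom.app (op V)))
    {A : TopCat.Sheaf Ab.{u} X} (hA : P A) : AcyclicOn V A := by
  intro n
  induction n generalizing A with
  | zero =>
    obtain ⟨S, hS, rfl, h₂, -, hs⟩ := h A hA
    refine subsingleton_of_forall_eq 0 fun x => ?_
    have := h₂ 0
    obtain ⟨y, rfl⟩ := Ext.covariant_sequence_exact₁ _ hS x (Subsingleton.elim _ _) rfl
    obtain ⟨f, rfl⟩ := (Ext.mk₀_bijective _ _).2 y
    -- In degree one, `x` is the coboundary of a section of `S.X₃`. Acyclicity of `S.X₂` alone does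
    -- not kill it; the assumed surjectivity on sections does.
    obtain ⟨t, ht⟩ := hs (freeOnEquiv V S.X₃ f)
    obtain ⟨g, rfl⟩ := (freeOnEquiv V S.X₂).surjective t
    rw [← freeOnEquiv_comp] at ht
    obtain rfl := (freeOnEquiv V S.X₃).injective ht
    rw [← Ext.mk₀_comp_mk₀, Ext.comp_assoc_of_second_deg_zero, hS.comp_extClass, Ext.comp_zero]
  | succ n ih =>
    obtain ⟨S, hS, rfl, h₂, h₃, -⟩ := h A hA
    refine subsingleton_of_forall_eq 0 fun x => ?_
    have := h₂ (n + 1)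
    have := ih h₃
    obtain ⟨y, rfl⟩ := Ext.covariant_sequence_exact₁ _ hS x (Subsingleton.elim _ _) rfl
    rw [Subsingleton.elim y 0, Ext.zero_comp]

/-- The embedding of `A` into an injective sheaf, and its cokernel. -/
noncomputable def injectiveShort (A : TopCat.Sheaf Ab.{u} X) :
    ShortComplex (TopCat.Sheaf Ab.{u} X) :=
  ShortComplex.mk (Injective.ι A) (cokernel.π (Injective.ι A)) (cokernel.condition _)

theorem injectiveShort_shortExact (A : TopCat.Sheaf Ab.{u} X) : (injectiveShort A).ShortExact where
  exact := ShortComplex.exact_cokernel _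
  mono_f := inferInstanceAs (Mono (Injective.ι A))
  epi_g := coequalizer.π_epi

/-- Flasque sheaves form a class to which dimension shifting applies: the quotient of an injective
sheaf by a flasque one is flasque, and sections of the quotient lift. -/
theorem AcyclicOn.of_isFlasque {V : Opens X} (A : TopCat.Sheaf Ab.{u} X) [hA : IsFlasque A] :
    AcyclicOn V A := by
  refine AcyclicOn.of_class (fun A => IsFlasque A) (fun A hA => ?_) hA
  have hS := injectiveShort_shortExact A
  have : Injective (injectiveShort A).X₂ := inferInstanceAs (Injective (Injective.under A))
  have : IsFlasque (injectiveShort A).X₁ := hA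
  have : IsFlasque (injectiveShort A).X₂ := isFlasque_of_injective _
  exact ⟨_, hS, rfl, .of_injective _, IsFlasque.of_shortExact_of_isFlasque₁₂ hS,
    (AddCommGrpCat.epi_iff_surjective _).1 (IsFlasque.epi_of_shortExact (U := V) hS)⟩

section complex

variable (K : CochainComplex (TopCat.Sheaf Ab.{u} X) ℕ) {V : Opens X}

/-- The short exact sequence `0 ⟶ Bⁿ ⟶ Zⁿ ⟶ Hⁿ ⟶ 0` of a complex. -/
noncomputable def boundariesShort (n : ℕ) : ShortComplex (TopCat.Sheaf Ab.{u} X) :=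
  ShortComplex.mk (kernel.ι (K.homologyπ n)) (K.homologyπ n) (kernel.condition _)

theorem boundariesShort_shortExact (n : ℕ) : (boundariesShort K n).ShortExact where
  exact := ShortComplex.exact_kernel _
  mono_f := equalizer.ι_mono
  epi_g := inferInstanceAs (Epi (K.homologyπ n))

/-- The short exact sequence `0 ⟶ Zⁿ ⟶ Kⁿ ⟶ Bⁿ⁺¹ ⟶ 0` of a complex. -/
noncomputable def cyclesShort (n : ℕ) : ShortComplex (TopCat.Sheaf Ab.{u} X) :=
  ShortComplex.mk (K.iCycles n)
    (kernel.lift (K.homologyπ (n + 1)) (K.toCycles n (n + 1)) (K.toCycles_comp_homologyπ _ _))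
    (by
      rw [← cancel_mono (kernel.ι _), ← cancel_mono (K.iCycles _)]
      simp)

theorem cyclesShort_shortExact (n : ℕ) : (cyclesShort K n).ShortExact where
  exact := by
    let T := ShortComplex.mk (K.iCycles n) (K.d n (n + 1)) (K.iCycles_d _ _)
    have hT : T.Exact := ShortComplex.exact_of_f_is_kernel _ (K.cyclesIsKernel n (n + 1) (by simp))
    let φ : cyclesShort K n ⟶ T :=
      { τ₁ := 𝟙 _
        τ₂ := 𝟙 _
        τ₃ := kernel.ι (K.homologyπ (n + 1)) ≫ K.iCycles _
        comm₁₂ := (Category.id_comp _).trans (Category.comp_id _).symm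
        comm₂₃ := by simp [T, cyclesShort] }
    have : Epi φ.τ₁ := inferInstanceAs (Epi (𝟙 _))
    have : IsIso φ.τ₂ := inferInstanceAs (IsIso (𝟙 _))
    have : Mono φ.τ₃ := inferInstanceAs (Mono (kernel.ι (K.homologyπ (n + 1)) ≫ K.iCycles _))
    exact (ShortComplex.exact_iff_of_epi_of_isIso_of_mono φ).2 hT
  mono_f := inferInstanceAs (Mono (K.iCycles n))
  epi_g := by
    have h : (ShortComplex.mk _ _ (K.toCycles_comp_homologyπ n (n + 1))).Exact :=
      ShortComplex.exact_of_g_is_cokernel _ (K.homologyIsCokernel n (n + 1) (by simp))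
    exact h.epi_kernelLift

variable {K} in
-- Induction on the degree: `Bⁿ⁺¹ = Kⁿ / Zⁿ` is acyclic as a quotient of acyclic sheaves, and `Zⁿ⁺¹`
-- is an extension of `Hⁿ⁺¹` by `Bⁿ⁺¹`. In degree `0` cycles and homology coincide.
theorem AcyclicOn.cycles (hK : ∀ n, AcyclicOn V (K.X n)) (hH : ∀ n, AcyclicOn V (K.homology n)) :
    ∀ n, AcyclicOn V (K.cycles n)
  | 0 => .of_iso (asIso (K.homologyπ 0)).symm (hH 0)
  | n + 1 => .X₂ (boundariesShort_shortExact K (n + 1))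
      (.X₃ (cyclesShort_shortExact K n) (AcyclicOn.cycles hK hH n) (hK n)) (hH (n + 1))

variable {K} in
theorem surjective_homologyπ (hK : ∀ n, AcyclicOn V (K.X n))
    (hH : ∀ n, AcyclicOn V (K.homology n)) : ∀ n,
    Function.Surjective ((K.homologyπ n).hom.app (op V))
  | 0 => by
    have : IsIso ((K.homologyπ 0).hom.app (op V)) :=
      inferInstanceAs (IsIso ((((TopCat.Sheaf.forget Ab X) ⋙ (evaluation _ _).obj (op V)).map
        (K.homologyπ 0))))
    exact (ConcreteCategory.bijective_of_isIso ((K.homologyπ 0).hom.app (op V))).2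
  | n + 1 => (AcyclicOn.X₃ (cyclesShort_shortExact K n) (.cycles hK hH n) (hK n)).surjective
      (boundariesShort_shortExact K (n + 1))

variable {K} in
-- A section with zero class lies in `Bⁿ⁺¹`, and `Kⁿ ⟶ Bⁿ⁺¹` has kernel `Zⁿ`, whose acyclicity makes
-- it surjective on sections.
theorem exists_toCycles_eq {n : ℕ} (hn : AcyclicOn V (K.cycles n))
    (w : (K.cycles (n + 1)).obj.obj (op V)) (hw : (K.homologyπ (n + 1)).hom.app (op V) w = 0) :
    ∃ t : (K.X n).obj.obj (op V), (K.toCycles n (n + 1)).hom.app (op V) t = w := by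
  obtain ⟨b, rfl⟩ := Sheaf.sections_exact_of_left_exact (boundariesShort_shortExact K (n + 1)).exact
    (boundariesShort_shortExact K (n + 1)).mono_f w hw
  obtain ⟨t, rfl⟩ := hn.surjective (cyclesShort_shortExact K n) b
  refine ⟨t, ?_⟩
  have h : (cyclesShort K n).g ≫ (boundariesShort K (n + 1)).f = K.toCycles n (n + 1) :=
    kernel.lift_ι _ _ _
  exact (ConcreteCategory.congr_hom (congrArg (fun f => f.hom.app (op V)) h) t).symm

end complex

/-- Leray by dimension shifting. Embed `A` in an injective sheaf with quotient `Q`; then `x` comes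
from some `y` over `Q`, which is again acyclic on the intersections. A cocycle for `y` lifts
termwise to a cochain `b`, and `δb` takes its values in `A`. -/
theorem exists_cechRepresents {I : Type u} (U : I → Opens X) : ∀ (q : ℕ)
    (A : TopCat.Sheaf Ab.{u} X) (_ : ∀ n (α : Fin (n + 1) → I), AcyclicOn (cechOpen U α) A)
    (x : Sheaf.H A q), ∃ c, CechRepresents U q A c x
  | 0, A, hA, x => ⟨_, fun α => rfl⟩
  | q + 1, A, hA, x => by
    have hS := injectiveShort_shortExact A
    have : Injective (injectiveShort A).X₂ := inferInstanceAs (Injective (Injective.under A))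
    obtain ⟨y, rfl⟩ := Ext.covariant_sequence_exact₁ _ hS x (Ext.eq_zero_of_injective _) rfl
    obtain ⟨c, hc⟩ := exists_cechRepresents U q (injectiveShort A).X₃
      (fun n α => AcyclicOn.X₃ hS (hA n α) (.of_injective _)) y
    choose b hb using fun α => AcyclicOn.surjective hS (hA q α) (c α)
    have h1 : CechCochain.map (injectiveShort A).g b = c := funext hb
    have h2 : ∀ α, ∃ a, (injectiveShort A).f.hom.app _ a = cechδ b α := fun α => by
      refine Sheaf.sections_exact_of_left_exact hS.exact hS.mono_f _ ?_
      have := congrFun (CechCochain.map_cechδ (injectiveShort A).g b) α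
      rw [h1, hc.cechδ_eq_zero] at this
      exact this
    choose a ha using h2
    exact ⟨a, _, _, _, _, _, hS, b, y, h1 ▸ hc, funext ha, rfl⟩

end TopCat.Sheaf

/-! ### Local homomorphisms as morphisms of restrictions -/

namespace AlgebraicGeometry.Scheme.Modules

variable {X Y : Scheme.{u}}

/-- Sections of a module, as a function of the open subset; restriction to a smaller open subset. -/
noncomputable def res (M : X.Modules) {V W : X.Opens} (h : W ≤ V) : Γ(M, V) →+ Γ(M, W) :=
  (M.presheaf.map (homOfLE h).op).hom

theorem res_res (M : X.Modules) {V W W' : X.Opens} (h : W ≤ V) (h' : W' ≤ W) (s : Γ(M, V)) :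
    M.res h' (M.res h s) = M.res (h'.trans h) s :=
  TopCat.Presheaf.res_res M.presheaf h h' s

@[simp]
theorem res_self (M : X.Modules) {V : X.Opens} (h : V ≤ V) (s : Γ(M, V)) : M.res h s = s :=
  TopCat.Presheaf.res_self M.presheaf h s

theorem res_smul (M : X.Modules) {V W : X.Opens} (h : W ≤ V) (r : Γ(X, V)) (s : Γ(M, V)) :
    M.res h (r • s) = X.presheaf.map (homOfLE h).op r • M.res h s :=
  M.map_smul (homOfLE h) r s

theorem app_res {M N : X.Modules} (f : M ⟶ N) {V W : X.Opens} (h : W ≤ V) (s : Γ(M, V)) :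
    f.app W (M.res h s) = N.res h (f.app V s) :=
  ConcreteCategory.congr_hom (f.mapPresheaf.naturality (homOfLE h).op) s

/-- The sheaf of abelian groups underlying a module. -/
noncomputable def abSheaf (M : X.Modules) : TopCat.Sheaf Ab.{u} X := ⟨M.presheaf, M.isSheaf⟩

/-- A morphism of modules from compatible linear maps on sections. -/
noncomputable def homMk {M N : X.Modules} (φ : ∀ V : X.Opens, Γ(M, V) →+ Γ(N, V))
    (h₁ : ∀ V (r : Γ(X, V)) (s : Γ(M, V)), φ V (r • s) = r • φ V s)
    (h₂ : ∀ (V W : X.Opens) (h : W ≤ V) (s : Γ(M, V)), φ W (M.res h s) = N.res h (φ V s)) :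
    M ⟶ N :=
  ⟨PresheafOfModules.homMk
    { app V := AddCommGrpCat.ofHom (φ V.unop)
      naturality V W f := by
        ext s
        exact h₂ V.unop W.unop f.unop.le s } fun V r s => h₁ V.unop r s⟩

theorem hom_ext_apply {M N : X.Modules} {f g : M ⟶ N} (h : ∀ V (s : Γ(M, V)), f.app V s = g.app V s) :
    f = g := hom_ext _ _ fun V => by ext s; exact h V s

section localHom

variable {F G : X.Modules} {U : X.Opens}

theorem localHom_smul (φ : localHom F G U) {V : X.Opens} (h : V ≤ U) (r : Γ(X, V)) (s : Γ(F, V)) :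
    φ.1 ⟨V, h⟩ (r • s) = r • φ.1 ⟨V, h⟩ s := φ.2.1 ⟨V, h⟩ r s

theorem localHom_res (φ : localHom F G U) {V W : X.Opens} (h : V ≤ U) (h' : W ≤ V) (s : Γ(F, V)) :
    φ.1 ⟨W, h'.trans h⟩ (F.res h' s) = G.res h' (φ.1 ⟨V, h⟩ s) :=
  φ.2.2 ⟨V, h⟩ ⟨W, h'.trans h⟩ h' s

variable (j : Y ⟶ X) [IsOpenImmersion j]

theorem image_le (W : Y.Opens) : j ''ᵁ W ≤ j.opensRange := j.image_le_opensRange W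

/-- A morphism of restrictions, acting on sections over images of open subsets. -/
noncomputable def restrictApp (ψ : F.restrict j ⟶ G.restrict j) (W : Y.Opens) :
    Γ(F, j ''ᵁ W) →+ Γ(G, j ''ᵁ W) := (ψ.app W).hom

theorem restrictApp_res (ψ : F.restrict j ⟶ G.restrict j) {V W : Y.Opens} (h : W ≤ V)
    (h' : j ''ᵁ W ≤ j ''ᵁ V) (s : Γ(F, j ''ᵁ V)) :
    restrictApp j ψ W (F.res h' s) = G.res h' (restrictApp j ψ V s) := app_res ψ h s

/-- Scalars of a restricted module act through `appIso`, so linearity over `Γ(Y, W)` has to be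
transported to linearity over `Γ(X, j ''ᵁ W)`. -/
theorem restrictApp_smul (ψ : F.restrict j ⟶ G.restrict j) {W : Y.Opens} (r : Γ(X, j ''ᵁ W))
    (s : Γ(F, j ''ᵁ W)) : restrictApp j ψ W (r • s) = r • restrictApp j ψ W s := by
  have h : (j.appIso W).inv ((j.appIso W).hom r) = r := CategoryTheory.Iso.hom_inv_id_apply _ r
  have h' : restrictApp j ψ W ((j.appIso W).inv ((j.appIso W).hom r) • s) =
      (j.appIso W).inv ((j.appIso W).hom r) • restrictApp j ψ W s :=
    ψ.app_smul ((j.appIso W).hom r) s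
  rwa [h] at h'

/-- The morphism of restrictions along an open immersion given by a local homomorphism. -/
noncomputable def localHomToHom (hU : j.opensRange ≤ U) (φ : localHom F G U) :
    F.restrict j ⟶ G.restrict j :=
  homMk (fun W => φ.1 ⟨j ''ᵁ W, (image_le j W).trans hU⟩)
    (fun _ _ _ => localHom_smul φ _ _ _)
    (fun V _ h _ => localHom_res φ ((image_le j V).trans hU) (j.image_mono h) _)

theorem image_preimage_eq_of_le {V : X.Opens} (h : V ≤ j.opensRange) : j ''ᵁ (j ⁻¹ᵁ V) = V := by
  rw [j.image_preimage_eq_opensRange_inf]; exact inf_eq_right.2 h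

theorem localHomToHom_injective (hU : j.opensRange ≤ U) (hU' : U ≤ j.opensRange) :
    Function.Injective (localHomToHom (F := F) (G := G) j hU) := by
  intro φ ψ h
  refine Subtype.ext (funext fun ⟨V, hV⟩ => AddMonoidHom.ext fun s => ?_)
  have hV' : V ≤ j.opensRange := le_trans hV hU'
  obtain ⟨W, rfl⟩ : ∃ W, V = j ''ᵁ W := ⟨_, (image_preimage_eq_of_le j hV').symm⟩
  exact congrArg (fun f : F.restrict j ⟶ G.restrict j => f.app W s) h

/-- A morphism of restrictions, acting on sections over open subsets of the image. -/
noncomputable def restrictAppOfLe (ψ : F.restrict j ⟶ G.restrict j) {V : X.Opens}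
    (hV : V ≤ j.opensRange) : Γ(F, V) →+ Γ(G, V) :=
  (G.res (image_preimage_eq_of_le j hV).ge).comp
    ((restrictApp j ψ (j ⁻¹ᵁ V)).comp (F.res (image_preimage_eq_of_le j hV).le))

theorem restrictAppOfLe_image (ψ : F.restrict j ⟶ G.restrict j) {W : Y.Opens}
    (s : Γ(F, j ''ᵁ W)) : restrictAppOfLe j ψ (image_le j W) s = restrictApp j ψ W s := by
  change G.res _ (restrictApp j ψ _ (F.res _ s)) = _
  rw [restrictApp_res j ψ (j.preimage_image_eq W).le, res_res, res_self]

theorem restrictAppOfLe_smul (ψ : F.restrict j ⟶ G.restrict j) {V : X.Opens}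
    (hV : V ≤ j.opensRange) (r : Γ(X, V)) (s : Γ(F, V)) :
    restrictAppOfLe j ψ hV (r • s) = r • restrictAppOfLe j ψ hV s := by
  obtain ⟨W, rfl⟩ : ∃ W, V = j ''ᵁ W := ⟨_, (image_preimage_eq_of_le j hV).symm⟩
  rw [restrictAppOfLe_image, restrictAppOfLe_image, restrictApp_smul]

theorem restrictAppOfLe_res (ψ : F.restrict j ⟶ G.restrict j) {V V' : X.Opens}
    (hV : V ≤ j.opensRange) (h : V' ≤ V) (s : Γ(F, V)) :
    restrictAppOfLe j ψ (h.trans hV) (F.res h s) = G.res h (restrictAppOfLe j ψ hV s) := by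
  change G.res _ (restrictApp j ψ _ (F.res _ (F.res h s))) =
    G.res h (G.res _ (restrictApp j ψ _ (F.res _ s)))
  have h' : j ⁻¹ᵁ V' ≤ j ⁻¹ᵁ V := j.preimage_mono h
  have := restrictApp_res j ψ h' (j.image_mono h')
    (F.res (image_preimage_eq_of_le j hV).le s)
  rw [res_res] at this ⊢
  rw [this, res_res, res_res]

/-- The local homomorphism given by a morphism of restrictions along an open immersion. -/
noncomputable def homToLocalHom (ψ : F.restrict j ⟶ G.restrict j) (hU : U ≤ j.opensRange) :
    localHom F G U :=
  ⟨fun V => restrictAppOfLe j ψ (V.2.trans hU),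
    fun V => restrictAppOfLe_smul j ψ (V.2.trans hU),
    fun V _ h => restrictAppOfLe_res j ψ (V.2.trans hU) h⟩

theorem homToLocalHom_apply (ψ : F.restrict j ⟶ G.restrict j) (hU : U ≤ j.opensRange) (W : Y.Opens)
    (h : j ''ᵁ W ≤ U) (s : Γ(F, j ''ᵁ W)) : (homToLocalHom j ψ hU).1 ⟨j ''ᵁ W, h⟩ s = ψ.app W s :=
  restrictAppOfLe_image j ψ s

theorem localHomToHom_homToLocalHom (ψ : F.restrict j ⟶ G.restrict j) (hU : j.opensRange ≤ U)
    (hU' : U ≤ j.opensRange) : localHomToHom j hU (homToLocalHom j ψ hU') = ψ :=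
  hom_ext_apply fun W s => homToLocalHom_apply j ψ hU' W _ s

end localHom

end AlgebraicGeometry.Scheme.Modules

/-! ### Restriction preserves injective modules -/

namespace AlgebraicGeometry.Scheme.Modules

variable {X Y : Scheme.{u}}

theorem app_injective_of_mono {M N : X.Modules} (f : M ⟶ N) [Mono f] (V : X.Opens) :
    Function.Injective (f.app V) := by
  have : Mono ((toPresheaf X).map f) := inferInstance
  have := (NatTrans.mono_iff_mono_app ((toPresheaf X).map f)).1 inferInstance (op V)
  exact (AddCommGrpCat.mono_iff_injective _).1 this

variable (X) in
/-- Sheafification of presheaves of modules. -/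
noncomputable def sheafify : X.PresheafOfModules ⥤ X.Modules :=
  PresheafOfModules.sheafification (𝟙 X.ringCatSheaf.obj)

variable (X) in
/-- The adjunction between sheafification and the inclusion of sheaves in presheaves. -/
noncomputable def sheafifyAdjunction : sheafify X ⊣ toPresheafOfModules X :=
  PresheafOfModules.sheafificationAdjunction (𝟙 X.ringCatSheaf.obj)

instance : PreservesFiniteLimits (sheafify X) :=
  inferInstanceAs (PreservesFiniteLimits (PresheafOfModules.sheafification (𝟙 X.ringCatSheaf.obj)))

/-- The inclusion of sheaves in presheaves is right adjoint to the exact functor of sheafification.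
-/
instance injective_toPresheafOfModules (I : X.Modules) [Injective I] :
    Injective ((toPresheafOfModules X).obj I) :=
  Injective.injective_of_adjoint (sheafifyAdjunction X) I

section Extend

variable (j : Y ⟶ X) [IsOpenImmersion j] {N : Y.Modules} {P I : X.Modules}
  (i : N ⟶ P.restrict j) (φ : N ⟶ I.restrict j)

/-- A morphism to a restriction, acting on sections. -/
noncomputable def toRestrictApp (W : Y.Opens) : Γ(N, W) →+ Γ(P, j ''ᵁ W) := (i.app W).hom

theorem toRestrictApp_res {V W : Y.Opens} (h : W ≤ V) (h' : j ''ᵁ W ≤ j ''ᵁ V) (s : Γ(N, V)) :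
    toRestrictApp j i W (N.res h s) = P.res h' (toRestrictApp j i V s) := app_res i h s

theorem toRestrictApp_smul {W : Y.Opens} (r : Γ(X, j ''ᵁ W)) (s : Γ(N, W)) :
    toRestrictApp j i W ((j.appIso W).hom r • s) = r • toRestrictApp j i W s := by
  have h : (j.appIso W).inv ((j.appIso W).hom r) = r := CategoryTheory.Iso.hom_inv_id_apply _ r
  have h' : toRestrictApp j i W ((j.appIso W).hom r • s) =
      (j.appIso W).inv ((j.appIso W).hom r) • toRestrictApp j i W s :=
    i.app_smul ((j.appIso W).hom r) s
  rwa [h] at h'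

/-- The pairs `(i s, φ s)`, over open subsets of the image of `j`. -/
noncomputable def graphSubmodule (W : X.Opens) : Submodule Γ(X, W) (Γ(P, W) × Γ(I, W)) where
  -- The alternative `x = 0` makes this an extension by zero: over opens not contained in the image
  -- of `j` it is the only pair allowed.
  carrier := {x | x = 0 ∨ W ≤ j.opensRange ∧ ∃ s : Γ(N, j ⁻¹ᵁ W),
    P.res (j.image_preimage_le W) x.1 = toRestrictApp j i _ s ∧
    I.res (j.image_preimage_le W) x.2 = toRestrictApp j φ _ s}
  zero_mem' := Or.inl rfl
  add_mem' := by
    rintro x y (rfl | ⟨hx, s, hs, hs'⟩) (rfl | ⟨hy, t, ht, ht'⟩)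
    · exact Or.inl (add_zero _)
    · exact Or.inr ⟨hy, t, by simpa using ht, by simpa using ht'⟩
    · exact Or.inr ⟨hx, s, by simpa using hs, by simpa using hs'⟩
    · exact Or.inr ⟨hx, s + t, by simp [hs, ht], by simp [hs', ht']⟩
  smul_mem' := by
    rintro r x (rfl | ⟨hx, s, hs, hs'⟩)
    · exact Or.inl (smul_zero _)
    · refine Or.inr ⟨hx, (j.appIso _).hom (X.presheaf.map (homOfLE (j.image_preimage_le W)).op r) • s,
        ?_, ?_⟩
      · rw [toRestrictApp_smul, ← hs, Prod.smul_fst, res_smul]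
      · rw [toRestrictApp_smul, ← hs', Prod.smul_snd, res_smul]

theorem mem_graphSubmodule_res {V W : X.Opens} (h : W ≤ V) (x : Γ(P, V) × Γ(I, V))
    (hx : x ∈ graphSubmodule j i φ V) :
    ((P.res h x.1, I.res h x.2) : Γ(P, W) × Γ(I, W)) ∈ graphSubmodule j i φ W := by
  obtain (rfl | ⟨hx, s, hs, hs'⟩) := hx
  · exact Or.inl (by simp)
  · refine Or.inr ⟨h.trans hx, N.res (j.preimage_mono h) s, ?_, ?_⟩
    · rw [toRestrictApp_res j i _ (j.image_mono (j.preimage_mono h)), ← hs, res_res, res_res]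
    · rw [toRestrictApp_res j φ _ (j.image_mono (j.preimage_mono h)), ← hs', res_res, res_res]

/-- Restriction of pairs `(i s, φ s)`. -/
noncomputable def graphRes {V W : X.Opens} (h : W ≤ V) :
    graphSubmodule j i φ V →+ graphSubmodule j i φ W where
  toFun x := ⟨_, mem_graphSubmodule_res j i φ h x.1 x.2⟩
  map_zero' := Subtype.ext (by simp)
  map_add' _ _ := Subtype.ext (by simp)

theorem graphRes_self {V : X.Opens} (x : graphSubmodule j i φ V) :
    graphRes j i φ le_rfl x = x :=
  Subtype.ext (Prod.ext (P.res_self le_rfl x.1.1) (I.res_self le_rfl x.1.2))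

theorem graphRes_res {V W W' : X.Opens} (h : W ≤ V) (h' : W' ≤ W) (x : graphSubmodule j i φ V) :
    graphRes j i φ (h'.trans h) x = graphRes j i φ h' (graphRes j i φ h x) :=
  Subtype.ext (Prod.ext (P.res_res h h' x.1.1).symm (I.res_res h h' x.1.2).symm)

/-- The abelian presheaf of pairs `(i s, φ s)`. -/
noncomputable def graphPresheaf : TopCat.Presheaf Ab.{u} X where
  obj W := AddCommGrpCat.of (graphSubmodule j i φ W.unop)
  map f := AddCommGrpCat.ofHom (graphRes j i φ f.unop.le)
  map_id W := by
    refine ConcreteCategory.hom_ext _ _ fun x => ?_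
    exact graphRes_self j i φ x
  map_comp f g := by
    refine ConcreteCategory.hom_ext _ _ fun x => ?_
    exact graphRes_res j i φ f.unop.le g.unop.le x

noncomputable instance (W : X.Opensᵒᵖ) :
    Module (X.ringCatSheaf.obj.obj W) ((graphPresheaf j i φ).obj W) :=
  inferInstanceAs (Module Γ(X, W.unop) (graphSubmodule j i φ W.unop))

/-- The presheaf of modules of pairs `(i s, φ s)`. -/
noncomputable def graphModule : X.PresheafOfModules :=
  PresheafOfModules.ofPresheaf (graphPresheaf j i φ) fun _ _ f r _ =>
    Subtype.ext (Prod.ext (P.res_smul f.unop.le r _) (I.res_smul f.unop.le r _))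

/-- The first projection. -/
noncomputable def graphFst : graphModule j i φ ⟶ (toPresheafOfModules X).obj P :=
  PresheafOfModules.homMk
    { app W := AddCommGrpCat.ofHom ((AddMonoidHom.fst Γ(P, W.unop) Γ(I, W.unop)).comp
        (graphSubmodule j i φ W.unop).toAddSubgroup.subtype) } fun _ _ _ => rfl

/-- The second projection. -/
noncomputable def graphSnd : graphModule j i φ ⟶ (toPresheafOfModules X).obj I :=
  PresheafOfModules.homMk
    { app W := AddCommGrpCat.ofHom ((AddMonoidHom.snd Γ(P, W.unop) Γ(I, W.unop)).comp
        (graphSubmodule j i φ W.unop).toAddSubgroup.subtype) } fun _ _ _ => rfl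

/-- Over the image of `j` a pair is determined by `s`, hence by `i s`; over other opens there is
only zero. -/
instance [Mono i] : Mono (graphFst j i φ) := by
  apply (PresheafOfModules.toPresheaf _).mono_of_mono_map
  rw [NatTrans.mono_iff_mono_app]
  intro W
  rw [AddCommGrpCat.mono_iff_injective]
  change Function.Injective ((AddMonoidHom.fst Γ(P, W.unop) Γ(I, W.unop)).comp
        (graphSubmodule j i φ W.unop).toAddSubgroup.subtype)
  rw [injective_iff_map_eq_zero]
  rintro ⟨⟨a, b⟩, (h | ⟨hW, s, hs, hs'⟩)⟩ (rfl : a = 0)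
  · exact Subtype.ext h
  · have h0 : s = 0 := app_injective_of_mono i _ (hs.symm.trans
      ((map_zero (P.res _)).trans (map_zero (toRestrictApp j i _)).symm))
    subst h0
    rw [map_zero] at hs'
    refine Subtype.ext (Prod.ext rfl ?_)
    change b = 0
    have := congrArg (I.res (image_preimage_eq_of_le j hW).ge) hs'
    rwa [res_res, res_self, map_zero] at this

/-- Morphisms from a submodule of `P|_Y` to `I|_Y` extend to `P ⟶ I` if `I` is injective. -/
theorem exists_extension_of_mono [Mono i] [Injective I] :
    ∃ ψ : P ⟶ I, i ≫ (restrictFunctor j).map ψ = φ := by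
  -- The graph plays the role of the extension by zero of `N`: it embeds in `P` by the first
  -- projection, and the second projection extends to `P` since `I` is injective among presheaves of
  -- modules.
  obtain ⟨ψ, hψ⟩ := Injective.factors (graphSnd j i φ) (graphFst j i φ)
  refine ⟨(fullyFaithfulToPresheafOfModules (X := X)).preimage ψ, hom_ext_apply fun W s => ?_⟩
  have h : ((toRestrictApp j i W s, toRestrictApp j φ W s) : Γ(P, j ''ᵁ W) × Γ(I, j ''ᵁ W)) ∈
      graphSubmodule j i φ (j ''ᵁ W) := by
    refine Or.inr ⟨image_le j W, N.res (j.preimage_image_eq W).le s, ?_, ?_⟩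
    · rw [toRestrictApp_res]
    · rw [toRestrictApp_res]
  exact congrArg (fun f : graphModule j i φ ⟶ (toPresheafOfModules X).obj I =>
    (f.app (op (j ''ᵁ W))).hom ⟨_, h⟩) hψ

end Extend

/-- Every module on `Y` is the restriction of its pushforward, so a monomorphism `A ⟶ B` exhibits
`A` as a submodule of a restricted module. -/
instance injective_restrict (j : Y ⟶ X) [IsOpenImmersion j] (I : X.Modules) [Injective I] :
    Injective (I.restrict j) where
  factors {A B} g f _ := by
    let e := asIso ((restrictAdjunction j).counit.app B)
    obtain ⟨ψ, hψ⟩ := exists_extension_of_mono (P := (pushforward j).obj B) j (f ≫ e.inv) g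
    exact ⟨e.inv ≫ (restrictFunctor j).map ψ, by rw [← hψ, Category.assoc]⟩

end AlgebraicGeometry.Scheme.Modules

/-! ### Exactness of restriction and of `𝓗om` into injectives -/

namespace CategoryTheory.Functor

theorem preservesFiniteLimits_of_preservesMonomorphisms {C D : Type*} [Category* C] [Category* D]
    [Abelian C] [Abelian D] (F : C ⥤ D) [F.Additive] [PreservesFiniteColimits F]
    [F.PreservesMonomorphisms] : PreservesFiniteLimits F := by
  have : F.PreservesHomology := by
    simp only [F.exact_tfae.out 2 0]
    intro S h
    have h' := (F.preservesFiniteColimits_tfae.out 3 0).mp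
      (inferInstance : PreservesFiniteColimits F)
    replace h' := h' S h
    have := h.2
    exact ShortComplex.ShortExact.mk' h'.1 (inferInstanceAs (Mono (F.map S.f))) h'.2
  exact F.preservesFiniteLimits_of_preservesHomology

end CategoryTheory.Functor

namespace TopCat.Sheaf

variable {X : TopCat.{u}}

theorem epi_of_surjective {A B : TopCat.Sheaf Ab.{u} X} (f : A ⟶ B)
    (h : ∀ V : Opens X, Function.Surjective (f.hom.app (op V))) : Epi f := by
  apply (sheafToPresheaf (Opens.grothendieckTopology X) Ab.{u}).epi_of_epi_map
  rw [NatTrans.epi_iff_epi_app]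
  exact fun V => (AddCommGrpCat.epi_iff_surjective _).2 (h V.unop)

theorem mono_of_injective {A B : TopCat.Sheaf Ab.{u} X} (f : A ⟶ B)
    (h : ∀ V : Opens X, Function.Injective (f.hom.app (op V))) : Mono f := by
  apply (sheafToPresheaf (Opens.grothendieckTopology X) Ab.{u}).mono_of_mono_map
  rw [NatTrans.mono_iff_mono_app]
  exact fun V => (AddCommGrpCat.mono_iff_injective _).2 (h V.unop)

theorem exact_of_sections (S : ShortComplex (TopCat.Sheaf Ab.{u} X))
    (h : ∀ (V : Opens X) (s : S.X₂.obj.obj (op V)), S.g.hom.app (op V) s = 0 →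
      ∃ t, S.f.hom.app (op V) t = s) : S.Exact := by
  rw [S.exact_iff_epi_kernel_lift]
  refine epi_of_surjective _ fun V s => ?_
  have h0 : kernel.lift S.g S.f S.zero ≫ kernel.ι S.g = S.f := kernel.lift_ι _ _ _
  obtain ⟨t, ht⟩ := h V ((kernel.ι S.g).hom.app (op V) s)
    (ConcreteCategory.congr_hom (congrArg (fun f => f.hom.app (op V)) (kernel.condition S.g)) s)
  refine ⟨t, app_injective (kernel.ι S.g) V (Eq.trans ?_ ht)⟩
  exact ConcreteCategory.congr_hom (congrArg (fun f => f.hom.app (op V)) h0) t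

theorem shortExact_of_sections (S : ShortComplex (TopCat.Sheaf Ab.{u} X))
    (h₁ : ∀ V : Opens X, Function.Injective (S.f.hom.app (op V)))
    (h₂ : ∀ (V : Opens X) (s : S.X₂.obj.obj (op V)), S.g.hom.app (op V) s = 0 →
      ∃ t, S.f.hom.app (op V) t = s)
    (h₃ : ∀ V : Opens X, Function.Surjective (S.g.hom.app (op V))) : S.ShortExact where
  exact := exact_of_sections S h₂
  mono_f := mono_of_injective _ h₁
  epi_g := epi_of_surjective _ h₃

end TopCat.Sheaf

namespace AlgebraicGeometry.Scheme.Modules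

variable {X Y : Scheme.{u}}

theorem mono_of_app_injective {M N : X.Modules} (f : M ⟶ N)
    (h : ∀ V : X.Opens, Function.Injective (f.app V)) : Mono f := by
  apply (toPresheaf X).mono_of_mono_map
  rw [NatTrans.mono_iff_mono_app]
  exact fun V => (AddCommGrpCat.mono_iff_injective _).2 (h V.unop)

section

variable (j : Y ⟶ X) [IsOpenImmersion j]

instance : (restrictFunctor j).Additive where

instance : (restrictFunctor j).PreservesMonomorphisms where
  preserves f _ := mono_of_app_injective _ fun V => app_injective_of_mono f (j ''ᵁ V)

instance : PreservesFiniteLimits (restrictFunctor j) :=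
  Functor.preservesFiniteLimits_of_preservesMonomorphisms _

end

section hom

variable {F F' : X.Modules} (G : X.Modules)

/-- Precomposition of local homomorphisms with a morphism of modules. -/
noncomputable def localHomPrecomp (f : F' ⟶ F) {G : X.Modules} (U : X.Opens) :
    localHom F G U →+ localHom F' G U where
  toFun φ := ⟨fun V => (φ.1 V).comp (f.app V.1).hom,
    fun V r s => (congrArg (φ.1 V) (f.app_smul r s)).trans (localHom_smul φ V.2 r _),
    fun V W h s => (congrArg (φ.1 W) (app_res f h s)).trans (localHom_res φ V.2 h _)⟩
  map_zero' := rfl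
  map_add' _ _ := rfl

/-- The natural transformation `𝓗om(F, -) ⟶ 𝓗om(F', -)` given by a morphism `F' ⟶ F`. -/
noncomputable def homSheafPrecomp (f : F' ⟶ F) : homSheaf F ⟶ homSheaf F' where
  app G := ⟨{ app U := AddCommGrpCat.ofHom (X := localHom F G U.unop) (Y := localHom F' G U.unop)
                (localHomPrecomp f U.unop)
              naturality _ _ _ := rfl }⟩
  naturality _ _ _ := rfl

/-- The local homomorphism given by a morphism. -/
noncomputable def localHomOfHom {G : X.Modules} (ψ : F ⟶ G) (U : X.Opens) : localHom F G U :=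
  ⟨fun V => (ψ.app V.1).hom, fun _ r s => ψ.app_smul r s, fun _ _ h s => app_res ψ h s⟩

/-- Injectivity extends the local homomorphism not just from `F'` to `F` but to a morphism on all of
`X`. For `f = 𝟙` this says that `𝓗om(F, I)` is flasque. -/
theorem exists_localHomPrecomp_eq (f : F' ⟶ F) [Mono f] {I : X.Modules} [Injective I]
    (U : X.Opens) (φ : localHom F' I U) :
    ∃ ψ : F ⟶ I, localHomPrecomp f U (localHomOfHom ψ U) = φ := by
  obtain ⟨ψ, hψ⟩ := exists_extension_of_mono U.ι ((restrictFunctor U.ι).map f)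
    (localHomToHom U.ι U.opensRange_ι.le φ)
  exact ⟨ψ, localHomToHom_injective U.ι U.opensRange_ι.le U.opensRange_ι.ge hψ⟩

instance isFlasque_homSheaf (I : X.Modules) [Injective I] : ((homSheaf F).obj I).IsFlasque where
  epi {U V} i := by
    rw [AddCommGrpCat.epi_iff_surjective]
    intro φ
    obtain ⟨ψ, hψ⟩ := exists_localHomPrecomp_eq (𝟙 F) V.unop φ
    exact ⟨localHomOfHom ψ U.unop, hψ⟩

/-- The complex `𝓗om(F, G) ⟶ 𝓗om(F', G) ⟶ 𝓗om(F'', G)`. -/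
noncomputable def homShortComplex (S : ShortComplex X.Modules) (G : X.Modules) :
    ShortComplex (TopCat.Sheaf Ab.{u} X) :=
  ShortComplex.mk ((homSheafPrecomp S.g).app G) ((homSheafPrecomp S.f).app G) (by
    have : homSheafPrecomp S.g ≫ homSheafPrecomp S.f = homSheafPrecomp (S.f ≫ S.g) := rfl
    rw [← NatTrans.comp_app, this, S.zero]
    apply (sheafToPresheaf (Opens.grothendieckTopology X) Ab.{u}).map_injective
    ext U φ
    refine Subtype.ext (funext fun V => AddMonoidHom.ext fun s => ?_)
    exact map_zero (φ.1 V))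

theorem homShortComplex_shortExact {S : ShortComplex X.Modules} (hS : S.ShortExact)
    (I : X.Modules) [Injective I] : (homShortComplex S I).ShortExact := by
  have := hS.mono_f
  have := hS.epi_g
  refine TopCat.Sheaf.shortExact_of_sections _ (fun (V : X.Opens) φ φ' h => ?_)
    (fun (V : X.Opens) φ h => ?_) fun (V : X.Opens) φ => ?_
  · refine localHomToHom_injective V.ι V.opensRange_ι.le V.opensRange_ι.ge ?_
    rw [← cancel_epi ((restrictFunctor V.ι).map S.g)]
    exact congrArg (localHomToHom V.ι V.opensRange_ι.le) h
  · have hS' := hS.map_of_exact (restrictFunctor V.ι)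
    have := hS'.epi_g
    obtain ⟨l, hl⟩ : ∃ l, (restrictFunctor V.ι).map S.g ≫ l = localHomToHom V.ι V.opensRange_ι.le φ :=
      ⟨_, hS'.exact.g_desc (localHomToHom V.ι V.opensRange_ι.le φ)
        (congrArg (localHomToHom V.ι V.opensRange_ι.le) h)⟩
    refine ⟨homToLocalHom V.ι l V.opensRange_ι.ge,
      localHomToHom_injective V.ι V.opensRange_ι.le V.opensRange_ι.ge ?_⟩
    refine Eq.trans ?_ hl
    exact congrArg ((restrictFunctor V.ι).map S.g ≫ ·)
      (localHomToHom_homToLocalHom V.ι l V.opensRange_ι.le V.opensRange_ι.ge)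
  · obtain ⟨ψ, hψ⟩ := exists_localHomPrecomp_eq S.f V φ
    exact ⟨_, hψ⟩

end hom

end AlgebraicGeometry.Scheme.Modules

/-! ### Restriction of abelian sheaves, acyclicity and Ext sheaves along open immersions -/

namespace AlgebraicGeometry.Scheme.Modules

variable {X Y : Scheme.{u}}

section

variable (j : Y ⟶ X) [IsOpenImmersion j]

/-- Restriction of abelian sheaves along an open immersion. -/
noncomputable def resSheaf : TopCat.Sheaf Ab.{u} X ⥤ TopCat.Sheaf Ab.{u} Y :=
  j.opensFunctor.sheafPushforwardContinuous Ab.{u} (Opens.grothendieckTopology Y)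
    (Opens.grothendieckTopology X)

instance : (resSheaf j).Additive where

instance : (resSheaf j).IsLeftAdjoint :=
  (j.opensFunctor.sheafAdjunctionCocontinuous Ab.{u} (Opens.grothendieckTopology Y)
    (Opens.grothendieckTopology X)).isLeftAdjoint

instance : (resSheaf j).PreservesMonomorphisms where
  preserves f _ := TopCat.Sheaf.mono_of_injective _ fun V =>
    TopCat.Sheaf.app_injective f (j ''ᵁ V)

instance : PreservesFiniteLimits (resSheaf j) :=
  Functor.preservesFiniteLimits_of_preservesMonomorphisms _

instance (A : TopCat.Sheaf Ab.{u} X) [A.IsFlasque] : ((resSheaf j).obj A).IsFlasque where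
  epi i := inferInstanceAs (Epi (A.obj.map (j.opensFunctor.op.map i)))

open Abelian TopCat.Sheaf

/-- Dimension shifting again, which avoids comparing Ext groups on `X` and `Y`: an injective sheaf
restricts to a flasque one, so the quotient stays in the class and its sections lift. -/
theorem acyclicOn_of_resSheaf {A : TopCat.Sheaf Ab.{u} X}
    (h : AcyclicOn ⊤ ((resSheaf j).obj A)) : AcyclicOn (j ''ᵁ ⊤) A := by
  refine AcyclicOn.of_class (fun A => AcyclicOn ⊤ ((resSheaf j).obj A)) (fun A h => ?_) h
  have hS := injectiveShort_shortExact A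
  have hS' := hS.map_of_exact (resSheaf j)
  have : Injective (injectiveShort A).X₂ := inferInstanceAs (Injective (Injective.under A))
  have : IsFlasque (injectiveShort A).X₂ := isFlasque_of_injective _
  exact ⟨_, hS, rfl, .of_injective _, AcyclicOn.X₃ hS' h
    (AcyclicOn.of_isFlasque ((resSheaf j).obj (injectiveShort A).X₂)), fun s =>
      AcyclicOn.surjective hS' h s⟩

/-- Restriction of local homomorphisms along an open immersion. -/
noncomputable def restrictLocalHom {F G : X.Modules} (W : Y.Opens) :
    localHom F G (j ''ᵁ W) →+ localHom (F.restrict j) (G.restrict j) W where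
  toFun φ := ⟨fun V => φ.1 ⟨j ''ᵁ V.1, j.image_mono V.2⟩,
    fun V _ s => localHom_smul φ (j.image_mono V.2) _ s,
    fun V _ h s => localHom_res φ (j.image_mono V.2) (j.image_mono h) s⟩
  map_zero' := rfl
  map_add' _ _ := rfl

section

variable {F G : X.Modules} {W : Y.Opens} (ψ : localHom (F.restrict j) (G.restrict j) W)

/-- A local homomorphism of restrictions, acting on sections over images of open subsets. -/
noncomputable def imageApp {V : Y.Opens} (hV : V ≤ W) : Γ(F, j ''ᵁ V) →+ Γ(G, j ''ᵁ V) :=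
  ψ.1 ⟨V, hV⟩

theorem imageApp_res {V V' : Y.Opens} (hV : V ≤ W) (h : V' ≤ V) (h' : j ''ᵁ V' ≤ j ''ᵁ V)
    (s : Γ(F, j ''ᵁ V)) :
    imageApp j ψ (h.trans hV) (F.res h' s) = G.res h' (imageApp j ψ hV s) := localHom_res ψ hV h s

theorem imageApp_smul {V : Y.Opens} (hV : V ≤ W) (r : Γ(X, j ''ᵁ V)) (s : Γ(F, j ''ᵁ V)) :
    imageApp j ψ hV (r • s) = r • imageApp j ψ hV s := by
  have h : (j.appIso V).inv ((j.appIso V).hom r) = r := CategoryTheory.Iso.hom_inv_id_apply _ r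
  have h' : imageApp j ψ hV ((j.appIso V).inv ((j.appIso V).hom r) • s) =
      (j.appIso V).inv ((j.appIso V).hom r) • imageApp j ψ hV s :=
    localHom_smul ψ hV ((j.appIso V).hom r) s
  rwa [h] at h'

theorem preimage_le_of_le_image {V : X.Opens} (hV : V ≤ j ''ᵁ W) : j ⁻¹ᵁ V ≤ W :=
  (j.preimage_mono hV).trans (j.preimage_image_eq W).le

/-- A local homomorphism of restrictions, acting on sections over open subsets of the image. -/
noncomputable def imageAppOfLe {V : X.Opens} (hV : V ≤ j ''ᵁ W) : Γ(F, V) →+ Γ(G, V) :=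
  (G.res (image_preimage_eq_of_le j (hV.trans (image_le j W))).ge).comp
    ((imageApp j ψ (preimage_le_of_le_image j hV)).comp
      (F.res (image_preimage_eq_of_le j (hV.trans (image_le j W))).le))

theorem imageAppOfLe_image {V : Y.Opens} (hV : j ''ᵁ V ≤ j ''ᵁ W) (hV' : V ≤ W)
    (s : Γ(F, j ''ᵁ V)) : imageAppOfLe j ψ hV s = imageApp j ψ hV' s := by
  change G.res _ (imageApp j ψ _ (F.res _ s)) = _
  rw [imageApp_res j ψ hV' (j.preimage_image_eq V).le, res_res, res_self]

theorem exists_image_eq {V : X.Opens} (hV : V ≤ j ''ᵁ W) : ∃ V' : Y.Opens, V' ≤ W ∧ V = j ''ᵁ V' :=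
  ⟨_, preimage_le_of_le_image j hV, (image_preimage_eq_of_le j (hV.trans (image_le j W))).symm⟩

/-- The local homomorphism given by a local homomorphism of restrictions. -/
noncomputable def extendLocalHom : localHom F G (j ''ᵁ W) :=
  ⟨fun V => imageAppOfLe j ψ V.2, by
    constructor
    · rintro ⟨V, hV⟩ r s
      have hV' : V ≤ j ''ᵁ W := hV
      obtain ⟨V, h, rfl⟩ := exists_image_eq j hV'
      change imageAppOfLe j ψ hV' (r • s) = r • imageAppOfLe j ψ hV' s
      rw [imageAppOfLe_image j ψ hV' h, imageAppOfLe_image j ψ hV' h, imageApp_smul]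
    · rintro ⟨V, hV⟩ ⟨V', hV'⟩ h s
      have h1 : V ≤ j ''ᵁ W := hV
      have h2 : V' ≤ j ''ᵁ W := hV'
      have h3 : V' ≤ V := h
      obtain ⟨V, h4, rfl⟩ := exists_image_eq j h1
      obtain ⟨V', h5, rfl⟩ := exists_image_eq j h3
      change imageAppOfLe j ψ h2 (F.res h3 s) = G.res h3 (imageAppOfLe j ψ h1 s)
      rw [imageAppOfLe_image j ψ h1 h4, imageAppOfLe_image j ψ h2 (h5.trans h4),
        imageApp_res j ψ h4 h5]⟩

end

theorem restrictLocalHom_bijective {F G : X.Modules} (W : Y.Opens) :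
    Function.Bijective (restrictLocalHom (F := F) (G := G) j W) := by
  constructor
  · intro φ ψ h
    refine Subtype.ext (funext fun ⟨V, hV⟩ => AddMonoidHom.ext fun s => ?_)
    have hV' : V ≤ j ''ᵁ W := hV
    obtain ⟨V, hVW, rfl⟩ := exists_image_eq j hV'
    exact DFunLike.congr_fun (congrFun (congrArg Subtype.val h) ⟨V, hVW⟩) s
  · intro ψ
    refine ⟨extendLocalHom j ψ, Subtype.ext (funext fun ⟨V, hV⟩ => AddMonoidHom.ext fun s => ?_)⟩
    exact imageAppOfLe_image j ψ (j.image_mono hV) hV s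

/-- `𝓗om` commutes with restriction along open immersions. -/
noncomputable def homSheafRestrict (F : X.Modules) :
    homSheaf F ⋙ resSheaf j ≅ restrictFunctor j ⋙ homSheaf (F.restrict j) :=
  NatIso.ofComponents (fun G => ObjectProperty.isoMk _ (NatIso.ofComponents (fun W =>
    (AddEquiv.ofBijective (restrictLocalHom (F := F) (G := G) j W.unop)
      (restrictLocalHom_bijective j W.unop)).toAddCommGrpIso) fun _ => rfl)) fun _ => rfl

/-- The Ext sheaves commute with restriction -/
noncomputable def resSheafHomology (F : X.Modules) (K : CochainComplex X.Modules ℕ) (n : ℕ) :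
    (resSheaf j).obj ((((homSheaf F).mapHomologicalComplex _).obj K).homology n) ≅
      (((homSheaf (F.restrict j)).mapHomologicalComplex _).obj
        (((restrictFunctor j).mapHomologicalComplex _).obj K)).homology n :=
  (((((homSheaf F).mapHomologicalComplex _).obj K).sc n).mapHomologyIso (resSheaf j)).symm ≪≫
    (HomologicalComplex.homologyFunctor _ _ n).mapIso
      ((NatIso.mapHomologicalComplex (homSheafRestrict j F) _).app K)

end

end AlgebraicGeometry.Scheme.Modules

/-! ### Noetherian algebra: Artin–Rees and injective modules -/

theorem pow_smul_eq_zero_of_le {R N : Type*} [CommRing R] [AddCommGroup N] [Module R N] {f : R}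
    {x : N} {n m : ℕ} (h : n ≤ m) (hx : f ^ n • x = 0) : f ^ m • x = 0 := by
  obtain ⟨c, hc⟩ := pow_dvd_pow f h
  rw [hc, mul_comm, mul_smul, hx, smul_zero]

/-- A power of each `f i` kills the finitely many generators of `N`, so the ideal lies in the
radical of the annihilator; being finitely generated, it has a power in the annihilator. -/
theorem Ideal.exists_pow_le_annihilator {R : Type*} [CommRing R] [IsNoetherianRing R] {N : Type*}
    [AddCommGroup N] [Module R N] [Module.Finite R N] {ι : Type*} (f : ι → R)
    (h : ∀ (i : ι) (x : N), ∃ n : ℕ, f i ^ n • x = 0) :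
    ∃ k : ℕ, Ideal.span (Set.range f) ^ k ≤ Module.annihilator R N := by
  refine Ideal.exists_pow_le_of_le_radical_of_fg ?_ (IsNoetherian.noetherian _)
  rw [Ideal.span_le]
  rintro _ ⟨i, rfl⟩
  obtain ⟨S, hS⟩ := Module.Finite.fg_top (R := R) (M := N)
  choose n hn using h i
  refine ⟨S.sup n, ?_⟩
  rw [← Submodule.annihilator_top, ← hS, Submodule.mem_annihilator_span]
  rintro ⟨x, hx⟩
  exact pow_smul_eq_zero_of_le (Finset.le_sup (f := n) hx) (hn x)

/-- A consequence of the Artin–Rees lemma. -/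
theorem LinearMap.exists_injOn_pow_smul_mem {R : Type*} [CommRing R] [IsNoetherianRing R]
    {T T₂ : Type*} [AddCommGroup T] [Module R T] [Module.Finite R T] [AddCommGroup T₂]
    [Module R T₂] (a : T →ₗ[R] T₂) {ι : Type*} (f : ι → R)
    (h : ∀ x, a x = 0 → ∀ i, ∃ n : ℕ, f i ^ n • x = 0) :
    ∃ (T' : Submodule R T) (L : ℕ), Function.Injective (a.domRestrict T') ∧
      ∀ i x, f i ^ L • x ∈ T' := by
  obtain ⟨k, hk⟩ : ∃ k : ℕ, Ideal.span (Set.range f) ^ k ≤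
      Module.annihilator R (LinearMap.ker a) :=
    Ideal.exists_pow_le_annihilator f fun i x => by
      obtain ⟨l, hl⟩ := h x.1 x.2 i
      exact ⟨l, Subtype.ext hl⟩
  -- With `I` the ideal of the `f i`, Artin–Rees gives `I^(k₀+k) T ∩ ker a = I^k (I^k₀ T ∩ ker a) ⊆
  -- I^k ker a = 0`.
  obtain ⟨k₀, hk₀⟩ := (Ideal.span (Set.range f)).exists_pow_inf_eq_pow_smul (LinearMap.ker a)
  refine ⟨Ideal.span (Set.range f) ^ (k₀ + k) • ⊤, k₀ + k, ?_, fun i x =>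
    Submodule.smul_mem_smul (Ideal.pow_mem_pow (Ideal.subset_span (Set.mem_range_self i)) _)
      Submodule.mem_top⟩
  have hT : Ideal.span (Set.range f) ^ (k₀ + k) • (⊤ : Submodule R T) ⊓ LinearMap.ker a = ⊥ := by
    rw [hk₀ _ (Nat.le_add_right _ _), eq_bot_iff, Nat.add_sub_cancel_left]
    refine (Submodule.smul_mono le_rfl inf_le_right).trans (Submodule.smul_le.2 fun r hr x hx => ?_)
    exact congrArg Subtype.val (Module.mem_annihilator.1 (hk hr) (⟨x, hx⟩ : LinearMap.ker a))
  rw [← LinearMap.ker_eq_bot, LinearMap.ker_eq_bot']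
  intro x hx
  have h0 : x.1 ∈ (⊥ : Submodule R T) := hT.le ⟨x.2, hx⟩
  exact Subtype.ext h0

theorem ModuleCat.exists_extension_of_injective {R : Type u} [CommRing R] (E : ModuleCat.{u} R)
    [Injective E] {A B : Type u} [AddCommGroup A] [Module R A] [AddCommGroup B] [Module R B]
    (a : A →ₗ[R] B) (ha : Function.Injective a) (b : A →ₗ[R] E) :
    ∃ c : B →ₗ[R] E, ∀ x, c (a x) = b x := by
  have : Mono (ModuleCat.ofHom a) := (ModuleCat.mono_iff_injective _).2 ha
  obtain ⟨c, hc⟩ := Injective.factors (J := E) (ModuleCat.ofHom b) (ModuleCat.ofHom a)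
  exact ⟨c.hom, fun x => ConcreteCategory.congr_hom hc x⟩

/-- Over a Noetherian ring, an element of a module `S` over an injective module `E` that is locally
in the image of `E` is locally equal to the image of an element of `E`. -/
theorem ModuleCat.exists_pow_smul_eq_of_injective {R : Type u} [CommRing R] [IsNoetherianRing R]
    (E : ModuleCat.{u} R) [Injective E] {S : Type*} [AddCommGroup S] [Module R S]
    (ρ : E →ₗ[R] S) (s : S) {ι : Type*} [Finite ι] (f : ι → R)
    (h₁ : ∀ i, ∃ (n : ℕ) (m : E), f i ^ n • s = ρ m)
    (h₂ : ∀ m, ρ m = 0 → ∀ i, ∃ n : ℕ, f i ^ n • m = 0) :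
    ∃ e : E, ∀ i, ∃ n : ℕ, f i ^ n • s = f i ^ n • ρ e := by
  choose n m hm using h₁
  -- `T` is a multivalued partial map `R ⇢ E` lifting `r ↦ r • s` along `ρ`; its ambiguity is the
  -- set of elements with first coordinate `0`.
  let T : Submodule R (R × E) := Submodule.span R (Set.range fun i => (f i ^ n i, m i))
  have hT : ∀ x ∈ T, x.1 • s = ρ x.2 := by
    intro x hx
    induction hx using Submodule.span_induction with
    | mem x hx => obtain ⟨i, rfl⟩ := hx; exact hm i
    | zero => simp
    | add x y _ _ hx hy => simp [add_smul, hx, hy]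
    | smul r x _ hx => simp [mul_smul, hx]
  have : Module.Finite R T := Module.Finite.span_of_finite R (Set.finite_range _)
  -- The ambiguity lies in `ker ρ`, which is killed locally by powers of the `f i`. So after
  -- shrinking, `T'` is the graph of a map from an ideal of `R` to `E`.
  obtain ⟨T', L, h, hL⟩ := (LinearMap.fst R R E ∘ₗ T.subtype).exists_injOn_pow_smul_mem f
    fun x hx i => by
      have hx : x.1.1 = 0 := hx
      obtain ⟨l, hl⟩ := h₂ x.1.2 (by rw [← hT _ x.2, hx, zero_smul]) i
      exact ⟨l, Subtype.ext (Prod.ext ((congrArg (f i ^ l • ·) hx).trans (smul_zero _)) hl)⟩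
  obtain ⟨c, hc⟩ := E.exists_extension_of_injective (A := T') _ h
    ((LinearMap.snd R R E ∘ₗ T.subtype).domRestrict T')
  -- The map on the ideal extends to `c : R ⟶ E` by injectivity, and `c 1` is the required element.
  refine ⟨c 1, fun i => ⟨L + n i, ?_⟩⟩
  have hg : ((f i ^ n i, m i) : R × E) ∈ T := Submodule.subset_span ⟨i, rfl⟩
  have h : c (f i ^ L * f i ^ n i) = f i ^ L • m i := hc ⟨_, hL i ⟨_, hg⟩⟩
  have h' : c (f i ^ L * f i ^ n i) = f i ^ (L + n i) • c 1 := by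
    rw [← map_smul, smul_eq_mul, mul_one, pow_add]
  rw [← map_smul, ← h', h, map_smul, ← hm, smul_smul, pow_add]

/-! ### Sheaves of injective modules on a Noetherian affine scheme are flasque -/

namespace AlgebraicGeometry.Scheme.Modules

variable {R : CommRingCat.{u}}

/-- The basic open subset of `Spec R` given by an element of `R`. -/
abbrev specD (f : R) : (Spec R).Opens := _root_.PrimeSpectrum.basicOpen f

/-- Restriction of sections, as a linear map. -/
noncomputable def specRes (N : (Spec R).Modules) {V W : (Spec R).Opens} (h : W ≤ V) :
    Γ(N, V) →ₗ[R] Γ(N, W) where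
  __ := N.res h
  map_smul' r s := map_smul_Spec (homOfLE h).op r s

theorem specRes_apply (N : (Spec R).Modules) {V W : (Spec R).Opens} (h : W ≤ V) (s : Γ(N, V)) :
    specRes N h s = N.res h s := rfl

/-- The canonical map from a module to the sections of the associated sheaf. -/
noncomputable def tildeOpen (M : ModuleCat.{u} R) (U : (Spec R).Opens) :
    M →ₗ[R] Γ(tilde M, U) := (tilde.toOpen M U).hom

instance (M : ModuleCat.{u} R) (f : R) :
    IsLocalizedModule.Away f (tildeOpen M (specD f)) :=
  inferInstanceAs (IsLocalizedModule.Away f (tilde.toOpen M (specD f)).hom)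

theorem res_tildeOpen (M : ModuleCat.{u} R) {V W : (Spec R).Opens} (h : W ≤ V) (m : M) :
    specRes (tilde M) h (tildeOpen M V m) = tildeOpen M W m :=
  ConcreteCategory.congr_hom (tilde.toOpen_res M V W (homOfLE h)) m

theorem exists_pow_smul_eq_tildeOpen (M : ModuleCat.{u} R) (f : R) (s : Γ(tilde M, specD f)) :
    ∃ (n : ℕ) (m : M), f ^ n • s = tildeOpen M (specD f) m := by
  obtain ⟨⟨m, ⟨_, n, rfl⟩⟩, h⟩ := IsLocalizedModule.surj (Submonoid.powers f)
    (tildeOpen M (specD f)) s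
  exact ⟨n, m, h⟩

theorem exists_pow_smul_eq_zero_of_tildeOpen_eq_zero (M : ModuleCat.{u} R) (f : R) (m : M)
    (h : tildeOpen M (specD f) m = 0) : ∃ n : ℕ, f ^ n • m = 0 := by
  obtain ⟨⟨_, n, rfl⟩, h⟩ := (IsLocalizedModule.eq_zero_iff (Submonoid.powers f)
    (tildeOpen M (specD f))).1 h
  exact ⟨n, h⟩

theorem eq_of_pow_smul_eq {N : (Spec R).Modules} {U : (Spec R).Opens} {f : R}
    (hU : U ≤ specD f) {s t : Γ(N, U)} {n : ℕ} (h : f ^ n • s = f ^ n • t) : s = t :=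
  (isSMulRegular_of_le_basicOpen hU).pow n h

theorem eq_of_res_eq {X : Scheme.{u}} (N : X.Modules) {ι : Type u} {U : X.Opens}
    (V : ι → X.Opens) (hV : ∀ i, V i ≤ U) (hU : U ≤ ⨆ i, V i) {s t : Γ(N, U)}
    (h : ∀ i, N.res (hV i) s = N.res (hV i) t) : s = t := by
  refine N.abSheaf.eq_of_locally_eq' V U (fun i => homOfLE (hV i)) hU s t h

/-- A section over a quasi-compact open subset which vanishes on `D(f)` is killed by a power
of `f`. -/
theorem exists_pow_smul_eq_zero (M : ModuleCat.{u} R) {ι : Type u} [Finite ι] {U : (Spec R).Opens}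
    (g : ι → R) (hg : ∀ i, specD (g i) ≤ U) (hU : U ≤ ⨆ i, specD (g i)) {f : R}
    (hf : specD f ≤ U) (s : Γ(tilde M, U)) (h : (tilde M).res hf s = 0) :
    ∃ n : ℕ, f ^ n • s = 0 := by
  have key : ∀ i, ∃ n : ℕ, f ^ n • specRes (tilde M) (hg i) s = 0 := by
    intro i
    obtain ⟨n, m, hm⟩ := exists_pow_smul_eq_tildeOpen M (g i) (specRes (tilde M) (hg i) s)
    have hl : specD (f * g i) ≤ specD f := PrimeSpectrum.basicOpen_mul_le_left _ _
    have hr : specD (f * g i) ≤ specD (g i) := PrimeSpectrum.basicOpen_mul_le_right _ _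
    have h1 : tildeOpen M (specD (f * g i)) m = 0 := by
      rw [← res_tildeOpen M hr, ← hm, _root_.map_smul]
      have : specRes (tilde M) hr (specRes (tilde M) (hg i) s) =
          specRes (tilde M) hl (specRes (tilde M) hf s) :=
        ((tilde M).res_res (hg i) hr s).trans ((tilde M).res_res hf hl s).symm
      rw [this, specRes_apply _ hf, h, map_zero, smul_zero]
    obtain ⟨k, hk⟩ := exists_pow_smul_eq_zero_of_tildeOpen_eq_zero M _ m h1
    -- `g i` acts invertibly on sections over `D(g i)`, so the claim may be multiplied by `g i ^ (k
    -- + n)`.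
    refine ⟨k, eq_of_pow_smul_eq (n := k + n) le_rfl ?_⟩
    have h2 : (f * g i) ^ k • g i ^ n • specRes (tilde M) (hg i) s = 0 := by
      rw [hm, ← (tildeOpen M (specD (g i))).map_smul, hk, map_zero]
    have h3 : (f * g i) ^ k * g i ^ n = g i ^ (k + n) * f ^ k := by ring
    rw [smul_smul, h3, mul_smul] at h2
    rw [h2, smul_zero]
  choose n hn using key
  cases nonempty_fintype ι
  refine ⟨Finset.univ.sup n, ?_⟩
  refine eq_of_res_eq (tilde M) (fun i => specD (g i)) hg hU fun i => ?_
  rw [map_zero]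
  refine (_root_.map_smul (specRes (tilde M) (hg i)) _ s).trans ?_
  exact pow_smul_eq_zero_of_le (Finset.le_sup (f := n) (Finset.mem_univ i)) (hn i)

/-- Every section over any open set is in fact induced by an element of `E`. The open set is a
finite union of sets `D(g i)`, where the section has the form `m / g i ^ n`, and injectivity glues
these fractions to one element up to powers of the `g i`. -/
theorem isFlasque_tilde [IsNoetherianRing R] (E : ModuleCat.{u} R) [Injective E] :
    (tilde E).abSheaf.IsFlasque where
  epi {V U} i := by
    suffices ∀ s : Γ(tilde E, U.unop), ∃ e : E, tildeOpen E U.unop e = s by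
      rw [AddCommGrpCat.epi_iff_surjective]
      intro s
      obtain ⟨e, he⟩ := this s
      exact ⟨tildeOpen E V.unop e, (res_tildeOpen E i.unop.le e).trans he⟩
    intro s
    obtain ⟨ι, _, g, hg⟩ : ∃ (ι : Type u) (_ : Finite ι) (g : ι → R),
        U.unop = ⨆ i, specD (g i) := by
      exact PrimeSpectrum.isBasis_basic_opens.exists_iSup_eq_of_isCompact U.unop
        (NoetherianSpace.isCompact _)
    have hg' : ∀ i, specD (g i) ≤ U.unop := fun i => hg ▸ le_iSup (fun i => specD (g i)) i
    suffices ∃ e : E, ∀ i, ∃ n : ℕ, g i ^ n • s = g i ^ n • tildeOpen E U.unop e by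
      obtain ⟨e, he⟩ := this
      refine ⟨e, (eq_of_res_eq (tilde E) (fun i => specD (g i)) hg' hg.le fun i => ?_).symm⟩
      obtain ⟨n, hn⟩ := he i
      have := congrArg (specRes (tilde E) (hg' i)) hn
      rw [_root_.map_smul, _root_.map_smul] at this
      exact eq_of_pow_smul_eq le_rfl this
    refine ModuleCat.exists_pow_smul_eq_of_injective E (tildeOpen E U.unop) s g
      (fun i => ?_) (fun m hm i => ?_)
    · obtain ⟨n, m, hm⟩ := exists_pow_smul_eq_tildeOpen E (g i) (specRes (tilde E) (hg' i) s)
      obtain ⟨k, hk⟩ := exists_pow_smul_eq_zero E g hg' hg.le (hg' i)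
        (g i ^ n • s - tildeOpen E U.unop m) (by
          rw [← specRes_apply, map_sub, _root_.map_smul, hm, res_tildeOpen, sub_self])
      refine ⟨k + n, g i ^ k • m, ?_⟩
      rw [smul_sub, sub_eq_zero] at hk
      rw [pow_add, mul_smul, hk, _root_.map_smul]
    · refine exists_pow_smul_eq_zero_of_tildeOpen_eq_zero E (g i) m ?_
      rw [← res_tildeOpen E (hg' i), hm, map_zero]

end AlgebraicGeometry.Scheme.Modules

/-! ### Vanishing of cohomology of quasi-coherent sheaves on affine schemes -/

namespace CategoryTheory.Functor

theorem preservesFiniteColimits_of_preservesEpimorphisms {C D : Type*} [Category* C] [Category* D]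
    [Abelian C] [Abelian D] (F : C ⥤ D) [F.Additive] [PreservesFiniteLimits F]
    [F.PreservesEpimorphisms] : PreservesFiniteColimits F := by
  have : F.PreservesHomology := by
    simp only [F.exact_tfae.out 2 0]
    intro S h
    have h' := (F.preservesFiniteLimits_tfae.out 3 0).mp
      (inferInstance : PreservesFiniteLimits F)
    replace h' := h' S h
    have := h.3
    exact ShortComplex.ShortExact.mk' h'.1 h'.2 (inferInstanceAs (Epi (F.map S.g)))
  exact F.preservesFiniteColimits_of_preservesHomology

end CategoryTheory.Functor

namespace AlgebraicGeometry.Scheme.Modules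

variable (X : Scheme.{u})

/-- The functor from modules to abelian sheaves. -/
noncomputable def toAbSheaf : X.Modules ⥤ TopCat.Sheaf Ab.{u} X :=
  SheafOfModules.toSheaf X.ringCatSheaf

instance : (toAbSheaf X).Additive := inferInstanceAs (SheafOfModules.toSheaf X.ringCatSheaf).Additive

instance : PreservesFiniteLimits (toAbSheaf X) :=
  inferInstanceAs (PreservesFiniteLimits (SheafOfModules.toSheaf X.ringCatSheaf))

instance : (sheafify X).IsLeftAdjoint := (sheafifyAdjunction X).isLeftAdjoint

variable {X}

variable (X) in
/-- Sheafification of modules is compatible with sheafification of abelian presheaves. -/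
noncomputable def sheafifyCompToAbSheaf : sheafify X ⋙ toAbSheaf X ≅
    PresheafOfModules.toPresheaf _ ⋙ presheafToSheaf (Opens.grothendieckTopology X) Ab.{u} :=
  PresheafOfModules.sheafificationCompToSheaf (𝟙 X.ringCatSheaf.obj)

variable (X) in
/-- Modules are sheafifications of the underlying presheaves. -/
noncomputable def sheafifyCounitIso : toPresheafOfModules X ⋙ sheafify X ≅ 𝟭 _ :=
  have : IsIso (sheafifyAdjunction X).counit := inferInstance
  asIso (sheafifyAdjunction X).counit

/-- For an epimorphism, the cokernel formed in presheaves of modules has zero sheafification.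
Sheafifying modules or their underlying abelian presheaves gives the same abelian sheaf, so the
cokernel of abelian sheaves vanishes too. -/
instance : (toAbSheaf X).PreservesEpimorphisms where
  preserves {M N} f _ := by
    let g := (toPresheafOfModules X).map f
    have h1 : Epi ((sheafify X).map g) :=
      ((MorphismProperty.epimorphisms _).arrow_mk_iso_iff
        (Arrow.isoOfNatIso (sheafifyCounitIso X) (Arrow.mk f))).2 ‹Epi f›
    let T := PresheafOfModules.toPresheaf X.ringCatSheaf.obj ⋙
      presheafToSheaf (Opens.grothendieckTopology X) Ab.{u}
    have : PreservesFiniteColimits T := inferInstance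
    have h2 : (sheafify X).map (cokernel.π g) = 0 := by
      rw [← cancel_epi ((sheafify X).map g), ← Functor.map_comp, cokernel.condition,
        Functor.map_zero, comp_zero]
    have h3 : IsZero ((sheafify X).obj (cokernel g)) := IsZero.of_epi_eq_zero _ h2
    have h4 : IsZero (T.obj (cokernel g)) :=
      ((toAbSheaf X).map_isZero h3).of_iso ((sheafifyCompToAbSheaf X).app _).symm
    have h5 : Epi (T.map g) := Preadditive.epi_of_isZero_cokernel _ (h4.of_iso (PreservesCokernel.iso T g).symm)
    have h6 : Epi ((sheafify X ⋙ toAbSheaf X).map g) :=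
      ((MorphismProperty.epimorphisms _).arrow_mk_iso_iff
        (Arrow.isoOfNatIso (sheafifyCompToAbSheaf X) (Arrow.mk g))).2 h5
    exact ((MorphismProperty.epimorphisms _).arrow_mk_iso_iff
        ((toAbSheaf X).mapArrow.mapIso (Arrow.isoOfNatIso (sheafifyCounitIso X) (Arrow.mk f)))).1 h6

instance : PreservesFiniteColimits (toAbSheaf X) :=
  Functor.preservesFiniteColimits_of_preservesEpimorphisms _

variable {R : CommRingCat.{u}}

/-- The action of a morphism on sections, as a linear map. -/
noncomputable def specApp {N N' : (Spec R).Modules} (f : N ⟶ N') (V : (Spec R).Opens) :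
    Γ(N, V) →ₗ[R] Γ(N', V) where
  __ := (f.app V).hom
  map_smul' r s := ((modulesSpecToSheaf.map f).hom.app (op V)).hom.map_smul r s

theorem specApp_tildeOpen {M N : ModuleCat.{u} R} (f : M ⟶ N) (V : (Spec R).Opens) (m : M) :
    specApp (tilde.map f) V (tildeOpen M V m) = tildeOpen N V (f m) :=
  ConcreteCategory.congr_hom (tilde.toOpen_map_app f V) m

theorem specApp_res {N N' : (Spec R).Modules} (f : N ⟶ N') {V W : (Spec R).Opens} (h : W ≤ V)
    (s : Γ(N, V)) : specApp f W (specRes N h s) = specRes N' h (specApp f V s) :=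
  app_res f h s

theorem exists_iSup_specD_eq (V : (Spec R).Opens) :
    ∃ (ι : Type u) (g : ι → R), V = ⨆ i, specD (g i) :=
  PrimeSpectrum.isBasis_basic_opens.exists_iSup_eq V

theorem tilde_map_app_injective {M N : ModuleCat.{u} R} (f : M ⟶ N) (hf : Function.Injective f)
    (V : (Spec R).Opens) : Function.Injective (specApp (tilde.map f) V) := by
  rw [← LinearMap.ker_eq_bot, LinearMap.ker_eq_bot']
  intro s hs
  obtain ⟨ι, g, hg⟩ := exists_iSup_specD_eq V
  have hg' : ∀ i, specD (g i) ≤ V := fun i => hg ▸ le_iSup (fun i => specD (g i)) i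
  refine eq_of_res_eq (tilde M) (fun i => specD (g i)) hg' hg.le fun i => ?_
  rw [map_zero]
  obtain ⟨n, m, hm⟩ := exists_pow_smul_eq_tildeOpen M (g i) (specRes (tilde M) (hg' i) s)
  have h1 : tildeOpen N (specD (g i)) (f m) = 0 := by
    rw [← specApp_tildeOpen, ← hm, _root_.map_smul, specApp_res, hs, map_zero, smul_zero]
  obtain ⟨k, hk⟩ := exists_pow_smul_eq_zero_of_tildeOpen_eq_zero N _ _ h1
  have h2 : g i ^ k • m = 0 := hf (by
    rw [map_zero, ← hk]; exact f.hom.map_smul _ _)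
  refine eq_of_pow_smul_eq (n := k + n) le_rfl ?_
  rw [smul_zero, pow_add, mul_smul, ← specRes_apply, hm, ← _root_.map_smul, h2, map_zero]

instance : (tilde.functor R).PreservesMonomorphisms where
  preserves f _ := mono_of_app_injective _ fun V =>
    tilde_map_app_injective f ((ModuleCat.mono_iff_injective f).1 inferInstance) V

instance : PreservesFiniteLimits (tilde.functor R) :=
  Functor.preservesFiniteLimits_of_preservesMonomorphisms _

open TopCat.Sheaf

theorem tildeOpen_top_bijective (M : ModuleCat.{u} R) : Function.Bijective (tildeOpen M ⊤) :=
  ConcreteCategory.bijective_of_isIso (tilde.toOpen M ⊤)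

/-- The class of sheaves `M~` is closed under the dimension shift: embed `M` in an injective `E`, so
that `E~` is flasque, and note that global sections of `M~` are just `M`, so surjectivity is visible
on modules. -/
theorem acyclicOn_tilde [IsNoetherianRing R] (M : ModuleCat.{u} R) :
    AcyclicOn ⊤ (tilde M).abSheaf := by
  refine AcyclicOn.of_class (fun A => ∃ M : ModuleCat.{u} R, (tilde M).abSheaf = A) ?_ ⟨M, rfl⟩
  rintro _ ⟨M, rfl⟩
  let S := ShortComplex.mk (Injective.ι M) (cokernel.π (Injective.ι M)) (cokernel.condition _)
  have hS : S.ShortExact :=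
    { exact := ShortComplex.exact_cokernel _
      mono_f := inferInstanceAs (Mono (Injective.ι M))
      epi_g := coequalizer.π_epi }
  have : (tilde (Injective.under M)).abSheaf.IsFlasque := isFlasque_tilde _
  refine ⟨_, (hS.map_of_exact (tilde.functor R)).map_of_exact (toAbSheaf _), rfl,
    .of_isFlasque (tilde (Injective.under M)).abSheaf, ⟨_, rfl⟩, fun s => ?_⟩
  obtain ⟨m, rfl⟩ := (tildeOpen_top_bijective (cokernel (Injective.ι M))).2 s
  have := hS.epi_g
  obtain ⟨e, rfl⟩ := (ModuleCat.epi_iff_surjective S.g).1 inferInstance m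
  exact ⟨tildeOpen _ ⊤ e, specApp_tildeOpen S.g ⊤ e⟩

theorem acyclicOn_top_of_isQuasicoherent [IsNoetherianRing R] (M : (Spec R).Modules)
    (hM : M.IsQuasicoherent) : AcyclicOn ⊤ M.abSheaf := by
  have : IsIso M.fromTildeΓ := isIso_fromTildeΓ_of_isQuasicoherent M
  exact .of_iso ((toAbSheaf _).mapIso (asIso M.fromTildeΓ)) (acyclicOn_tilde _)

end AlgebraicGeometry.Scheme.Modules

/-! ### Local homomorphisms out of `M~` -/

namespace AlgebraicGeometry.Scheme.Modules

theorem bijective_res_of_eq {X : Scheme.{u}} (N : X.Modules) {V W : X.Opens} (h : W ≤ V) (h' : V ≤ W) :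
    Function.Bijective (N.res h) :=
  Function.bijective_iff_has_inverse.2 ⟨N.res h', fun s => by rw [res_res, res_self],
    fun s => by rw [res_res, res_self]⟩

theorem bijective_unit_app {X : Scheme.{u}} (N : X.Modules) {U V : X.Opens} (hV : V ≤ U) :
    Function.Bijective (((restrictAdjunction U.ι).unit.app N).app V) :=
  N.bijective_res_of_eq (U.ι.image_preimage_le V)
    (image_preimage_eq_of_le U.ι (hV.trans U.opensRange_ι.ge)).ge

theorem exists_localHom_comp {X : Scheme.{u}} {F N P : X.Modules} {U : X.Opens} (e : N ⟶ P)
    (he : ∀ V ≤ U, Function.Bijective (e.app V)) (f : F ⟶ P) :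
    ∃ φ : localHom F N U, ∀ (V : X.Opens) (h : V ≤ U) (s : Γ(F, V)),
      e.app V (φ.1 ⟨V, h⟩ s) = f.app V s := by
  let E (V : Set.Iic U) : Γ(N, V.1) ≃+ Γ(P, V.1) := AddEquiv.ofBijective (e.app V.1).hom (he V.1 V.2)
  have hE (V : Set.Iic U) (s : Γ(F, V.1)) : e.app V.1 ((E V).symm (f.app V.1 s)) = f.app V.1 s :=
    (E V).apply_symm_apply _
  refine ⟨⟨fun V => (E V).symm.toAddMonoidHom.comp (f.app V.1).hom, fun V r s => ?_,
    fun V W hVW s => ?_⟩, fun V h s => hE ⟨V, h⟩ s⟩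
  · apply (he V.1 V.2).1
    refine (hE V _).trans ((f.app_smul r s).trans ?_)
    refine Eq.trans ?_ (e.app_smul r _).symm
    exact congrArg (r • ·) (hE V s).symm
  · apply (he W.1 W.2).1
    refine (hE W _).trans ((app_res f hVW s).trans ?_)
    refine Eq.trans ?_ (app_res e hVW _).symm
    exact congrArg (P.res hVW) (hE V s).symm

theorem exists_localHom_unit {X : Scheme.{u}} {F N : X.Modules} {U : X.Opens}
    (f : F ⟶ (pushforward U.ι).obj (N.restrict U.ι)) :
    ∃ φ : localHom F N U, ∀ (V : X.Opens) (h : V ≤ U) (s : Γ(F, V)),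
      ((restrictAdjunction U.ι).unit.app N).app V (φ.1 ⟨V, h⟩ s) = f.app V s :=
  exists_localHom_comp ((restrictAdjunction U.ι).unit.app N)
    (fun _ h => bijective_unit_app N h) f

section

variable {R : CommRingCat.{u}} {M : ModuleCat.{u} R} {N : (Spec R).Modules} {U : (Spec R).Opens}

/-- A morphism from the sheaf associated with a module, given by its action on global sections. -/
theorem exists_specApp_tildeOpen_top (h : M →ₗ[R] Γ(N, ⊤)) :
    ∃ f : tilde M ⟶ N, ∀ m, specApp f ⊤ (tildeOpen M ⊤ m) = h m := by
  let h' : M ⟶ (modulesSpecToSheaf.obj N).presheaf.obj (op ⊤) :=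
    ModuleCat.ofHom (Y := Γ(N, ⊤)) h
  refine ⟨tilde.map h' ≫ N.fromTildeΓ, fun m => ?_⟩
  have h1 := specApp_tildeOpen h' ⊤ m
  have h2 : specApp N.fromTildeΓ ⊤ (tildeOpen _ ⊤ (h m)) = N.res le_top (h m) :=
    ConcreteCategory.congr_hom (toOpen_fromTildeΓ_app N ⊤) (h m)
  refine (congrArg (specApp N.fromTildeΓ ⊤) h1).trans (h2.trans ?_)
  exact N.res_self le_rfl (h m)

theorem localHom_smul_spec (φ : localHom (tilde M) N U) {V : (Spec R).Opens} (h : V ≤ U) (r : R)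
    (s : Γ(tilde M, V)) : φ.1 ⟨V, h⟩ (r • s) = r • φ.1 ⟨V, h⟩ s := localHom_smul φ h _ s

/-- The values of a local homomorphism on the elements of the module. -/
noncomputable def localHomTilde (φ : localHom (tilde M) N U) : M →ₗ[R] Γ(N, U) where
  toFun m := φ.1 ⟨U, le_refl U⟩ (tildeOpen M U m)
  map_add' _ _ := by rw [map_add, map_add]
  map_smul' r m := (congrArg (φ.1 ⟨U, le_refl U⟩) (_root_.map_smul (tildeOpen M U) r m)).trans
    (localHom_smul_spec φ (le_refl U) r _)

theorem res_localHomTilde (φ : localHom (tilde M) N U) {V : (Spec R).Opens} (h : V ≤ U) (m : M) :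
    N.res h (localHomTilde φ m) = φ.1 ⟨V, h⟩ (tildeOpen M V m) :=
  (localHom_res φ (le_refl U) h _).symm.trans (congrArg (φ.1 ⟨V, h⟩) (res_tildeOpen M h m))

/-- Locally on `D(g)` a section of `M~` is a fraction `m / gⁿ`, so values on `M` determine a local
homomorphism. -/
theorem localHomTilde_injective :
    Function.Injective (localHomTilde : localHom (tilde M) N U → _) := by
  intro φ ψ h
  refine Subtype.ext (funext fun ⟨V, hV⟩ => AddMonoidHom.ext fun s => ?_)
  have hV : V ≤ U := hV
  obtain ⟨ι, g, hg⟩ := exists_iSup_specD_eq V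
  have hg' : ∀ i, specD (g i) ≤ V := fun i => hg ▸ le_iSup (fun i => specD (g i)) i
  refine eq_of_res_eq N (fun i => specD (g i)) hg' hg.le fun i => ?_
  obtain ⟨n, m, hm⟩ := exists_pow_smul_eq_tildeOpen M (g i) (specRes (tilde M) (hg' i) s)
  refine eq_of_pow_smul_eq (n := n) le_rfl ?_
  have key : ∀ χ : localHom (tilde M) N U, g i ^ n • N.res (hg' i) (χ.1 ⟨V, hV⟩ s) =
      N.res ((hg' i).trans hV) (localHomTilde χ m) := fun χ => by
    rw [res_localHomTilde, ← hm, localHom_smul_spec]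
    exact congrArg (g i ^ n • ·) (localHom_res χ hV (hg' i) s).symm
  rw [key, key, h]

/-- `Γ(N, U)` is the module of global sections of the pushforward of `N|_U`, so a linear map into it
gives a morphism from `M~` to that pushforward. Over opens inside `U` the pushforward agrees with
`N`. -/
theorem localHomTilde_surjective :
    Function.Surjective (localHomTilde : localHom (tilde M) N U → _) := by
  intro h
  have hP : Function.Bijective (specRes ((pushforward U.ι).obj (N.restrict U.ι)) (le_top : U ≤ ⊤)) :=
    N.bijective_res_of_eq (U.ι.image_mono (U.ι.preimage_mono le_top)) (by
      rw [image_preimage_eq_of_le U.ι U.opensRange_ι.ge]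
      exact (image_le U.ι _).trans U.opensRange_ι.le)
  obtain ⟨f, hf⟩ := exists_specApp_tildeOpen_top
    ((LinearEquiv.ofBijective _ hP).symm.toLinearMap ∘ₗ
      specApp ((restrictAdjunction U.ι).unit.app N) U ∘ₗ h)
  obtain ⟨φ, hφ⟩ := exists_localHom_unit f
  refine ⟨φ, LinearMap.ext fun m => ?_⟩
  apply (bijective_unit_app N (le_refl U)).1
  refine (hφ U le_rfl _).trans ?_
  have h1 : specRes ((pushforward U.ι).obj (N.restrict U.ι)) le_top
      (specApp f ⊤ (tildeOpen M ⊤ m)) = specApp ((restrictAdjunction U.ι).unit.app N) U (h m) := by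
    rw [hf]; exact (LinearEquiv.ofBijective _ hP).apply_symm_apply _
  rw [← specApp_res, res_tildeOpen] at h1
  exact h1

end

end AlgebraicGeometry.Scheme.Modules

/-! ### The isomorphism `Hom(M, N)~ ≅ 𝓗om(M~, N~)` for finite `M` -/

namespace TopCat.Sheaf

variable {X : TopCat.{u}} {A B : TopCat.Sheaf Ab.{u} X} (f : A ⟶ B)

theorem epi_of_locally_surjective (h : ∀ (V : Opens X) (t : B.obj.obj (op V)),
    ∃ (ι : Type u) (W : ι → Opens X) (_ : V = ⨆ i, W i) (hW : ∀ i, W i ≤ V), ∀ i, ∃ s,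
      f.hom.app (op (W i)) s = B.obj.map (homOfLE (hW i)).op t) : Epi f := by
  rw [← TopCat.Sheaf.isLocallySurjective_iff_epi, TopCat.Presheaf.isLocallySurjective_iff]
  intro V t x hx
  obtain ⟨ι, W, hV, hW, h⟩ := h V t
  rw [hV, Opens.mem_iSup] at hx
  obtain ⟨i, hi⟩ := hx
  exact ⟨W i, hW i, h i, hi⟩

theorem isIso_of_locally_bijective (h : ∀ V : Opens X, ∃ (ι : Type u) (W : ι → Opens X),
    V = ⨆ i, W i ∧ ∀ i, Function.Bijective (f.hom.app (op (W i)))) : IsIso f := by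
  have h1 : Epi f := epi_of_locally_surjective f fun V t => by
    obtain ⟨ι, W, hV, hW⟩ := h V
    exact ⟨ι, W, hV, fun i => hV ▸ le_iSup W i, fun i => (hW i).2 _⟩
  have h2 : Mono f := mono_of_injective f fun V => by
    obtain ⟨ι, W, hV, hW⟩ := h V
    have hW' : ∀ i, W i ≤ V := fun i => hV ▸ le_iSup W i
    refine (injective_iff_map_eq_zero (f.hom.app (op V)).hom).2 fun s hs => ?_
    refine A.eq_of_locally_eq' W V (fun i => homOfLE (hW' i)) hV.le s 0 fun i => (hW i).1 ?_
    have h3 := ConcreteCategory.congr_hom (f.hom.naturality (homOfLE (hW' i)).op) s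
    refine h3.trans ?_
    refine (congrArg (B.obj.map (homOfLE (hW' i)).op) hs).trans ?_
    rw [map_zero, map_zero, map_zero]
  exact isIso_of_mono_of_epi f

end TopCat.Sheaf

namespace AlgebraicGeometry.Scheme.Modules

open TopCat.Sheaf

variable {R : CommRingCat.{u}} {M : ModuleCat.{u} R} {N : (Spec R).Modules} {U : (Spec R).Opens}

/-- Local homomorphisms from the sheaf associated with a module. -/
noncomputable def localHomTildeEquiv : localHom (tilde M) N U ≃+ (M →ₗ[R] Γ(N, U)) :=
  AddEquiv.ofBijective (AddMonoidHom.mk' localHomTilde fun _ _ => rfl)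
    ⟨localHomTilde_injective, localHomTilde_surjective⟩

theorem eq_of_pow_smul_eq_on_specD {s t : Γ(N, U)} (h : ∀ g : R, ∀ hg : specD g ≤ U,
    ∃ n : ℕ, g ^ n • N.res hg s = g ^ n • N.res hg t) : s = t := by
  obtain ⟨ι, g, hg⟩ := exists_iSup_specD_eq U
  have hg' : ∀ i, specD (g i) ≤ U := fun i => hg ▸ le_iSup (fun i => specD (g i)) i
  refine eq_of_res_eq N (fun i => specD (g i)) hg' hg.le fun i => ?_
  obtain ⟨n, hn⟩ := h (g i) (hg' i)
  exact eq_of_pow_smul_eq le_rfl hn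

variable {N₀ : ModuleCat.{u} R}

/-- Evaluation at `m` of homomorphisms. -/
noncomputable abbrev homEval (N₀ : ModuleCat.{u} R) (m : M) :
    ModuleCat.of R (M →ₗ[R] N₀) ⟶ N₀ :=
  ModuleCat.ofHom (LinearMap.applyₗ m)

theorem smul_res_specApp_homEval {s : Γ(tilde (ModuleCat.of R (M →ₗ[R] N₀)), U)} {g : R}
    {hg : specD g ≤ U} {n : ℕ} {h : M →ₗ[R] N₀}
    (hn : g ^ n • specRes _ hg s = tildeOpen (ModuleCat.of R (M →ₗ[R] N₀)) (specD g) h) (m : M) :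
    g ^ n • specRes _ hg (specApp (tilde.map (homEval N₀ m)) U s) =
      tildeOpen N₀ (specD g) (h m) := by
  rw [← specApp_res, ← _root_.map_smul, hn, specApp_tildeOpen]
  rfl

/-- Evaluation of a section of the sheaf associated with `Hom(M, N₀)`. -/
noncomputable def tildeHomEval (s : Γ(tilde (ModuleCat.of R (M →ₗ[R] N₀)), U)) :
    M →ₗ[R] Γ(tilde N₀, U) where
  toFun m := specApp (tilde.map (homEval N₀ m)) U s
  map_add' m m' := by
    refine eq_of_pow_smul_eq_on_specD fun g hg => ?_
    obtain ⟨n, h, hn⟩ := exists_pow_smul_eq_tildeOpen _ g (specRes _ hg s)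
    refine ⟨n, (smul_res_specApp_homEval hn (m + m')).trans ?_⟩
    rw [map_add, map_add, map_add, smul_add]
    exact (congrArg₂ (· + ·) (smul_res_specApp_homEval hn m) (smul_res_specApp_homEval hn m')).symm
  map_smul' r m := by
    refine eq_of_pow_smul_eq_on_specD fun g hg => ?_
    obtain ⟨n, h, hn⟩ := exists_pow_smul_eq_tildeOpen _ g (specRes _ hg s)
    refine ⟨n, (smul_res_specApp_homEval hn (r • m)).trans ?_⟩
    rw [_root_.map_smul, _root_.map_smul, ← smul_res_specApp_homEval hn m, smul_comm,
      ← _root_.map_smul]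
    rfl

theorem tildeHomEval_tildeOpen (h : M →ₗ[R] N₀) :
    tildeHomEval (tildeOpen (ModuleCat.of R (M →ₗ[R] N₀)) U h) = tildeOpen N₀ U ∘ₗ h :=
  LinearMap.ext fun m => specApp_tildeOpen (homEval N₀ m) U h

theorem tildeHomEval_add (s t : Γ(tilde (ModuleCat.of R (M →ₗ[R] N₀)), U)) :
    tildeHomEval (s + t) = tildeHomEval s + tildeHomEval t :=
  LinearMap.ext fun m => map_add (specApp (tilde.map (homEval N₀ m)) U) s t

theorem tildeHomEval_smul (r : R) (s : Γ(tilde (ModuleCat.of R (M →ₗ[R] N₀)), U)) :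
    tildeHomEval (r • s) = r • tildeHomEval s :=
  LinearMap.ext fun m => _root_.map_smul (specApp (tilde.map (homEval N₀ m)) U) r s

/-- This is the fact that `Hom(M, -)` commutes with localization when `M` is finitely presented:
uniqueness of lifts up to powers of `f` uses finite generation, existence uses finite presentation.
-/
theorem tildeHomEval_bijective [IsNoetherianRing R] [Module.Finite R M] (f : R) :
    Function.Bijective (tildeHomEval (M := M) (N₀ := N₀) (U := specD f)) := by
  have hfp : Module.FinitePresentation R M := Module.finitePresentation_of_finite R M
  constructor
  · refine (injective_iff_map_eq_zero (AddMonoidHom.mk' (tildeHomEval (M := M) (N₀ := N₀)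
      (U := specD f)) tildeHomEval_add)).2
      fun s (hs : tildeHomEval s = 0) => ?_
    obtain ⟨n, h, hn⟩ := exists_pow_smul_eq_tildeOpen _ f s
    have h1 : tildeOpen N₀ (specD f) ∘ₗ (h : M →ₗ[R] N₀) = tildeOpen N₀ (specD f) ∘ₗ 0 := by
      rw [← tildeHomEval_tildeOpen, LinearMap.comp_zero]
      refine (congrArg tildeHomEval hn.symm).trans ?_
      rw [tildeHomEval_smul, hs, smul_zero]
    obtain ⟨⟨_, k, rfl⟩, hk⟩ := Module.Finite.exists_smul_of_comp_eq_of_isLocalizedModule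
      (Submonoid.powers f) (tildeOpen N₀ (specD f)) _ _ h1
    have hk : f ^ k • h = 0 := hk.trans (smul_zero _)
    refine eq_of_pow_smul_eq (n := k + n) le_rfl ?_
    rw [smul_zero, pow_add, mul_smul, hn, ← _root_.map_smul, hk, map_zero]
  · intro g
    obtain ⟨h, ⟨_, n, rfl⟩, hh⟩ := Module.FinitePresentation.exists_lift_of_isLocalizedModule
      (Submonoid.powers f) (tildeOpen N₀ (specD f)) g
    have h1 : IsUnit (algebraMap R (Module.End R
        Γ(tilde (ModuleCat.of R (M →ₗ[R] N₀)), specD f)) (f ^ n)) := by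
      rw [map_pow]
      exact (isUnit_algebraMap_end_of_le_basicOpen _ le_rfl).pow n
    rw [Module.End.isUnit_iff] at h1
    obtain ⟨t, ht⟩ := h1.2 (tildeOpen _ _ h)
    refine ⟨t, LinearMap.ext fun m => eq_of_pow_smul_eq (n := n) (f := f) le_rfl ?_⟩
    have h2 : f ^ n • tildeHomEval t = f ^ n • g := by
      rw [← tildeHomEval_smul]
      refine (congrArg tildeHomEval ht).trans ?_
      rw [tildeHomEval_tildeOpen]
      exact hh
    exact LinearMap.congr_fun h2 m

theorem res_tildeHomEval {V : (Spec R).Opens} (h : V ≤ U)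
    (s : Γ(tilde (ModuleCat.of R (M →ₗ[R] N₀)), U)) (m : M) :
    tildeHomEval ((tilde (ModuleCat.of R (M →ₗ[R] N₀))).res h s) m =
      (tilde N₀).res h (tildeHomEval s m) :=
  specApp_res (tilde.map (homEval N₀ m)) h s

variable (M N₀) in
/-- The canonical morphism from the sheaf associated with `Hom(M, N₀)` to `𝓗om(M~, N₀~)`. -/
noncomputable def tildeHomToHomSheaf :
    (tilde (ModuleCat.of R (M →ₗ[R] N₀))).abSheaf ⟶ (homSheaf (tilde M)).obj (tilde N₀) :=
  ⟨{ app U := AddCommGrpCat.ofHom (X := Γ(tilde (ModuleCat.of R (M →ₗ[R] N₀)), U.unop))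
        (Y := localHom (tilde M) (tilde N₀) U.unop)
        (localHomTildeEquiv.symm.toAddMonoidHom.comp (AddMonoidHom.mk' tildeHomEval tildeHomEval_add))
     naturality U V i := by
        ext s
        apply localHomTildeEquiv.injective
        refine (localHomTildeEquiv.apply_symm_apply _).trans (LinearMap.ext fun m => ?_)
        refine (res_tildeHomEval i.unop.le s m).trans ?_
        let φ := localHomTildeEquiv.symm (tildeHomEval s)
        have h1 : localHomTilde φ m = tildeHomEval s m :=
          LinearMap.congr_fun (localHomTildeEquiv.apply_symm_apply (tildeHomEval s)) m
        rw [← h1]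
        exact res_localHomTilde φ i.unop.le m }⟩

instance isIso_tildeHomToHomSheaf [IsNoetherianRing R] [Module.Finite R M] :
    IsIso (tildeHomToHomSheaf M N₀) :=
  isIso_of_locally_bijective _ fun V => by
    obtain ⟨ι, g, hg⟩ := exists_iSup_specD_eq V
    exact ⟨ι, fun i => specD (g i), hg, fun i =>
      localHomTildeEquiv.symm.bijective.comp (tildeHomEval_bijective (g i))⟩

theorem acyclicOn_homSheaf_tilde [IsNoetherianRing R] [Module.Finite R M] (N : (Spec R).Modules)
    (hN : N.IsQuasicoherent) : AcyclicOn ⊤ ((homSheaf (tilde M)).obj N) := by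
  have : IsIso N.fromTildeΓ := isIso_fromTildeΓ_of_isQuasicoherent N
  refine .of_iso (asIso (tildeHomToHomSheaf M _) ≪≫
    (homSheaf (tilde M)).mapIso (asIso N.fromTildeΓ)) (acyclicOn_tilde _)

end AlgebraicGeometry.Scheme.Modules

/-! ### Left exactness of `𝓗om(F, -)`, exactness for free `F` -/

namespace AlgebraicGeometry.Scheme.Modules

section

variable {X Y : Scheme.{u}} {F G G' : X.Modules} {U : X.Opens}

/-- Postcomposition with a morphism on local homomorphisms. -/
noncomputable def localHomPostcomp (g : G ⟶ G') (U : X.Opens) :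
    localHom F G U →+ localHom F G' U := (((homSheaf F).map g).hom.app (op U)).hom

theorem localHomToHom_postcomp (g : G ⟶ G') (j : Y ⟶ X) [IsOpenImmersion j]
    (hU : j.opensRange ≤ U) (φ : localHom F G U) :
    localHomToHom j hU (localHomPostcomp g U φ) =
      localHomToHom j hU φ ≫ (restrictFunctor j).map g := rfl

instance preservesFiniteLimits_homSheaf (F : X.Modules) : PreservesFiniteLimits (homSheaf F) := by
  refine ((homSheaf F).preservesFiniteLimits_tfae.out 0 3).mp fun S hS => ?_
  have := hS.mono_f
  refine ⟨TopCat.Sheaf.exact_of_sections _ fun (V : X.Opens)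
      (φ : localHom F S.X₂ V) (h : localHomPostcomp S.g V φ = 0) => ?_,
    TopCat.Sheaf.mono_of_injective _ fun (V : X.Opens) φ ψ
      (h : localHomPostcomp S.f V φ = localHomPostcomp S.f V ψ) => ?_⟩
  · have hT : (S.map (restrictFunctor V.ι)).Exact := by
      have h0 := ((restrictFunctor V.ι).preservesFiniteLimits_tfae.out 3 0).mp
        (inferInstance : PreservesFiniteLimits (restrictFunctor V.ι))
      exact (h0 S hS).1
    have : Mono (S.map (restrictFunctor V.ι)).f := inferInstanceAs (Mono ((restrictFunctor V.ι).map S.f))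
    have h' : localHomToHom V.ι V.opensRange_ι.le φ ≫ (S.map (restrictFunctor V.ι)).g = 0 :=
      (localHomToHom_postcomp S.g V.ι V.opensRange_ι.le φ).symm.trans
        (congrArg (localHomToHom V.ι V.opensRange_ι.le) h)
    refine ⟨homToLocalHom V.ι (hT.lift _ h') V.opensRange_ι.ge, ?_⟩
    refine localHomToHom_injective V.ι V.opensRange_ι.le V.opensRange_ι.ge ?_
    refine (localHomToHom_postcomp S.f V.ι V.opensRange_ι.le _).trans ?_
    refine (congrArg (· ≫ (restrictFunctor V.ι).map S.f)
      (localHomToHom_homToLocalHom V.ι _ V.opensRange_ι.le V.opensRange_ι.ge)).trans ?_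
    exact hT.lift_f _ h'
  · refine localHomToHom_injective V.ι V.opensRange_ι.le V.opensRange_ι.ge ?_
    rw [← cancel_mono ((restrictFunctor V.ι).map S.f)]
    exact congrArg (localHomToHom V.ι V.opensRange_ι.le) h

theorem exists_app_eq_res_of_epi (g : G ⟶ G') [Epi g] {ι : Type*} [Finite ι]
    (t : ι → Γ(G', U)) {x : X} (hx : x ∈ U) : ∃ (W : X.Opens) (hW : W ≤ U) (s : ι → Γ(G, W)),
      x ∈ W ∧ ∀ i, g.app W (s i) = G'.res hW (t i) := by
  have h : Epi ((toAbSheaf X).map g) := inferInstance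
  rw [← TopCat.Sheaf.isLocallySurjective_iff_epi, TopCat.Presheaf.isLocallySurjective_iff] at h
  have h' : ∀ i, ∃ (W : X.Opens) (hW : W ≤ U) (s : Γ(G, W)),
      g.app W s = G'.res hW (t i) ∧ x ∈ W := fun i => by
    obtain ⟨W, hW, ⟨s, hs⟩, hx⟩ := h U (t i) x hx
    exact ⟨W, hW, s, hs, hx⟩
  choose W hW s hs hx' using h'
  have : Nonempty (Fintype ι) := ⟨Fintype.ofFinite ι⟩
  obtain ⟨_⟩ := this
  refine ⟨U ⊓ Finset.univ.inf W, inf_le_left, fun i =>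
    G.res (inf_le_right.trans (Finset.inf_le (Finset.mem_univ i))) (s i), ⟨hx, ?_⟩, fun i => ?_⟩
  · suffices ∀ T : Finset ι, x ∈ T.inf W from this _
    intro T
    induction T using Finset.cons_induction with
    | empty => exact trivial
    | cons i T hi h => rw [Finset.inf_cons]; exact ⟨hx' i, h⟩
  · refine (app_res g _ (s i)).trans ?_
    exact (congrArg (G'.res _) (hs i)).trans (G'.res_res (hW i) _ (t i))

end

variable {R : CommRingCat.{u}}

/-- The free sheaf of modules of rank `n`. -/
noncomputable abbrev tildeFree (R : CommRingCat.{u}) (n : ℕ) : (Spec R).Modules :=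
  tilde (ModuleCat.of R (Fin n → R))

/-- A local homomorphism out of a free sheaf is an `n`-tuple of sections; finitely many sections
lift together on a common neighbourhood. -/
instance (n : ℕ) : (homSheaf (tildeFree R n)).PreservesEpimorphisms where
  preserves {G G'} g _ := by
    rw [← TopCat.Sheaf.isLocallySurjective_iff_epi, TopCat.Presheaf.isLocallySurjective_iff]
    intro U (t : localHom (tildeFree R n) G' U) x hx
    let b := Pi.basisFun R (Fin n)
    obtain ⟨W, hW, s, hxW, hs⟩ := exists_app_eq_res_of_epi g
      (fun i => localHomTilde t (b i)) hx
    refine ⟨W, hW, ⟨localHomTildeEquiv.symm (b.constr R s), ?_⟩, hxW⟩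
    apply localHomTildeEquiv.injective
    refine b.ext fun i => ?_
    have h1 : localHomTildeEquiv (M := ModuleCat.of R (Fin n → R))
        (localHomTildeEquiv.symm (b.constr R s)) (b i) = s i := by
      rw [AddEquiv.apply_symm_apply]
      exact b.constr_basis R s i
    refine (congrArg (g.app W) h1).trans ((hs i).trans ?_)
    exact res_localHomTilde t hW (b i)

instance (n : ℕ) : PreservesFiniteColimits (homSheaf (tildeFree R n)) :=
  Functor.preservesFiniteColimits_of_preservesEpimorphisms _

end AlgebraicGeometry.Scheme.Modules

/-! ### Acyclicity of Ext sheaves on a Noetherian affine scheme -/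

namespace TopCat.Sheaf

variable {X : TopCat.{u}} {V : Opens X}

theorem AcyclicOn.of_exact {A B C D : TopCat.Sheaf Ab.{u} X} {f : A ⟶ B} {g : B ⟶ C} {h : C ⟶ D}
    (wfg : f ≫ g = 0) (wgh : g ≫ h = 0) (hf : Mono f) (hfg : (ShortComplex.mk f g wfg).Exact)
    (hgh : (ShortComplex.mk g h wgh).Exact) (hh : Epi h)
    (hA : AcyclicOn V A) (hB : AcyclicOn V B) (hC : AcyclicOn V C) : AcyclicOn V D := by
  let S := ShortComplex.mk f (cokernel.π f) (cokernel.condition f)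
  have hS : S.ShortExact :=
    { exact := ShortComplex.exact_cokernel _
      mono_f := hf
      epi_g := coequalizer.π_epi }
  let T := ShortComplex.mk (cokernel.desc f g wfg) h
    ((cancel_epi (cokernel.π f)).1 (by rw [cokernel.π_desc_assoc, wgh, comp_zero]))
  have hT : T.ShortExact :=
    { exact := (ShortComplex.exact_iff_of_epi_of_isIso_of_mono
        { τ₁ := cokernel.π f, τ₂ := 𝟙 _, τ₃ := 𝟙 _ } (S₁ := ShortComplex.mk g h wgh)
          (S₂ := T)).1 hgh
      mono_f := (ShortComplex.mk f g wfg).exact_iff_mono_cokernel_desc.1 hfg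
      epi_g := hh }
  exact .X₃ hT (.X₃ hS hA hB) hC

end TopCat.Sheaf

namespace AlgebraicGeometry.Scheme.Modules

open TopCat.Sheaf

section

variable {X : Scheme.{u}}

/-- The complex `𝓗om(F, J)`. -/
noncomputable abbrev homComplex (F : X.Modules) (J : CochainComplex X.Modules ℕ) :
    CochainComplex (TopCat.Sheaf Ab.{u} X) ℕ :=
  ((homSheaf F).mapHomologicalComplex (ComplexShape.up ℕ)).obj J

/-- The morphism of complexes induced by a morphism in the first variable. -/
noncomputable def homComplexMap {F F' : X.Modules} (f : F' ⟶ F) (J : CochainComplex X.Modules ℕ) :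
    homComplex F J ⟶ homComplex F' J :=
  (NatTrans.mapHomologicalComplex (homSheafPrecomp f) (ComplexShape.up ℕ)).app J

/-- The short complex `𝓗om(X₃, J) ⟶ 𝓗om(X₂, J) ⟶ 𝓗om(X₁, J)`. -/
noncomputable def homComplexShort (S : ShortComplex X.Modules) (J : CochainComplex X.Modules ℕ) :
    ShortComplex (CochainComplex (TopCat.Sheaf Ab.{u} X) ℕ) :=
  ShortComplex.mk (homComplexMap S.g J) (homComplexMap S.f J)
    (HomologicalComplex.hom_ext _ _ fun i => (homShortComplex S (J.X i)).zero)

theorem homComplexShort_shortExact {S : ShortComplex X.Modules} (hS : S.ShortExact)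
    (J : CochainComplex X.Modules ℕ) (hJ : ∀ n, Injective (J.X n)) :
    (homComplexShort S J).ShortExact :=
  HomologicalComplex.shortExact_of_degreewise_shortExact _ fun i =>
    have := hJ i
    homShortComplex_shortExact hS (J.X i)

theorem mono_homologyMap_zero {C : Type*} [Category* C] [Abelian C] {K L : CochainComplex C ℕ}
    (f : K ⟶ L) [Mono f] : Mono (HomologicalComplex.homologyMap f 0) := by
  have : Mono (f.f 0) := inferInstance
  have h1 : Mono (HomologicalComplex.cyclesMap f 0) := by
    have : Mono (HomologicalComplex.cyclesMap f 0 ≫ L.iCycles 0) := by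
      rw [HomologicalComplex.cyclesMap_i]; infer_instance
    exact mono_of_mono _ (L.iCycles 0)
  have h2 : HomologicalComplex.homologyMap f 0 =
      K.isoHomologyπ₀.inv ≫ HomologicalComplex.cyclesMap f 0 ≫ L.isoHomologyπ₀.hom := by
    rw [← CochainComplex.isoHomologyπ₀_inv_naturality_assoc, Iso.inv_hom_id, Category.comp_id]
  rw [h2]
  infer_instance

/-- The long exact sequence reads `0 ⟶ H⁰(X₃) ⟶ H⁰(X₂) ⟶ H⁰(X₁) ⟶ H¹(X₃) ⟶ 0`, so the last term is
resolved by acyclic sheaves. -/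
theorem acyclicOn_homology_one {S : ShortComplex X.Modules} (hS : S.ShortExact)
    (J : CochainComplex X.Modules ℕ) (hJ : ∀ n, Injective (J.X n)) {V : X.Opens}
    (hz : IsZero ((homComplex S.X₂ J).homology 1))
    (h₁ : AcyclicOn V ((homComplex S.X₁ J).homology 0))
    (h₂ : AcyclicOn V ((homComplex S.X₂ J).homology 0))
    (h₃ : AcyclicOn V ((homComplex S.X₃ J).homology 0)) :
    AcyclicOn V ((homComplex S.X₃ J).homology 1) := by
  have hT := homComplexShort_shortExact hS J hJ
  have hrel : (ComplexShape.up ℕ).Rel 0 1 := by simp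
  have := hT.mono_f
  exact .of_exact _ _ (mono_homologyMap_zero (homComplexShort S J).f) (hT.homology_exact₂ 0)
    (hT.homology_exact₃ 0 1 hrel) ((hT.homology_exact₁ 0 1 hrel).epi_f (hz.eq_of_tgt _ _)) h₃ h₂ h₁

/-- Dimension shifting. -/
noncomputable def homologySuccIso {S : ShortComplex X.Modules} (hS : S.ShortExact)
    (J : CochainComplex X.Modules ℕ) (hJ : ∀ n, Injective (J.X n)) (p : ℕ)
    (hz : IsZero ((homComplex S.X₂ J).homology p))
    (hz' : IsZero ((homComplex S.X₂ J).homology (p + 1))) :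
    (homComplex S.X₁ J).homology p ≅ (homComplex S.X₃ J).homology (p + 1) :=
  (homComplexShort_shortExact hS J hJ).δIso p (p + 1) (by simp) hz hz'

/-- `𝓗om(F, J)` is a resolution of `𝓗om(F, G)` in degree `0`. -/
noncomputable def homComplexHomologyZero (F : X.Modules) {G : X.Modules}
    (J : CochainComplex X.Modules ℕ) (a : G ⟶ J.X 0) (w : a ≫ J.d 0 1 = 0) [Mono a]
    (ha : (ShortComplex.mk a (J.d 0 1) w).Exact) :
    (homSheaf F).obj G ≅ (homComplex F J).homology 0 :=
  IsLimit.conePointUniqueUpToIso (KernelFork.mapIsLimit _ ha.fIsKernel (homSheaf F))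
    ((homComplex F J).cyclesIsKernel 0 1 (by simp)) ≪≫ (homComplex F J).isoHomologyπ₀

end

variable {R : CommRingCat.{u}}

theorem isZero_homology_homComplex_tildeFree (n : ℕ) (J : CochainComplex (Spec R).Modules ℕ)
    {p : ℕ} (hJ : J.ExactAt p) : IsZero ((homComplex (tildeFree R n) J).homology p) := by
  rw [← HomologicalComplex.exactAt_iff_isZero_homology]
  exact ShortComplex.Exact.map hJ (homSheaf (tildeFree R n))

/-- Induction on `p`, for all finite `M` at once. In degree `0` the homology is `𝓗om(M~, G)`.
Otherwise `M` is presented by a free module with kernel `K`, again finite since `R` is Noetherian,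
and the degree drops by one on replacing `M` by `K`. -/
theorem acyclicOn_homology_homComplex [IsNoetherianRing R] {G : (Spec R).Modules}
    (hG : G.IsQuasicoherent) (J : CochainComplex (Spec R).Modules ℕ) (hJ : ∀ n, Injective (J.X n))
    (hJ' : ∀ n, J.ExactAt (n + 1)) (a : G ⟶ J.X 0) (w : a ≫ J.d 0 1 = 0) [Mono a]
    (ha : (ShortComplex.mk a (J.d 0 1) w).Exact) (p : ℕ) (M : ModuleCat.{u} R)
    [Module.Finite R M] : AcyclicOn ⊤ ((homComplex (tilde M) J).homology p) := by
  have h0 : ∀ (M : ModuleCat.{u} R) [Module.Finite R M],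
      AcyclicOn ⊤ ((homComplex (tilde M) J).homology 0) := fun M _ =>
    .of_iso (homComplexHomologyZero (tilde M) J a w ha) (acyclicOn_homSheaf_tilde G hG)
  induction p generalizing M with
  | zero => exact h0 M
  | succ p ih =>
    obtain ⟨n, f, hf⟩ := Module.Finite.exists_fin' R M
    have : Module.Finite R (ModuleCat.of R (LinearMap.ker f)) :=
      inferInstanceAs (Module.Finite R (LinearMap.ker f))
    have hS := (LinearMap.shortExact_shortComplexKer hf).map_of_exact (tilde.functor R)
    have hz (p : ℕ) : IsZero ((homComplex (tildeFree R n) J).homology (p + 1)) :=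
      isZero_homology_homComplex_tildeFree n J (hJ' p)
    -- The free sheaf has no Ext in positive degrees but does contribute in degree `0`, so the
    -- connecting map into degree `1` is only an epimorphism and that case is separate.
    cases p with
    | zero =>
      exact acyclicOn_homology_one hS J hJ (hz 0) (h0 (ModuleCat.of R (LinearMap.ker f)))
        (h0 (ModuleCat.of R (Fin n → R))) (h0 M)
    | succ p =>
      exact .of_iso (homologySuccIso hS J hJ (p + 1) (hz p) (hz (p + 1)))
        (ih (ModuleCat.of R (LinearMap.ker f)))

end AlgebraicGeometry.Scheme.Modules

/-! ### Extensions under exact functors; changing a cocycle by a coboundary -/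

namespace CategoryTheory.YonedaExtension

section

variable {C D : Type*} [Category* C] [Abelian C] [Category* D] [Abelian D] {n : ℕ} {F G : C}

/-- The image of an extension under an exact functor. -/
noncomputable def mapExact (S : YonedaExtension n F G) (Φ : C ⥤ D) [Φ.Additive]
    [PreservesFiniteLimits Φ] [PreservesFiniteColimits Φ] {F' G' : D} (eF : Φ.obj F ≅ F')
    (eG : Φ.obj G ≅ G') : YonedaExtension n F' G' where
  seq := S.seq ⋙ Φ
  exact := ⟨⟨fun i hi => (Φ.map_comp _ _).symm.trans
    ((congrArg Φ.map (S.exact.toIsComplex.zero i hi)).trans (Φ.map_zero _ _))⟩,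
    fun i hi => (S.exact.exact i hi).map Φ⟩
  mono_left := have := S.mono_left; Φ.map_mono _
  epi_right := have := S.epi_right; Φ.map_epi _
  isoLeft := Φ.mapIso S.isoLeft ≪≫ eG
  isoRight := Φ.mapIso S.isoRight ≪≫ eF

section

variable {S : YonedaExtension n F G} {J : ℕ → C} {d : ∀ k, J k ⟶ J (k + 1)} (φ : S.MapTo d)
  (Φ : C ⥤ D) [Φ.Additive] [PreservesFiniteLimits Φ] [PreservesFiniteColimits Φ] {F' G' : D}
  (eF : Φ.obj F ≅ F') (eG : Φ.obj G ≅ G') {J' : ℕ → D} {d' : ∀ k, J' k ⟶ J' (k + 1)}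
  (e : ∀ k, Φ.obj (J k) ≅ J' k) (he : ∀ k, Φ.map (d k) ≫ (e (k + 1)).hom = (e k).hom ≫ d' k)

/-- The image of a morphism from an extension to a sequence under an exact functor. -/
noncomputable def MapTo.mapExact : (S.mapExact Φ eF eG).MapTo d' where
  φ k := Φ.map (φ.φ k) ≫ (e k).hom
  comm k := by
    have h1 : Φ.map (S.tailArrow k) ≫ Φ.map (φ.φ k.succ) = Φ.map (φ.φ k.castSucc) ≫ Φ.map (d k) := by
      rw [← Φ.map_comp, φ.comm, Φ.map_comp]
    refine (Category.assoc _ _ _).symm.trans ((h1 =≫ (e (k + 1)).hom).trans ?_)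
    refine (Category.assoc _ _ _).trans ((Φ.map (φ.φ k.castSucc) ≫= he k).trans ?_)
    exact (Category.assoc _ _ _).symm

theorem MapTo.mapExact_last : (φ.mapExact Φ eF eG e he).last = eF.inv ≫ Φ.map φ.last ≫ (e n).hom := by
  refine (Category.assoc _ _ _).trans (eF.inv ≫= ?_)
  refine (Category.assoc _ _ _).symm.trans ?_
  exact (Φ.map_comp S.isoRight.inv (φ.φ (Fin.last n))).symm =≫ (e n).hom

theorem MapTo.mapExact_inl_first : (S.mapExact Φ eF eG).inl ≫ (φ.mapExact Φ eF eG e he).first =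
    eG.inv ≫ Φ.map (S.inl ≫ φ.first) ≫ (e 0).hom := by
  have h1 : (S.mapExact Φ eF eG).inl = eG.inv ≫ Φ.map S.inl :=
    (Category.assoc _ _ _).trans (eG.inv ≫= (Φ.map_comp S.isoLeft.inv (S.arrow 0)).symm)
  refine (h1 =≫ _).trans ((Category.assoc _ _ _).trans (eG.inv ≫= ?_))
  refine (Category.assoc _ _ _).symm.trans ?_
  exact (Φ.map_comp S.inl φ.first).symm =≫ (e 0).hom

end

theorem map_last_eq_zero (S : YonedaExtension (n + 1) F G) (a : Fin (n + 3)) (h : a.1 ≤ n) :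
    S.seq.map (homOfLE (Fin.le_last a)) = 0 := by
  have h1 : S.seq.map' a.1 (a.1 + 1) (by omega) (by omega) ≫
      S.seq.map' (a.1 + 1) (a.1 + 2) (by omega) (by omega) = 0 := S.exact.toIsComplex.zero a.1
  have h2 : S.seq.map (homOfLE (Fin.le_last a)) = (S.seq.map' a.1 (a.1 + 1) (by omega) (by omega) ≫
      S.seq.map' (a.1 + 1) (a.1 + 2) (by omega) (by omega)) ≫
        S.seq.map' (a.1 + 2) (n + 2) (by omega) (by omega) := by
    rw [← Functor.map_comp, ← Functor.map_comp]
    rfl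
  rw [h2, h1, zero_comp]

/-- Adding a null-homotopic map. -/
theorem MapTo.exists_homotopic {S : YonedaExtension (n + 1) F G} {J : ℕ → C}
    {d : ∀ k, J k ⟶ J (k + 1)} (φ : S.MapTo d) (t : F ⟶ J n) :
    ∃ φ' : S.MapTo d, φ'.last = φ.last + t ≫ d n ∧ S.inl ≫ φ'.first = S.inl ≫ φ.first := by
  -- The correction factors through `F`: `t` is used at position `n`, `t ≫ d n` at the right end `n
  -- + 1`. The other values of `τ` are irrelevant, since `r k` is zero for `k < n`.
  obtain ⟨τ, hτ, hτ'⟩ : ∃ τ : ∀ k, F ⟶ J k, τ n = t ∧ τ (n + 1) = t ≫ d n :=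
    ⟨Function.update (Function.update 0 n t) (n + 1) (t ≫ d n), by simp, by simp⟩
  let r (k : Fin (n + 2)) : S.seq.obj k.succ ⟶ F :=
    S.seq.map (homOfLE (Fin.le_last k.succ)) ≫ S.isoRight.hom
  have hr (k : Fin (n + 1)) : S.tailArrow k ≫ r k.succ = r k.castSucc := by
    refine (Category.assoc _ _ _).symm.trans ((S.seq.map_comp _ _).symm =≫ _)
  have hr0 (k : Fin (n + 2)) (h : k.1 < n) : r k = 0 := by
    refine (S.map_last_eq_zero k.succ ?_ =≫ _).trans zero_comp
    simpa using h
  refine ⟨⟨fun k => φ.φ k + r k ≫ τ k, fun k => ?_⟩, ?_, ?_⟩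
  · have h1 : S.tailArrow k ≫ r k.succ ≫ τ (k + 1) = (r k.castSucc ≫ τ k) ≫ d k := by
      refine (Category.assoc _ _ _).symm.trans ((hr k =≫ _).trans ?_)
      rcases lt_or_eq_of_le (Nat.lt_succ_iff.1 k.2) with h | h
      · rw [hr0 k.castSucc h, zero_comp, zero_comp, zero_comp]
      · obtain rfl : k = Fin.last n := Fin.ext h
        exact (r (Fin.last n).castSucc ≫= (hτ'.trans (hτ.symm =≫ d n))).trans
          (Category.assoc _ _ _).symm
    refine (Preadditive.comp_add _ _ _ _ _ _).trans (Eq.trans ?_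
      (Preadditive.add_comp _ _ _ _ _ _).symm)
    exact congrArg₂ (· + ·) (φ.comm k) h1
  · have h1 : S.isoRight.inv ≫ r (Fin.last (n + 1)) = 𝟙 F := by
      have h2 : r (Fin.last (n + 1)) = S.isoRight.hom :=
        (S.seq.map_id (Fin.last (n + 2)) =≫ _).trans (Category.id_comp _)
      rw [h2]
      exact S.isoRight.inv_hom_id
    refine (Preadditive.comp_add _ _ _ _ _ _).trans (congrArg (φ.last + ·) ?_)
    refine (Category.assoc _ _ _).symm.trans ((h1 =≫ _).trans ((Category.id_comp _).trans hτ'))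
  · refine (Preadditive.comp_add _ _ _ _ _ _).trans ?_
    have h1 : S.inl ≫ r 0 = 0 := by
      have h2 : S.arrow 0 ≫ r 0 = S.seq.map (homOfLE (Fin.le_last 0)) ≫ S.isoRight.hom :=
        (Category.assoc _ _ _).symm.trans ((S.seq.map_comp _ _).symm =≫ _)
      rw [S.map_last_eq_zero 0 (Nat.zero_le n), zero_comp] at h2
      exact (Category.assoc _ _ _).trans ((_ ≫= h2).trans comp_zero)
    have h3 : S.inl ≫ r 0 ≫ τ 0 = 0 := by rw [← Category.assoc, h1, zero_comp]
    exact (congrArg (S.inl ≫ φ.first + ·) h3).trans (add_zero _)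

end

end CategoryTheory.YonedaExtension

/-! ### Coherent sheaves on Noetherian affine schemes -/

namespace AlgebraicGeometry.Scheme.Modules

open TopCat.Sheaf

section

variable {X Y : Scheme.{u}}

theorem isQuasicoherent_of_iso {M N : X.Modules} (e : M ≅ N) (h : M.IsQuasicoherent) :
    N.IsQuasicoherent :=
  ObjectProperty.prop_of_iso (SheafOfModules.isQuasicoherent X.ringCatSheaf) e h

theorem isQuasicoherent_restrict {M : X.Modules} (h : M.IsQuasicoherent) (j : Y ⟶ X)
    [IsOpenImmersion j] : (M.restrict j).IsQuasicoherent :=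
  isQuasicoherent_restrictFunctor j M

theorem IsCoherent.of_iso {M N : X.Modules} (e : M ≅ N) (h : M.IsCoherent) : N.IsCoherent where
  isQuasicoherent := isQuasicoherent_of_iso e h.1
  finite U hU := by
    have := h.2 U hU
    refine Module.Finite.of_surjective
      ({ (e.hom.app U).hom with map_smul' := fun r s => e.hom.app_smul r s } :
        Γ(M, U) →ₗ[Γ(X, U)] Γ(N, U)) ?_
    exact (ConcreteCategory.bijective_of_isIso (e.hom.app U)).2

theorem IsCoherent.restrict {M : X.Modules} (h : M.IsCoherent) (j : Y ⟶ X) [IsOpenImmersion j] :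
    (M.restrict j).IsCoherent where
  isQuasicoherent := isQuasicoherent_restrict h.1 j
  finite U hU := by
    have := h.2 (j ''ᵁ U) (hU.image_of_isOpenImmersion j)
    refine Module.Finite.of_surjective
      ({ toFun := id, map_add' := fun _ _ => rfl, map_smul' := fun r s => ?_ } :
        Γ(M, j ''ᵁ U) →ₛₗ[(j.appIso U).hom.hom] Γ(M.restrict j, U)) Function.surjective_id
    have h : (j.appIso U).inv ((j.appIso U).hom r) = r := CategoryTheory.Iso.hom_inv_id_apply _ r
    exact congrArg (fun r : Γ(X, j ''ᵁ U) => r • s) h.symm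

theorem acyclicOn_of_isAffineOpen [IsLocallyNoetherian X] {M : X.Modules}
    (h : M.IsQuasicoherent) {V : X.Opens} (hV : IsAffineOpen V) : AcyclicOn V M.abSheaf := by
  have : IsNoetherianRing Γ(X, V) := IsLocallyNoetherian.component_noetherian ⟨V, hV⟩
  have h1 : AcyclicOn ⊤ ((resSheaf hV.fromSpec).obj M.abSheaf) :=
    acyclicOn_top_of_isQuasicoherent (M.restrict hV.fromSpec)
      (isQuasicoherent_restrict h hV.fromSpec)
  have h2 : hV.fromSpec ''ᵁ ⊤ = V :=
    (Scheme.Hom.image_top_eq_opensRange _).trans hV.opensRange_fromSpec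
  exact h2 ▸ acyclicOn_of_resSheaf hV.fromSpec h1

end

variable {R : CommRingCat.{u}}

/-- The identity of `R^n` is the sum of the inclusions composed with the projections, so sections
are generated by `n` copies of those of the structure sheaf. This is needed over arbitrary opens
because coherence is tested on all affine ones. -/
instance finite_section_tildeFree (n : ℕ) (U : (Spec R).Opens) :
    Module.Finite Γ(Spec R, U) Γ(tildeFree R n, U) := by
  have : Module.Finite Γ(Spec R, U) Γ(tilde (ModuleCat.of R R), U) :=
    inferInstanceAs (Module.Finite Γ(Spec R, U) Γ(Spec R, U))
  let a (i : Fin n) : ModuleCat.of R R ⟶ ModuleCat.of R (Fin n → R) :=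
    ModuleCat.ofHom (LinearMap.single R (fun _ => R) i)
  let b (i : Fin n) : ModuleCat.of R (Fin n → R) ⟶ ModuleCat.of R R :=
    ModuleCat.ofHom (LinearMap.proj i)
  let a' (i : Fin n) : Γ(tilde (ModuleCat.of R R), U) →ₗ[Γ(Spec R, U)] Γ(tildeFree R n, U) :=
    { ((tilde.map (a i)).app U).hom with map_smul' := fun r s => (tilde.map (a i)).app_smul r s }
  refine Module.Finite.of_surjective (LinearMap.lsum Γ(Spec R, U) _ Γ(Spec R, U) a') fun s => ?_
  refine ⟨fun i => specApp (tilde.map (b i)) U s, ?_⟩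
  rw [LinearMap.lsum_apply, LinearMap.sum_apply]
  refine eq_of_pow_smul_eq_on_specD fun g hg => ?_
  obtain ⟨m, h, hm⟩ := exists_pow_smul_eq_tildeOpen _ g (specRes _ hg s)
  refine ⟨m, ?_⟩
  rw [← specRes_apply, ← specRes_apply, hm, map_sum, Finset.smul_sum]
  have h1 (i : Fin n) : g ^ m • specRes (tildeFree R n) hg
      (specApp (tilde.map (a i)) U (specApp (tilde.map (b i)) U s)) =
      tildeOpen (ModuleCat.of R (Fin n → R)) (specD g) (a i (b i h)) := by
    rw [← specApp_res, ← specApp_res, ← _root_.map_smul, ← _root_.map_smul, hm, specApp_tildeOpen,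
      specApp_tildeOpen]
  refine (Finset.sum_congr rfl fun i _ => h1 i).trans ?_
  rw [← map_sum]
  congr 1
  exact Finset.univ_sum_single (h : Fin n → R)

/-- Over an affine open the kernel of `R^n ⟶ M` has an acyclic sheaf, so sections of `M~` are a
quotient of those of the free sheaf. -/
theorem isCoherent_tilde [IsNoetherianRing R] (M : ModuleCat.{u} R) [Module.Finite R M] :
    (tilde M).IsCoherent where
  isQuasicoherent := inferInstance
  finite U hU := by
    obtain ⟨n, f, hf⟩ := Module.Finite.exists_fin' R M
    have hS := ((LinearMap.shortExact_shortComplexKer hf).map_of_exact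
      (tilde.functor R)).map_of_exact (toAbSheaf _)
    have h1 : AcyclicOn U (tilde (ModuleCat.of R (LinearMap.ker f))).abSheaf :=
      acyclicOn_of_isAffineOpen inferInstance hU
    have h2 : Function.Surjective ((tilde.map (ModuleCat.ofHom f)).app U) := h1.surjective hS
    exact Module.Finite.of_surjective
      ({ ((tilde.map (ModuleCat.ofHom f)).app U).hom with
          map_smul' := fun r s => (tilde.map (ModuleCat.ofHom f)).app_smul r s } :
        Γ(tildeFree R n, U) →ₗ[Γ(Spec R, U)] Γ(tilde M, U)) h2

/-- The sheaves associated with finitely generated modules. -/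
def tildeFinite (R : CommRingCat.{u}) : ObjectProperty (Spec R).Modules := fun F =>
  ∃ M : ModuleCat.{u} R, Module.Finite R M ∧ Nonempty (tilde M ≅ F)

/-- Free sheaves of modules of finite rank. -/
def isFiniteFree (R : CommRingCat.{u}) : ObjectProperty (Spec R).Modules := fun F =>
  ∃ n : ℕ, Nonempty (tildeFree R n ≅ F)

theorem isCoherent_of_tildeFinite [IsNoetherianRing R] {F : (Spec R).Modules}
    (h : tildeFinite R F) : F.IsCoherent := by
  obtain ⟨M, _, ⟨e⟩⟩ := h
  exact (isCoherent_tilde M).of_iso e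

theorem IsCoherent.tildeFinite {F : (Spec R).Modules} (h : F.IsCoherent) : tildeFinite R F := by
  have := h.1
  have : IsIso F.fromTildeΓ := isIso_fromTildeΓ_of_isQuasicoherent F
  refine ⟨_, ?_, ⟨asIso F.fromTildeΓ⟩⟩
  have h1 := h.2 ⊤ (isAffineOpen_top _)
  refine Module.Finite.of_surjective
    ({ toFun := id, map_add' := fun _ _ => rfl, map_smul' := fun r s => ?_ } :
      Γ(F, ⊤) →ₛₗ[(Scheme.ΓSpecIso R).hom.hom] Γ(F, ⊤)) Function.surjective_id
  have h : (Scheme.ΓSpecIso R).inv ((Scheme.ΓSpecIso R).hom r) = r :=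
    CategoryTheory.Iso.hom_inv_id_apply _ r
  refine (congrArg (fun r : Γ(Spec R, ⊤) => r • s) ?_).symm
  refine Eq.trans ?_ h
  exact ConcreteCategory.congr_hom ((Spec R).presheaf.map_id (op ⊤)) _

theorem hasCover_tildeFinite [IsNoetherianRing R] :
    YonedaExtension.HasCover (tildeFinite R) (isFiniteFree R) := by
  rintro K ⟨M, _, ⟨e⟩⟩
  obtain ⟨n, f, hf⟩ := Module.Finite.exists_fin' R M
  have hS := (LinearMap.shortExact_shortComplexKer hf).map_of_exact (tilde.functor R)
  have w : tilde.map (ModuleCat.ofHom (LinearMap.ker f).subtype) ≫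
      tilde.map (ModuleCat.ofHom f) ≫ e.hom = 0 := by
    rw [← Category.assoc]
    exact ((f.shortComplexKer.map (tilde.functor R)).zero =≫ e.hom).trans zero_comp
  refine ⟨ShortComplex.mk _ _ w, ?_, rfl,
    ⟨_, inferInstanceAs (Module.Finite R (LinearMap.ker f)), ⟨Iso.refl _⟩⟩,
    ⟨_, inferInstanceAs (Module.Finite R (Fin n → R)), ⟨Iso.refl _⟩⟩, ⟨n, ⟨Iso.refl _⟩⟩⟩
  refine ShortComplex.shortExact_of_iso (S₁ := f.shortComplexKer.map (tilde.functor R))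
    (ShortComplex.isoMk (Iso.refl _) (Iso.refl _) e ?_ ?_) hS
  · exact (Category.id_comp _).trans (Category.comp_id _).symm
  · exact Category.id_comp _

/-- The functor `tilde` is full and preserves colimits, so the pushout comes from modules, where it
is a quotient of `M' × M''`. -/
theorem tildeFinite_pushout {F F' F'' : (Spec R).Modules} (f : F ⟶ F') (g : F ⟶ F'')
    (h : tildeFinite R F) (h' : tildeFinite R F') (h'' : tildeFinite R F'') :
    tildeFinite R (pushout f g) := by
  obtain ⟨M, _, ⟨e⟩⟩ := h
  obtain ⟨M', _, ⟨e'⟩⟩ := h'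
  obtain ⟨M'', _, ⟨e''⟩⟩ := h''
  obtain ⟨f₀, hf₀⟩ := (tilde.functor R).map_surjective (e.hom ≫ f ≫ e'.inv)
  obtain ⟨g₀, hg₀⟩ := (tilde.functor R).map_surjective (e.hom ≫ g ≫ e''.inv)
  replace hf₀ : tilde.map f₀ = e.hom ≫ f ≫ e'.inv := hf₀
  replace hg₀ : tilde.map g₀ = e.hom ≫ g ≫ e''.inv := hg₀
  have h₁ : tilde.map f₀ ≫ e'.hom = e.hom ≫ f := by simp [hf₀]
  have h₂ : tilde.map g₀ ≫ e''.hom = e.hom ≫ g := by simp [hg₀]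
  have i₁ : tilde (pushout f₀ g₀) ≅ pushout (tilde.map f₀) (tilde.map g₀) :=
    (PreservesPushout.iso (tilde.functor R) f₀ g₀).symm
  have i₂ : pushout (tilde.map f₀) (tilde.map g₀) ≅ pushout f g :=
    asIso (pushout.map (tilde.map f₀) (tilde.map g₀) f g e'.hom e''.hom e.hom h₁ h₂)
  refine ⟨pushout f₀ g₀, ?_, ⟨i₁ ≪≫ i₂⟩⟩
  let π : (M' × M'') →ₗ[R] (pushout f₀ g₀ : ModuleCat.{u} R) :=
    LinearMap.coprod (pushout.inl f₀ g₀).hom (pushout.inr f₀ g₀).hom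
  refine Module.Finite.of_surjective π ?_
  refine (ModuleCat.epi_iff_surjective (ModuleCat.ofHom π)).1 ⟨fun {Z} a b hab => ?_⟩
  apply pushout.hom_ext
  · ext x
    have := ConcreteCategory.congr_hom hab ((x, 0) : M' × M'')
    simpa [π] using this
  · ext x
    have := ConcreteCategory.congr_hom hab ((0, x) : M' × M'')
    simpa [π] using this

end AlgebraicGeometry.Scheme.Modules

/-! ### Restricted injective resolutions and lifting from free sheaves -/

namespace TopCat.Sheaf

theorem exists_iCycles_eq {X : TopCat.{u}} {V : Opens X}
    (K : CochainComplex (TopCat.Sheaf Ab.{u} X) ℕ) (p : ℕ) (s : (K.X p).obj.obj (op V))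
    (hs : (K.d p (p + 1)).hom.app (op V) s = 0) :
    ∃ w : (K.cycles p).obj.obj (op V), (K.iCycles p).hom.app (op V) w = s := by
  let S := ShortComplex.mk (K.iCycles p) (K.d p (p + 1)) (K.iCycles_d p (p + 1))
  have hS : S.Exact := ShortComplex.exact_of_f_is_kernel _ (K.cyclesIsKernel p (p + 1) (by simp))
  exact Sheaf.sections_exact_of_left_exact hS (inferInstanceAs (Mono (K.iCycles p))) s hs

end TopCat.Sheaf

namespace AlgebraicGeometry.Scheme.Modules

open TopCat.Sheaf

section

variable {X Y : Scheme.{u}}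

/-- The morphism `a` makes `J` an injective resolution of `G`. -/
structure IsInjectiveResolution {G : X.Modules} (J : CochainComplex X.Modules ℕ)
    (a : G ⟶ J.X 0) : Prop where
  injective (n : ℕ) : Injective (J.X n)
  exactAt (n : ℕ) : J.ExactAt (n + 1)
  mono : Mono a
  w : a ≫ J.d 0 1 = 0
  exact : (ShortComplex.mk a (J.d 0 1) w).Exact

theorem isInjectiveResolution_augmentation (G : X.Modules) :
    IsInjectiveResolution (injectiveResolution G).cocomplex (augmentation G) where
  injective := (injectiveResolution G).injective
  exactAt n := (injectiveResolution G).cocomplex_exactAt_succ n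
  mono := inferInstanceAs (Mono ((injectiveResolution G).ι.f 0))
  w := (injectiveResolution G).ι_f_zero_comp_complex_d
  exact := (injectiveResolution G).exact₀

/-- The restriction of a complex of modules. -/
noncomputable abbrev restrictComplex (j : Y ⟶ X) [IsOpenImmersion j] (J : CochainComplex X.Modules ℕ) :
    CochainComplex Y.Modules ℕ :=
  ((restrictFunctor j).mapHomologicalComplex (ComplexShape.up ℕ)).obj J

variable {F G : X.Modules} {J : CochainComplex X.Modules ℕ} {a : G ⟶ J.X 0}

theorem IsInjectiveResolution.restrict (h : IsInjectiveResolution J a) (j : Y ⟶ X)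
    [IsOpenImmersion j] :
    IsInjectiveResolution (G := G.restrict j) (restrictComplex j J) ((restrictFunctor j).map a) where
  injective n := have := h.injective n; injective_restrict j (J.X n)
  exactAt n := ShortComplex.Exact.map (h.exactAt n) (restrictFunctor j)
  mono := have := h.mono; (restrictFunctor j).map_mono a
  w := (Functor.map_comp _ _ _).symm.trans ((congrArg _ h.w).trans (Functor.map_zero _ _ _))
  exact := h.exact.map (restrictFunctor j)

theorem IsInjectiveResolution.isKernelOf (h : IsInjectiveResolution J a) :
    YonedaExtension.IsKernelOf a (J.d 0 1) :=
  have := h.mono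
  ⟨h.mono, h.w, fun t ht => ⟨h.exact.lift t ht, h.exact.lift_f t ht⟩⟩

theorem IsInjectiveResolution.exact_succ (h : IsInjectiveResolution J a) (k : ℕ) :
    ∃ w : J.d k (k + 1) ≫ J.d (k + 1) (k + 1 + 1) = 0, (ShortComplex.mk _ _ w).Exact :=
  ⟨J.d_comp_d _ _ _, (J.exactAt_iff' k (k + 1) (k + 1 + 1) (by simp) (by simp)).1 (h.exactAt k)⟩

/-- The complex of homomorphisms depends only on the isomorphism class of the first variable. -/
noncomputable def homComplexIso {F F' : X.Modules} (e : F ≅ F') (J : CochainComplex X.Modules ℕ) :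
    homComplex F J ≅ homComplex F' J where
  hom := homComplexMap e.inv J
  inv := homComplexMap e.hom J
  hom_inv_id := by
    have : homComplexMap e.inv J ≫ homComplexMap e.hom J = homComplexMap (e.hom ≫ e.inv) J := rfl
    rw [this, e.hom_inv_id]
    rfl
  inv_hom_id := by
    have : homComplexMap e.hom J ≫ homComplexMap e.inv J = homComplexMap (e.inv ≫ e.hom) J := rfl
    rw [this, e.inv_hom_id]
    rfl

end

section

variable {R : CommRingCat.{u}} [IsNoetherianRing R] {F G : (Spec R).Modules}
  {J : CochainComplex (Spec R).Modules ℕ} {a : G ⟶ J.X 0}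

theorem IsInjectiveResolution.acyclicOn_homology (h : IsInjectiveResolution J a)
    (hG : G.IsQuasicoherent) (hF : tildeFinite R F) (p : ℕ) :
    AcyclicOn ⊤ ((homComplex F J).homology p) := by
  obtain ⟨M, _, ⟨e⟩⟩ := hF
  have := h.mono
  exact .of_iso ((HomologicalComplex.homologyFunctor _ _ p).mapIso (homComplexIso e J))
    (acyclicOn_homology_homComplex hG J h.injective h.exactAt a h.w h.exact p M)

/-- For free `P`, `𝓗om(P, J)` has no homology in degree `k + 1`, so `x` is locally a coboundary. It
is one globally because the cycles of degree `k` are acyclic. -/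
theorem IsInjectiveResolution.exists_lift (h : IsInjectiveResolution J a)
    (hG : G.IsQuasicoherent) {P : (Spec R).Modules} (hP : isFiniteFree R P) (k : ℕ)
    (x : P ⟶ J.X (k + 1)) (hx : x ≫ J.d (k + 1) (k + 1 + 1) = 0) : ∃ y, y ≫ J.d k (k + 1) = x := by
  obtain ⟨n, ⟨e⟩⟩ := hP
  suffices ∃ t : localHom (tildeFree R n) (J.X k) ⊤,
      localHomPostcomp (J.d k (k + 1)) ⊤ t = localHomOfHom (e.hom ≫ x) ⊤ by
    obtain ⟨t, ht⟩ := this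
    refine ⟨e.inv ≫ homMk (fun V => t.1 ⟨V, le_top (a := V)⟩) (fun V => t.2.1 ⟨V, le_top (a := V)⟩)
      (fun V W h s => t.2.2 ⟨V, le_top (a := V)⟩ ⟨W, le_top (a := W)⟩ h s), ?_⟩
    rw [Category.assoc, Iso.inv_comp_eq]
    exact hom_ext_apply fun V s => DFunLike.congr_fun
      (congrFun (congrArg Subtype.val ht) ⟨V, le_top (a := V)⟩) s
  let K := homComplex (tildeFree R n) J
  have hf : tildeFinite R (tildeFree R n) :=
    ⟨_, inferInstanceAs (Module.Finite R (Fin n → R)), ⟨Iso.refl _⟩⟩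
  have hK (m : ℕ) : AcyclicOn ⊤ (K.X m) :=
    have := h.injective m
    .of_isFlasque ((homSheaf (tildeFree R n)).obj (J.X m))
  obtain ⟨w, hw⟩ := exists_iCycles_eq K (k + 1) (V := ⊤) (localHomOfHom (e.hom ≫ x) ⊤) (by
    have h1 : (e.hom ≫ x) ≫ J.d (k + 1) (k + 1 + 1) = 0 := by rw [Category.assoc, hx, comp_zero]
    exact congrArg (fun ψ => localHomOfHom ψ ⊤) h1)
  have hz : IsZero (K.homology (k + 1)) := isZero_homology_homComplex_tildeFree n J (h.exactAt k)
  obtain ⟨t, ht⟩ := exists_toCycles_eq (.cycles hK (h.acyclicOn_homology hG hf) k) w (by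
    rw [hz.eq_of_tgt (K.homologyπ (k + 1)) 0]
    rfl)
  refine ⟨t, Eq.trans ?_ hw⟩
  rw [← ht]
  exact (ConcreteCategory.congr_hom (congrArg (fun f => f.hom.app (op ⊤))
    (K.toCycles_i k (k + 1))) t).symm

end

section

variable {X : Scheme.{u}} [IsLocallyNoetherian X] {F G : X.Modules}

theorem acyclicOn_extSheaf (hF : F.IsCoherent) (hG : G.IsCoherent) (p : ℕ) {V : X.Opens}
    (hV : IsAffineOpen V) : AcyclicOn V (extSheaf F G p) := by
  have : IsNoetherianRing Γ(X, V) := IsLocallyNoetherian.component_noetherian ⟨V, hV⟩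
  have h1 : AcyclicOn ⊤ ((resSheaf hV.fromSpec).obj (extSheaf F G p)) :=
    .of_iso (resSheafHomology hV.fromSpec F (injectiveResolution G).cocomplex p).symm
      (((isInjectiveResolution_augmentation G).restrict hV.fromSpec).acyclicOn_homology
        (isQuasicoherent_restrict hG.1 _) (hF.restrict hV.fromSpec).tildeFinite p)
  have h2 : hV.fromSpec ''ᵁ ⊤ = V :=
    (Scheme.Hom.image_top_eq_opensRange _).trans hV.opensRange_fromSpec
  exact h2 ▸ acyclicOn_of_resSheaf hV.fromSpec h1

end

end AlgebraicGeometry.Scheme.Modules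

/-! ### Classes of extensions in terms of cocycles; iterated restriction -/

namespace AlgebraicGeometry.Scheme.Modules

open TopCat.Sheaf

variable {X Y : Scheme.{u}} {F G : X.Modules} {n : ℕ}

/-- The restriction of the injective resolution of `G`. -/
noncomputable abbrev resolutionD (G : X.Modules) (j : Y ⟶ X) [IsOpenImmersion j] (k : ℕ) :
    ((injectiveResolution G).cocomplex.X k).restrict j ⟶
      ((injectiveResolution G).cocomplex.X (k + 1)).restrict j :=
  (restrictFunctor j).map ((injectiveResolution G).cocomplex.d k (k + 1))

/-- The local homomorphism underlying a cocycle. -/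
noncomputable def cocycleHom {U : X.Opens} (w : ((extComplex F G).cycles n).obj.obj (op U)) :
    localHom F ((injectiveResolution G).cocomplex.X n) U :=
  ((extComplex F G).iCycles n).hom.app (op U) w

theorem localHomPostcomp_cocycleHom {U : X.Opens}
    (w : ((extComplex F G).cycles n).obj.obj (op U)) :
    localHomPostcomp ((injectiveResolution G).cocomplex.d n (n + 1)) U (cocycleHom w) = 0 :=
  ConcreteCategory.congr_hom (congrArg (fun f => f.hom.app (op U))
    ((extComplex F G).iCycles_d n (n + 1))) w

theorem localHomToHom_cocycleHom_comp {U : X.Opens}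
    (w : ((extComplex F G).cycles n).obj.obj (op U)) (j : Y ⟶ X) [IsOpenImmersion j]
    (h : j.opensRange ≤ U) :
    localHomToHom j h (cocycleHom w) ≫ resolutionD G j n = 0 :=
  (localHomToHom_postcomp _ j h (cocycleHom w)).symm.trans
    (congrArg (localHomToHom j h) (localHomPostcomp_cocycleHom w))

/-- The section `z` is eliminated, being determined by `w`, and the rest is phrased as morphisms of
restrictions, to which the abstract construction of extensions applies. -/
theorem hasExtClass_iff {U : X.Opens}
    (S : YonedaExtension (n + 1) (F.restrict U.ι) (G.restrict U.ι))
    (e : (extSheaf F G (n + 1)).obj.obj (op U)) : HasExtClass S e ↔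
    ∃ (φ : S.MapTo (resolutionD G U.ι)) (w : ((extComplex F G).cycles (n + 1)).obj.obj (op U)),
      S.inl ≫ φ.first = (restrictFunctor U.ι).map (augmentation G) ∧
      φ.last = localHomToHom U.ι U.opensRange_ι.le (cocycleHom w) ∧
      ((extComplex F G).homologyπ (n + 1)).hom.app (op U) w = e := by
  constructor
  · rintro ⟨φ, z, w, h₁, h₂, h₃, rfl, h₅⟩
    refine ⟨⟨φ, h₂⟩, w, ?_, hom_ext_apply fun W s => ?_, h₅⟩
    · exact (Category.assoc _ _ _).trans ((Iso.inv_comp_eq _).2 h₁)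
    · exact (h₃ W _ s).symm
  · rintro ⟨φ, w, h₁, h₂, h₃⟩
    refine ⟨φ.φ, cocycleHom w, w, ?_, φ.comm, fun W hW s => ?_, rfl, h₃⟩
    · exact (Iso.inv_comp_eq _).1 ((Category.assoc _ _ _).symm.trans h₁)
    · exact (congrArg (fun f => f.app W s) h₂).symm

/-- Iterated restriction. -/
noncomputable def restrictIso {Z : Scheme.{u}} {k : Z ⟶ Y} {j : Y ⟶ X} {i : Z ⟶ X}
    [IsOpenImmersion k] [IsOpenImmersion j] [IsOpenImmersion i] (h : k ≫ j = i) :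
    restrictFunctor j ⋙ restrictFunctor k ≅ restrictFunctor i :=
  (restrictFunctorComp k j).symm ≪≫ restrictFunctorCongr h

section

variable {Z : Scheme.{u}} {k : Z ⟶ Y} {j : Y ⟶ X} {i : Z ⟶ X}
    [IsOpenImmersion k] [IsOpenImmersion j] [IsOpenImmersion i]

theorem image_image_of_comp_eq (h : k ≫ j = i) (W : Z.Opens) : j ''ᵁ (k ''ᵁ W) = i ''ᵁ W := by
  subst h
  exact (Scheme.Hom.comp_image ..).symm

theorem restrictIso_hom_app (h : k ≫ j = i) (M : X.Modules) (W : Z.Opens) (s : Γ(M, j ''ᵁ (k ''ᵁ W))) :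
    ((restrictIso h).hom.app M).app W s = M.res (image_image_of_comp_eq h W).ge s :=
  M.res_res (W' := i ''ᵁ W) (W := (k ≫ j) ''ᵁ W) _ _ s

theorem restrictIso_hom_localHomToHom (h : k ≫ j = i) {U V : X.Opens} (hV : j.opensRange ≤ V)
    (hU : i.opensRange ≤ U) (hUV : U ≤ V) (z : localHom F G V) :
    (restrictFunctor k).map (localHomToHom j hV z) ≫ (restrictIso h).hom.app G =
      (restrictIso h).hom.app F ≫ localHomToHom i hU ((homPresheaf F G).map (homOfLE hUV).op z) := by
  refine hom_ext_apply fun W s => ?_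
  refine (restrictIso_hom_app h G W _).trans ?_
  refine Eq.trans ?_ (congrArg (z.1 ⟨i ''ᵁ W, ((image_le i W).trans hU).trans hUV⟩)
    (restrictIso_hom_app h F W s).symm)
  exact (localHom_res z ((image_le j _).trans hV) (image_image_of_comp_eq h W).ge s).symm

end

end AlgebraicGeometry.Scheme.Modules

/-! ### Extensions over affine open sets and the theorem -/

namespace AlgebraicGeometry.Scheme.Modules

open TopCat.Sheaf

variable {X Y : Scheme.{u}} {F G : X.Modules} {n : ℕ}

/-- Restriction of sections of an abelian sheaf. -/
noncomputable abbrev resSection (A : TopCat.Sheaf Ab.{u} X) {V U : X.Opens} (h : U ≤ V)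
    (s : A.obj.obj (op V)) : A.obj.obj (op U) := A.obj.map (homOfLE h).op s

theorem app_resSection {A B : TopCat.Sheaf Ab.{u} X} (f : A ⟶ B) {V U : X.Opens} (h : U ≤ V)
    (s : A.obj.obj (op V)) :
    f.hom.app (op U) (resSection A h s) = resSection B h (f.hom.app (op V) s) :=
  ConcreteCategory.congr_hom (f.hom.naturality (homOfLE h).op) s

theorem cocycleHom_resSection {V U : X.Opens} (h : U ≤ V)
    (w : ((extComplex F G).cycles n).obj.obj (op V)) :
    cocycleHom (resSection _ h w) =
      (homPresheaf F ((injectiveResolution G).cocomplex.X n)).map (homOfLE h).op (cocycleHom w) :=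
  app_resSection ((extComplex F G).iCycles n) h w

theorem acyclicOn_extComplex_X (F G : X.Modules) (V : X.Opens) (m : ℕ) :
    AcyclicOn V ((extComplex F G).X m) :=
  .of_isFlasque ((homSheaf F).obj ((injectiveResolution G).cocomplex.X m))

section

variable [IsLocallyNoetherian X] {V : X.Opens}

/-- Over an affine open subset, a cocycle with values in the injective resolution comes from an
extension with coherent terms. -/
theorem exists_extension_fromSpec (hF : F.IsCoherent) (hG : G.IsCoherent) (hV : IsAffineOpen V)
    (w : ((extComplex F G).cycles (n + 1)).obj.obj (op V)) :
    ∃ (S : YonedaExtension (n + 1) (F.restrict hV.fromSpec) (G.restrict hV.fromSpec))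
      (φ : S.MapTo (resolutionD G hV.fromSpec)), (∀ k, (S.seq.obj k).IsCoherent) ∧
      S.inl ≫ φ.first = (restrictFunctor hV.fromSpec).map (augmentation G) ∧
      φ.last = localHomToHom hV.fromSpec hV.opensRange_fromSpec.le (cocycleHom w) := by
  have : IsNoetherianRing Γ(X, V) := IsLocallyNoetherian.component_noetherian ⟨V, hV⟩
  have hJ := (isInjectiveResolution_augmentation G).restrict hV.fromSpec
  obtain ⟨S, φ, h₁, h₂, h₃⟩ := YonedaExtension.exists_extension_mapTo
    (hasCover_tildeFinite (R := Γ(X, V))) (n := n)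
    (fun f g => tildeFinite_pushout f g) (resolutionD G hV.fromSpec)
    (fun P hP k x hx => hJ.exists_lift (isQuasicoherent_restrict hG.1 _) hP k x hx)
    (hG.restrict hV.fromSpec).tildeFinite ((restrictFunctor hV.fromSpec).map (augmentation G))
    hJ.w (hJ.isKernelOf.2.2) (hF.restrict hV.fromSpec).tildeFinite
    (localHomToHom hV.fromSpec hV.opensRange_fromSpec.le (cocycleHom w))
    (localHomToHom_cocycleHom_comp w _ _)
  exact ⟨S, φ, fun k => isCoherent_of_tildeFinite (h₁ k), h₂, h₃⟩

/-- The class lifts to a cocycle over the affine `V`, which gives an extension on `Spec Γ(X, V)`.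
Since `U` is an open subscheme of that spectrum, the extension is restricted along `U ⟶ Spec Γ(X,
V)`; `U` itself need not be affine. -/
theorem exists_hasExtClass_resSection (hF : F.IsCoherent) (hG : G.IsCoherent) (hV : IsAffineOpen V)
    (e : (extSheaf F G (n + 1)).obj.obj (op V)) {U : X.Opens}
    (hUV : U ≤ V) : ∃ S : YonedaExtension (n + 1) (F.restrict U.ι) (G.restrict U.ι),
      (∀ k, (S.seq.obj k).IsCoherent) ∧ HasExtClass S (resSection _ hUV e) := by
  obtain ⟨w, rfl⟩ := surjective_homologyπ (acyclicOn_extComplex_X F G V)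
    (fun m => acyclicOn_extSheaf hF hG m hV) (n + 1) e
  obtain ⟨S, φ, h₁, h₂, h₃⟩ := exists_extension_fromSpec hF hG hV w
  let j := hV.fromSpec
  have hle : Set.range U.ι ⊆ Set.range j := by
    rw [U.range_ι, hV.range_fromSpec]; exact hUV
  let k : U.toScheme ⟶ Spec Γ(X, V) := IsOpenImmersion.lift j U.ι hle
  have hk : k ≫ j = U.ι := IsOpenImmersion.lift_fac j U.ι hle
  have : IsOpenImmersion k := by
    have : IsOpenImmersion (k ≫ j) := hk ▸ inferInstance
    exact IsOpenImmersion.of_comp k j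
  let ε := restrictIso hk
  refine ⟨S.mapExact (restrictFunctor k) (ε.app F) (ε.app G), fun i => (h₁ i).restrict k, ?_⟩
  rw [hasExtClass_iff]
  refine ⟨φ.mapExact (restrictFunctor k) (ε.app F) (ε.app G)
    (fun m => ε.app ((injectiveResolution G).cocomplex.X m))
    (fun m => ε.hom.naturality ((injectiveResolution G).cocomplex.d m (m + 1))),
    resSection _ hUV w, ?_, ?_, ?_⟩
  · rw [YonedaExtension.MapTo.mapExact_inl_first, Iso.inv_comp_eq, h₂]
    exact ε.hom.naturality (augmentation G)
  · rw [YonedaExtension.MapTo.mapExact_last, Iso.inv_comp_eq, h₃, cocycleHom_resSection]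
    exact restrictIso_hom_localHomToHom hk hV.opensRange_fromSpec.le U.opensRange_ι.le hUV _
  · exact app_resSection ((extComplex F G).homologyπ (n + 1)) hUV w

/-- The two cocycles differ by `d t` with `t` defined on all of `V`, because the cycles one degree
lower are acyclic there. A homotopy then moves the second extension's map onto the cocycle of the
first. -/
theorem equivalent_of_hasExtClass (hF : F.IsCoherent) (hG : G.IsCoherent) (hV : IsAffineOpen V)
    {e : (extSheaf F G (n + 1)).obj.obj (op V)}
    {S S' : YonedaExtension (n + 1) (F.restrict V.ι) (G.restrict V.ι)} (h : HasExtClass S e)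
    (h' : HasExtClass S' e) : S.Equivalent S' := by
  obtain ⟨φ, w, h₁, h₂, h₃⟩ := (hasExtClass_iff S e).1 h
  obtain ⟨φ', w', h₁', h₂', h₃'⟩ := (hasExtClass_iff S' e).1 h'
  obtain ⟨t, ht⟩ := exists_toCycles_eq (AcyclicOn.cycles (acyclicOn_extComplex_X F G V)
    (fun m => acyclicOn_extSheaf hF hG m hV) n) (w - w') (by
      refine (map_sub _ w w').trans ?_
      exact sub_eq_zero.2 (h₃.trans h₃'.symm))
  let t' : localHom F ((injectiveResolution G).cocomplex.X n) V := t
  have ht' : localHomPostcomp ((injectiveResolution G).cocomplex.d n (n + 1)) V t' =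
      cocycleHom w - cocycleHom w' := by
    refine Eq.trans ?_ (map_sub (((extComplex F G).iCycles (n + 1)).hom.app (op V)).hom w w')
    rw [← ht]
    exact (ConcreteCategory.congr_hom (congrArg (fun f => f.hom.app (op V))
      ((extComplex F G).toCycles_i n (n + 1))) t).symm
  obtain ⟨ψ, hψ, hψ'⟩ := φ'.exists_homotopic (localHomToHom V.ι V.opensRange_ι.le t')
  have hJ := (isInjectiveResolution_augmentation G).restrict V.ι
  refine YonedaExtension.equivalent_of_mapTo (Nat.succ_ne_zero n) hJ.exact_succ hJ.isKernelOf φ ψ h₁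
    (hψ'.trans h₁') ?_ ?_
  · have h1 : cocycleHom w = cocycleHom w' +
        localHomPostcomp ((injectiveResolution G).cocomplex.d n (n + 1)) V t' := by
      rw [ht', add_sub_cancel]
    exact h₂.trans ((congrArg (localHomToHom V.ι V.opensRange_ι.le) h1).trans
      (hψ.trans (congrArg (· + _) h₂')).symm)
  · exact (h₂ =≫ resolutionD G V.ι (n + 1)).trans
      (localHomToHom_cocycleHom_comp w V.ι V.opensRange_ι.le)

end

end AlgebraicGeometry.Scheme.Modules

theorem TopCat.Sheaf.isAffineOpen_cechOpen {X : Scheme.{u}} [X.IsSeparated] {I : Type u}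
    {U : I → X.Opens} (hU : ∀ i, IsAffineOpen (U i)) {q : ℕ} (α : Fin (q + 1) → I) :
    IsAffineOpen (TopCat.Sheaf.cechOpen U α) :=
  IsAffineOpen.iInf fun j => hU (α j)

theorem mainTheorem9 (X : Scheme.{u}) [AlgebraicGeometry.IsNoetherian X] [X.IsSeparated]
    {I : Type u} (U : I → X.Opens) (hU : ⨆ i, U i = ⊤)
    (hfine : ∀ i, ∃ V : X.Opens, IsAffineOpen V ∧ U i ≤ V)
    (F G : X.Modules) (hF : F.IsCoherent) (hG : G.IsCoherent)
    (p q : ℕ) (hp : 0 < p) (x : Sheaf.H (Scheme.Modules.extSheaf F G p) q) :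
    (∃ c : TopCat.Sheaf.CechCochain (Scheme.Modules.extSheaf F G p) U q,
      TopCat.Sheaf.CechRepresents U q _ c x ∧
      ∀ α : Fin (q + 1) → I, ∃ S : YonedaExtension p
          (F.restrict (Scheme.Opens.ι (TopCat.Sheaf.cechOpen U α)))
          (G.restrict (Scheme.Opens.ι (TopCat.Sheaf.cechOpen U α))),
        (∀ k, Scheme.Modules.IsCoherent (S.seq.obj k)) ∧ Scheme.Modules.HasExtClass S (c α)) ∧
    ((∀ i, IsAffineOpen (U i)) →
      ∀ c : TopCat.Sheaf.CechCochain (Scheme.Modules.extSheaf F G p) U q,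
        TopCat.Sheaf.CechRepresents U q _ c x →
        ∀ α : Fin (q + 1) → I,
          (∃ S : YonedaExtension p
              (F.restrict (Scheme.Opens.ι (TopCat.Sheaf.cechOpen U α)))
              (G.restrict (Scheme.Opens.ι (TopCat.Sheaf.cechOpen U α))),
            (∀ k, Scheme.Modules.IsCoherent (S.seq.obj k)) ∧
              Scheme.Modules.HasExtClass S (c α)) ∧
          ∀ S S' : YonedaExtension p
              (F.restrict (Scheme.Opens.ι (TopCat.Sheaf.cechOpen U α)))
              (G.restrict (Scheme.Opens.ι (TopCat.Sheaf.cechOpen U α))),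
            Scheme.Modules.HasExtClass S (c α) → Scheme.Modules.HasExtClass S' (c α) →
              S.Equivalent S') := by
  obtain ⟨n, rfl⟩ := Nat.exists_eq_succ_of_ne_zero hp.ne'
  refine ⟨?_, fun hU' c _ α => ⟨?_, fun S S' h h' => ?_⟩⟩
  · choose V hV hUV using hfine
    have hV' {q : ℕ} (α : Fin (q + 1) → I) := TopCat.Sheaf.isAffineOpen_cechOpen hV α
    obtain ⟨c, hc⟩ := TopCat.Sheaf.exists_cechRepresents V q (Scheme.Modules.extSheaf F G (n + 1))
      (fun _ α => Scheme.Modules.acyclicOn_extSheaf hF hG (n + 1) (hV' α)) x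
    exact ⟨c.refine hUV, hc.refine hUV, fun α =>
      Scheme.Modules.exists_hasExtClass_resSection hF hG (hV' α) (c α) _⟩
  · obtain ⟨S, h₁, h₂⟩ := Scheme.Modules.exists_hasExtClass_resSection hF hG
      (TopCat.Sheaf.isAffineOpen_cechOpen hU' α) (c α) le_rfl
    refine ⟨S, h₁, ?_⟩
    have h : Scheme.Modules.resSection (Scheme.Modules.extSheaf F G (n + 1)) le_rfl (c α) = c α :=
      TopCat.Presheaf.res_self _ _ _
    rwa [h] at h₂
  · exact Scheme.Modules.equivalent_of_hasExtClass hF hG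
      (TopCat.Sheaf.isAffineOpen_cechOpen hU' α) h h'
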